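/- Let $p=(p(n))_{n\ge 0}$ be a probability distribution on $\mathbb N$ with $0<p(0)<1$, $p(0)+p(1)<1$ and mean $\sum_n n\,p(n)=1$. Trees are rooted ordered trees in which every vertex has finitely many children; the set $\mathbb T$ of such trees carries the distance $d(\mathbf t,\mathbf t')=2^{-\sup\{h:\ r_h(\mathbf t)=r_h(\mathbf t')\}}$, where $r_h(\mathbf t)$ is $\mathbf t$ cut at height $h$, and its Borel $\sigma$-field. Let $\tau$ be a (critical) Galton--Watson (GW) tree with offspring distribution $p$: the number of children of the root has law $p$ and, for $n\ge1$, conditionally on the root having $n$ children, the $n$ sub-trees above them are independent and distributed as $\tau$. Let $\tau^*$ be Kesten's tree associated to $p$: the two-type GW tree whose root is special, in which a normal individual has only normal children, their number having law $p$, and a special individual has a number of children with the size-biased law $p^*(n)=n\,p(n)$, one of them, chosen uniformly, being special and the others normal. Let $L_0(\mathbf t)$ denote the number of leaves of $\mathbf t$ (vertices without children), and $|\mathbf t|$ its number of vertices. Let $p_{\{0\}}$ be the law of $\sum_{k=1}^{N-1}(X_k-1)$, where $N$ is geometric, $\mathbb P(N=n)=(1-p(0))^{n-1}p(0)$ for $n\ge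 1$, and $(X_k)_{k\ge1}$ are i.i.d., independent of $N$, with $\mathbb P(X_k=n)=p(n)/(1-p(0))$ for $n\ge1$. Let $d_{\{0\}}$ be the period of $p_{\{0\}}$, i.e. the largest $k$ such that $p_{\{0\}}(k\mathbb N)=1$. Then: (a) $p_{\{0\}}$ also satisfies $0<p_{\{0\}}(0)<1$, $p_{\{0\}}(0)+p_{\{0\}}(1)<1$ and has mean $1$, and $L_0(\tau)$ is distributed as $|\tau_{\{0\}}|$, where $\tau_{\{0\}}$ is a GW tree with offspring distribution $p_{\{0\}}$. (b) $\mathbb P(L_0(\tau)\in[n,n+d_{\{0\}}))>0$ for all large enough $n$, and if $\tau_n$ is a random tree distributed as $\tau$ conditionally on $\{L_0(\tau)\in[n,n+d_{\{0\}})\}$ (for every $n$ for which this event has positive probability), then $\tau_n\to\tau^*$ in distribution in $(\mathbb T,d)$ as $n\to\infty$. (c) $\mathbb P(L_0(\tau)\ge n)>0$ for all $n$, and if $\tau_n$ is a random tree distributed as $\tau$ conditionally on $\{L_0(\tau)\ge n\}$, then $\tau_n\to\tau^*$ in distribution in $(\mathbb T,d)$ as $n\to\infty$. -/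

import Mathlib

open MeasureTheory ProbabilityTheory Filter
open scoped ENNReal Topology

namespace RandomTree

/-! ### Ordered rooted trees -/

/-- An ordered rooted tree without infinite vertex (Neveu's formalism). Vertices are finite words;
the letters are numbered from `0`, so that the children of a vertex `u` with `k` children are
`u ++ [0], …, u ++ [k - 1]`. -/
@[ext]
structure PlaneTree where
  /-- the set of vertices -/
  nodes : Set (List ℕ)
  root_mem : [] ∈ nodes
  parent_mem : ∀ (u : List ℕ) (i : ℕ), u ++ [i] ∈ nodes → u ∈ nodes
  children : ∀ u ∈ nodes, ∃ k : ℕ, ∀ i : ℕ, u ++ [i] ∈ nodes ↔ i < k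

namespace PlaneTree

/-- The number of children of `u` in `t`. -/
noncomputable def outdegree (t : PlaneTree) (u : List ℕ) : ℕ :=
  {i : ℕ | u ++ [i] ∈ t.nodes}.ncard

/-- The set of leaves of `t`. -/
def leaves (t : PlaneTree) : Set (List ℕ) :=
  {u | u ∈ t.nodes ∧ t.outdegree u = 0}

/-- The number of leaves of `t` (possibly infinite). -/
noncomputable def numLeaves (t : PlaneTree) : ℕ∞ := t.leaves.encard

/-- The number of vertices of `t` (possibly infinite). -/
noncomputable def size (t : PlaneTree) : ℕ∞ := t.nodes.encard

/-- The sub-tree of `t` above the `i`-th child of the root. (If the root has no such child this is,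
by convention, the tree reduced to its root.) -/
def subtree (i : ℕ) (t : PlaneTree) : PlaneTree where
  nodes := {v | v = [] ∨ i :: v ∈ t.nodes}
  root_mem := Or.inl rfl
  parent_mem := by
    rintro u j (h | h)
    · simp at h
    · exact Or.inr (t.parent_mem (i :: u) j (by simpa using h))
  children := by
    intro u hu
    by_cases hi : i :: u ∈ t.nodes
    · obtain ⟨k, hk⟩ := t.children _ hi
      exact ⟨k, fun j => by simpa using hk j⟩
    · refine ⟨0, fun j => ?_⟩
      simp only [Set.mem_ofPred_eq, List.append_eq_nil_iff, List.cons_ne_self, and_false, false_or,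
        Nat.not_lt_zero, iff_false]
      exact fun h => hi (t.parent_mem (i :: u) j (by simpa using h))

/-- The restriction `r_h(t)`: the tree `t` cut at height `h`. -/
def restrict (h : ℕ) (t : PlaneTree) : PlaneTree where
  nodes := {u | u ∈ t.nodes ∧ u.length ≤ h}
  root_mem := ⟨t.root_mem, by simp⟩
  parent_mem := by
    rintro u i ⟨h1, h2⟩
    refine ⟨t.parent_mem u i h1, ?_⟩
    simp only [List.length_append, List.length_singleton] at h2
    omega
  children := by
    rintro u ⟨hu, _⟩
    by_cases hl : u.length + 1 ≤ h
    · obtain ⟨k, hk⟩ := t.children u hu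
      exact ⟨k, fun i => by simp [hk i, hl]⟩
    · exact ⟨0, fun i => by simp [hl]⟩

/-! ### The local topology -/

theorem restrict_mono {s t : PlaneTree} {h k : ℕ} (hk : k ≤ h)
    (e : restrict h s = restrict h t) : restrict k s = restrict k t := by
  have e' : ∀ u, (u ∈ s.nodes ∧ u.length ≤ h) ↔ (u ∈ t.nodes ∧ u.length ≤ h) := fun u =>
    Set.ext_iff.1 (congrArg nodes e) u
  ext u
  change (u ∈ s.nodes ∧ u.length ≤ k) ↔ (u ∈ t.nodes ∧ u.length ≤ k)
  have := e' u
  constructor <;> rintro ⟨h1, h2⟩ <;> have := h2.trans hk <;> tauto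

theorem restrict_zero (s t : PlaneTree) : restrict 0 s = restrict 0 t := by
  ext u
  change (u ∈ s.nodes ∧ u.length ≤ 0) ↔ (u ∈ t.nodes ∧ u.length ≤ 0)
  constructor
  · rintro ⟨_, h2⟩
    obtain rfl : u = [] := List.length_eq_zero_iff.1 (by omega)
    exact ⟨t.root_mem, h2⟩
  · rintro ⟨_, h2⟩
    obtain rfl : u = [] := List.length_eq_zero_iff.1 (by omega)
    exact ⟨s.root_mem, h2⟩

theorem eq_of_forall_restrict {s t : PlaneTree} (H : ∀ h, restrict h s = restrict h t) :
    s = t := by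
  ext u
  have e : (u ∈ s.nodes ∧ u.length ≤ u.length) ↔ (u ∈ t.nodes ∧ u.length ≤ u.length) :=
    Set.ext_iff.1 (congrArg nodes (H u.length)) u
  simpa using e

/-- The set of heights up to which `s` and `t` agree. -/
def agreement (s t : PlaneTree) : Set ℕ := {h | restrict h s = restrict h t}

theorem agreement_bddAbove {s t : PlaneTree} (hst : s ≠ t) : BddAbove (agreement s t) := by
  by_contra hb
  refine hst (eq_of_forall_restrict fun h => ?_)
  obtain ⟨k, hk, hlt⟩ := not_bddAbove_iff.1 hb h
  exact restrict_mono hlt.le hk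

open Classical in
/-- The distance `d(s, t) = 2 ^ (- sup {h | r_h(s) = r_h(t)})`, which is `0` if `s = t`. -/
noncomputable def treeDist (s t : PlaneTree) : ℝ :=
  if s = t then 0 else ((2 : ℝ) ^ sSup (agreement s t))⁻¹

theorem treeDist_nonneg (s t : PlaneTree) : 0 ≤ treeDist s t := by
  unfold treeDist
  split_ifs <;> positivity

theorem treeDist_le_max (s t u : PlaneTree) :
    treeDist s u ≤ max (treeDist s t) (treeDist t u) := by
  by_cases hst : s = t
  · subst hst; exact le_max_right _ _
  by_cases htu : t = u
  · subst htu; exact le_max_left _ _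
  by_cases hsu : s = u
  · have h0 : treeDist s u = 0 := by simp [treeDist, hsu]
    rw [h0]
    exact le_max_of_le_left (treeDist_nonneg _ _)
  have ha : sSup (agreement s t) ∈ agreement s t :=
    Nat.sSup_mem ⟨0, restrict_zero s t⟩ (agreement_bddAbove hst)
  have hb : sSup (agreement t u) ∈ agreement t u :=
    Nat.sSup_mem ⟨0, restrict_zero t u⟩ (agreement_bddAbove htu)
  have hc : min (sSup (agreement s t)) (sSup (agreement t u)) ≤ sSup (agreement s u) :=
    le_csSup (agreement_bddAbove hsu)
      ((restrict_mono (min_le_left _ _) ha).trans (restrict_mono (min_le_right _ _) hb))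
  have key : ∀ m : ℕ, m ≤ sSup (agreement s u) →
      ((2 : ℝ) ^ sSup (agreement s u))⁻¹ ≤ ((2 : ℝ) ^ m)⁻¹ := fun m hm =>
    inv_anti₀ (by positivity) (pow_le_pow_right₀ (by norm_num) hm)
  simp only [treeDist, hst, htu, hsu, if_false]
  rcases min_le_iff.1 hc with h | h
  · exact le_max_of_le_left (key _ h)
  · exact le_max_of_le_right (key _ h)

noncomputable instance : MetricSpace PlaneTree where
  dist := treeDist
  dist_self s := by simp [treeDist]
  dist_comm s t := by
    have h : agreement s t = agreement t s := Set.ext fun _ => eq_comm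
    by_cases hst : s = t
    · subst hst; rfl
    · simp only [treeDist, h, hst, Ne.symm hst, if_false]
  dist_triangle s t u := (treeDist_le_max s t u).trans
    (max_le_add_of_nonneg (treeDist_nonneg _ _) (treeDist_nonneg _ _))
  eq_of_dist_eq_zero {s t} h := by
    by_contra hst
    have h' : treeDist s t = 0 := h
    simp [treeDist, hst] at h'

noncomputable instance : MeasurableSpace PlaneTree := borel PlaneTree

instance : BorelSpace PlaneTree := ⟨rfl⟩

/-- The tree in which every vertex `u` has `κ u` children. -/
def ofDegrees (κ : List ℕ → ℕ) : PlaneTree where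
  nodes := {u | ∀ (v : List ℕ) (i : ℕ), v ++ [i] <+: u → i < κ v}
  root_mem := by
    intro v i h
    simp at h
  parent_mem := fun u j hu v i hv => hu v i (hv.trans (List.prefix_append u [j]))
  children := by
    intro u hu
    refine ⟨κ u, fun j => ⟨fun h => h u j (List.prefix_refl _), fun hj v i hv => ?_⟩⟩
    rcases List.prefix_concat_iff.1 hv with h | h
    · obtain ⟨rfl, hi⟩ := List.append_inj' h rfl
      obtain rfl : i = j := by simpa using hi
      exact hj
    · exact hu v i h

end PlaneTree

open PlaneTree

/-! ### Offspring distributions -/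

/-- The non-degeneracy condition `0 < p(0) < 1` and `p(0) + p(1) < 1`. -/
structure NonDegenerate (p : PMF ℕ) : Prop where
  zero_pos : 0 < p 0
  zero_lt_one : p 0 < 1
  zero_add_one_lt_one : p 0 + p 1 < 1

/-- The mean of `p`. -/
noncomputable def mean (p : PMF ℕ) : ℝ≥0∞ := ∑' n : ℕ, (n : ℝ≥0∞) * p n

/-- `p` is critical if its mean is `1`. -/
def IsCritical (p : PMF ℕ) : Prop := mean p = 1

/-- The period `max {k | P(ζ ∈ k ℕ) = 1}` of the law `p` of `ζ`. -/
noncomputable def period (p : PMF ℕ) : ℕ := sSup {k : ℕ | p.toMeasure {n : ℕ | k ∣ n} = 1}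

theorem NonDegenerate.exists_pos {p : PMF ℕ} (h : NonDegenerate p) :
    ∃ n ∈ {n : ℕ | n ≠ 0}, n ∈ p.support := by
  by_contra! H
  have h0 : ∑' n, p n = p 0 := tsum_eq_single 0 fun n hn => by
    simpa [PMF.mem_support_iff] using H n hn
  rw [p.tsum_coe] at h0
  exact h.zero_lt_one.ne h0.symm

theorem NonDegenerate.mean_ne_zero {p : PMF ℕ} (h : NonDegenerate p) : mean p ≠ 0 := by
  obtain ⟨n, hn, hp⟩ := h.exists_pos
  intro H
  have := ENNReal.tsum_eq_zero.1 H n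
  rw [mul_eq_zero, Nat.cast_eq_zero] at this
  exact this.elim hn ((PMF.mem_support_iff _ _).1 hp)

theorem IsCritical.mean_ne_top {p : PMF ℕ} (h : IsCritical p) : mean p ≠ ∞ := by
  rw [show mean p = 1 from h]
  exact ENNReal.one_ne_top

/-- The size-biased distribution `p*(n) = n p(n) / m`. -/
noncomputable def sizeBiased (p : PMF ℕ) (h : NonDegenerate p) (hm : mean p ≠ ∞) : PMF ℕ :=
  ⟨fun n => (n : ℝ≥0∞) * p n / mean p, by
    rw [ENNReal.summable.hasSum_iff]
    simp only [div_eq_mul_inv]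
    rw [ENNReal.tsum_mul_right]
    exact ENNReal.mul_inv_cancel h.mean_ne_zero hm⟩

/-! ### Galton–Watson trees -/

section GaltonWatson

variable {Ω : Type*} [MeasurableSpace Ω]

/-- The branching property: for `n ≥ 1`, conditionally on the root having `n` children, the `n`
sub-trees above the children of the root are independent and distributed as the whole tree. -/
def HasBranchingProperty (τ : Ω → PlaneTree) (P : Measure Ω) : Prop :=
  ∀ n : ℕ, 1 ≤ n → P {ω | (τ ω).outdegree [] = n} ≠ 0 →
    iIndepFun (fun (i : Fin n) (ω : Ω) => subtree i (τ ω)) (P[|{ω | (τ ω).outdegree [] = n}]) ∧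
    ∀ i : Fin n,
      HasLaw (fun ω => subtree i (τ ω)) (P.map τ) (P[|{ω | (τ ω).outdegree [] = n}])

/-- `τ` is, under the probability measure `P`, a Galton–Watson tree with offspring
distribution `p`. -/
structure IsGaltonWatsonTree (p : PMF ℕ) (τ : Ω → PlaneTree) (P : Measure Ω) : Prop where
  measurable : Measurable τ
  branching : HasBranchingProperty τ P
  root_law : ∀ n : ℕ, P {ω | (τ ω).outdegree [] = n} = p n

end GaltonWatson

/-! ### Kesten's tree -/

/-- The law of the pair (number of children, rank of the special child) for a special individual:
the number `k` of children has the size-biased law, hence `k ≥ 1` almost surely, and given `k` the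
rank of the special child is uniform on `{0, …, k - 1}`. -/
noncomputable def specialLaw (p : PMF ℕ) (h : NonDegenerate p) (hm : mean p ≠ ∞) : PMF (ℕ × ℕ) :=
  (sizeBiased p h hm).bind fun k =>
    (PMF.uniformOfFinset (Finset.range (k - 1 + 1)) (by simp)).map fun j => (k, j)

/-- Independent data attached to each word `u`: the number of children of `u` if `u` is a normal
individual (law `p`), and, independently, the number of children of `u` together with the rank of
its special child if `u` is a special individual (law `specialLaw`). -/
noncomputable def kestenData (p : PMF ℕ) (h : NonDegenerate p) (hm : mean p ≠ ∞) :
    Measure (List ℕ → ℕ × (ℕ × ℕ)) :=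
  Measure.infinitePi fun _ => p.toMeasure.prod (specialLaw p h hm).toMeasure

/-- The special individual of generation `n`: the root is special, and the unique special child of
a special individual `u` is the one whose rank is given by the data at `u`. -/
def specialNode (ω : List ℕ → ℕ × (ℕ × ℕ)) : ℕ → List ℕ
  | 0 => []
  | n + 1 => specialNode ω n ++ [(ω (specialNode ω n)).2.2]

open Classical in
/-- The two-type tree built from the data `ω`, special and normal individuals reproducing each
according to their own rule. -/
noncomputable def kestenOf (ω : List ℕ → ℕ × (ℕ × ℕ)) : PlaneTree :=
  ofDegrees fun u => if ∃ n, u = specialNode ω n then (ω u).2.1 else (ω u).1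

/-- The law of Kesten's tree associated to `p`. -/
noncomputable def kestenLaw (p : PMF ℕ) (h : NonDegenerate p) (hm : mean p ≠ ∞) :
    Measure PlaneTree :=
  (kestenData p h hm).map kestenOf

/-! ### The offspring distribution of the tree of leaves -/

/-- The law of the sum of `n` independent random variables with law `q`. -/
noncomputable def sumLaw (q : PMF ℕ) : ℕ → PMF ℕ
  | 0 => PMF.pure 0
  | n + 1 => (sumLaw q n).bind fun s => q.map fun x => s + x

/-- The geometric law `P(N - 1 = n) = (1 - p(0)) ^ n * p(0)`, `n ≥ 0`. -/
noncomputable def geometricLaw (p : PMF ℕ) (h : NonDegenerate p) : PMF ℕ :=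
  ⟨fun n => (1 - p 0) ^ n * p 0, by
    rw [ENNReal.summable.hasSum_iff, ENNReal.tsum_mul_right, ENNReal.tsum_geometric,
      ENNReal.sub_sub_cancel ENNReal.one_ne_top h.zero_lt_one.le]
    exact ENNReal.inv_mul_cancel h.zero_pos.ne' (PMF.apply_ne_top p 0)⟩

/-- The law `p_{0}` of `∑_{k=1}^{N-1} (X_k - 1)`, where `N` is geometric with parameter `p(0)` and
the `X_k` are independent, independent of `N`, with the law `p` conditioned on being positive.
It is the law of the number of sub-trees attached to the left-most branch of a Galton–Watson tree
with offspring distribution `p`. -/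
noncomputable def leafOffspring (p : PMF ℕ) (h : NonDegenerate p) : PMF ℕ :=
  (geometricLaw p h).bind
    (sumLaw ((p.filter {n : ℕ | n ≠ 0} h.exists_pos).map fun x => x - 1))

end RandomTree

open RandomTree RandomTree.PlaneTree

/-! Write φ for the generating function of `p` and ψ for that of `leafOffspring p hp`. Splitting at
the root, the generating function F of the number of leaves satisfies F + p(0) = φ(F) + p(0)x. Since
φ(t) - t is strictly decreasing on [0,1] by criticality, this equation has at most one solution in
[0,1] (`eq_of_add_eq_pgf_add`). The identity ψ(s)(s + p(0)) = p(0)s + ψ(s)φ(s) turns it into F =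
xψ(F), the equation of a total progeny; this gives (a).

For (b) and (c), on the event that τ agrees with t up to height h, the number of leaves is a
constant ℓ plus the sum of k independent copies of L₀(τ), where k is the number of vertices of t at
height h. Kesten's tree gives this cylinder at most k times its weight, the product of `p` over the
outdegrees below height h (`kestenLaw_restrict_le`). By the portmanteau theorem, lower bounds on
open sets suffice, hence lower bounds on cylinders. What remains is that the sum of k copies falls
in a shifted window with probability asymptotically at least k times that of one copy
(`LongTailed.le_liminf`): one of the k summands makes a single big jump, and these k possibilities
are disjoint.

This needs window masses that are almost insensitive to shifts. For tails, monotonicity is enough.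
For windows of one period, the hitting time theorem (`IsTotalProgeny.mul_sumLaw`) expresses the
progeny law through a random walk with step law `leafOffspring p hp`. Given the sum of n steps, the
proportion of steps equal to e concentrates near its probability, unless the conditioning event is
exponentially unlikely (`abs_walkProb_sub_le`). It is not, because a critical total progeny has
infinite mean (`IsTotalProgeny.exists_pow_le_walkProb`). Ratios of walk probabilities, hence of the
progeny law along its period, therefore tend to 1. -/

namespace RandomTree

/-! ### Generating functions -/

/-- The generating function of `q`. -/
noncomputable def pgf (q : PMF ℕ) (x : ℝ≥0∞) : ℝ≥0∞ := ∑' n, q n * x ^ n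

theorem tsum_eq_zero_add_tsum_succ (f : ℕ → ℝ≥0∞) : ∑' n, f n = f 0 + ∑' n, f (n + 1) :=
  tsum_eq_zero_add' ENNReal.summable

/-- Cancel the terms of index below `N`, divide by x^N and let x tend to 0: the remaining tail of
`a` is at most x times its total mass. -/
theorem coeff_le_of_tsum_mul_pow_eq {a b : ℕ → ℝ≥0∞} (ha : ∑' n, a n ≠ ∞)
    (h : ∀ x < 1, ∑' n, a n * x ^ n = ∑' n, b n * x ^ n) {N : ℕ} (hN : ∀ n < N, a n = b n) :
    b N ≤ a N := by
  have hfin : ∀ n, a n ≠ ∞ := fun n => ne_top_of_le_ne_top ha (ENNReal.le_tsum n)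
  have key : ∀ x : ℝ≥0∞, 0 < x → x < 1 → b N ≤ a N + x * ∑' n, a n := by
    intro x hx0 hx1
    have hxt : x ≠ ∞ := (hx1.trans ENNReal.one_lt_top).ne
    have h1 : ∑ n ∈ Finset.range N, a n * x ^ n + b N * x ^ N ≤ ∑' n, b n * x ^ n := by
      have e : ∑ n ∈ Finset.range N, a n * x ^ n = ∑ n ∈ Finset.range N, b n * x ^ n :=
        Finset.sum_congr rfl fun n hn => congrArg (· * x ^ n) (hN n (Finset.mem_range.1 hn))
      rw [e, ← Finset.sum_range_succ (fun n => b n * x ^ n)]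
      exact ENNReal.sum_le_tsum _
    have h2 : ∑' n, a n * x ^ n ≤ ∑ n ∈ Finset.range N, a n * x ^ n +
        (a N * x ^ N + x ^ (N + 1) * ∑' n, a n) := by
      have e := (ENNReal.summable (f := fun n => a (n + (N + 1)) * x ^ (n + (N + 1)))).sum_add_tsum_nat_add'
        (f := fun n => a n * x ^ n)
      rw [← e, Finset.sum_range_succ, add_assoc]
      gcongr
      rw [← ENNReal.tsum_mul_left]
      calc ∑' n, a (n + (N + 1)) * x ^ (n + (N + 1))
          ≤ ∑' n, x ^ (N + 1) * a (n + (N + 1)) := by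
            refine ENNReal.tsum_le_tsum fun n => ?_
            rw [mul_comm]
            gcongr ?_ * _
            exact pow_le_pow_right_of_le_one' hx1.le (by omega)
        _ ≤ ∑' n, x ^ (N + 1) * a n :=
            ENNReal.tsum_comp_le_tsum_of_injective (add_left_injective (N + 1))
              (fun n => x ^ (N + 1) * a n)
    have h3 := (h1.trans_eq (h x hx1).symm).trans h2
    rw [ENNReal.add_le_add_iff_left] at h3
    · have h4 : b N * x ^ N ≤ (a N + x * ∑' n, a n) * x ^ N := by
        refine h3.trans_eq ?_
        ring
      exact (ENNReal.mul_le_mul_iff_left (pow_ne_zero _ hx0.ne') (ENNReal.pow_ne_top hxt)).1 h4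
    · exact (ENNReal.sum_lt_top.2 fun n _ =>
        (ENNReal.mul_ne_top (hfin n) (ENNReal.pow_ne_top hxt)).lt_top).ne
  have hlim : Tendsto (fun x : ℝ≥0∞ => a N + x * ∑' n, a n) (𝓝[>] 0) (𝓝 (a N + 0 * ∑' n, a n)) :=
    ((ENNReal.Tendsto.mul_const tendsto_id (Or.inr ha)).const_add (a N)).mono_left
      nhdsWithin_le_nhds
  rw [zero_mul, add_zero] at hlim
  refine ge_of_tendsto hlim ?_
  filter_upwards [Ioo_mem_nhdsGT (zero_lt_one' ℝ≥0∞)] with x hx using key x hx.1 hx.2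

theorem coeff_eq_of_tsum_mul_pow_eq {a b : ℕ → ℝ≥0∞} (ha : ∑' n, a n ≠ ∞) (hb : ∑' n, b n ≠ ∞)
    (h : ∀ x < 1, ∑' n, a n * x ^ n = ∑' n, b n * x ^ n) (n : ℕ) : a n = b n := by
  induction n using Nat.strong_induction_on with
  | _ N ih =>
    exact le_antisymm (coeff_le_of_tsum_mul_pow_eq hb (fun x hx => (h x hx).symm)
      fun n hn => (ih n hn).symm) (coeff_le_of_tsum_mul_pow_eq ha h ih)

theorem pmf_eq_of_pgf_eq {q r : PMF ℕ} (h : ∀ x < 1, pgf q x = pgf r x) : q = r :=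
  PMF.ext (coeff_eq_of_tsum_mul_pow_eq (by simp [q.tsum_coe]) (by simp [r.tsum_coe]) h)

theorem tsum_bind_mul {α : Type*} (q : PMF α) (f : α → PMF ℕ) (g : ℕ → ℝ≥0∞) :
    ∑' n, q.bind f n * g n = ∑' a, q a * ∑' n, f a n * g n := by
  simp only [PMF.bind_apply, ← ENNReal.tsum_mul_right, ← ENNReal.tsum_mul_left]
  rw [ENNReal.tsum_comm]
  simp only [mul_assoc]

theorem tsum_pure_mul (m : ℕ) (g : ℕ → ℝ≥0∞) : ∑' n, PMF.pure m n * g n = g m := by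
  rw [tsum_eq_single m fun n hn => by simp [hn]]
  simp

theorem tsum_map_mul {α : Type*} (q : PMF α) (f : α → ℕ) (g : ℕ → ℝ≥0∞) :
    ∑' n, q.map f n * g n = ∑' a, q a * g (f a) := by
  rw [PMF.map, tsum_bind_mul]
  simp only [Function.comp, tsum_pure_mul]

theorem tsum_sumLaw_succ_mul (q : PMF ℕ) (n : ℕ) (g : ℕ → ℝ≥0∞) :
    ∑' m, sumLaw q (n + 1) m * g m = ∑' s, sumLaw q n s * ∑' k, q k * g (s + k) := by
  rw [sumLaw, tsum_bind_mul]
  simp only [tsum_map_mul]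

theorem pgf_bind {α : Type*} (q : PMF α) (f : α → PMF ℕ) (x : ℝ≥0∞) :
    pgf (q.bind f) x = ∑' a, q a * pgf (f a) x := tsum_bind_mul q f _

theorem pgf_map_succ (q : PMF ℕ) (x : ℝ≥0∞) : pgf (q.map (· + 1)) x = x * pgf q x := by
  rw [pgf, tsum_map_mul, pgf, ← ENNReal.tsum_mul_left]
  exact tsum_congr fun n => by ring

theorem pgf_sumLaw (q : PMF ℕ) (n : ℕ) (x : ℝ≥0∞) : pgf (sumLaw q n) x = pgf q x ^ n := by
  induction n with
  | zero => rw [pgf, sumLaw, tsum_pure_mul, pow_zero, pow_zero]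
  | succ n ih =>
    rw [pgf, tsum_sumLaw_succ_mul, pow_succ, ← ih, pgf, ← ENNReal.tsum_mul_right]
    refine tsum_congr fun s => ?_
    have e : ∑' k, q k * x ^ (s + k) = x ^ s * pgf q x := by
      rw [pgf, ← ENNReal.tsum_mul_left]
      exact tsum_congr fun k => by ring
    rw [e, mul_assoc]

theorem pgf_le_one (q : PMF ℕ) {x : ℝ≥0∞} (hx : x ≤ 1) : pgf q x ≤ 1 := by
  rw [← q.tsum_coe]
  exact ENNReal.tsum_le_tsum fun n => mul_le_of_le_one_right' (pow_le_one' hx n)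

theorem pgf_one (q : PMF ℕ) : pgf q 1 = 1 := by simp [pgf, q.tsum_coe]

theorem mean_eq_tsum (q : PMF ℕ) : mean q = ∑' n, q n * (n : ℝ≥0∞) :=
  tsum_congr fun _ => mul_comm _ _

theorem mean_bind {α : Type*} (q : PMF α) (f : α → PMF ℕ) :
    mean (q.bind f) = ∑' a, q a * mean (f a) := by
  simp only [mean_eq_tsum]
  exact tsum_bind_mul q f _

theorem mean_map_succ (q : PMF ℕ) : mean (q.map (· + 1)) = mean q + 1 := by
  rw [mean_eq_tsum, tsum_map_mul, mean_eq_tsum, ← q.tsum_coe, ← ENNReal.tsum_add]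
  exact tsum_congr fun n => by push_cast; ring

theorem mean_sumLaw (q : PMF ℕ) (n : ℕ) : mean (sumLaw q n) = n * mean q := by
  induction n with
  | zero => rw [mean_eq_tsum, sumLaw, tsum_pure_mul]; simp
  | succ n ih =>
    rw [mean_eq_tsum, tsum_sumLaw_succ_mul]
    have : ∀ s, ∑' k, q k * ((s + k : ℕ) : ℝ≥0∞) = s + mean q := fun s => by
      simp only [Nat.cast_add, mul_add, ENNReal.tsum_add, ENNReal.tsum_mul_right, q.tsum_coe,
        one_mul, mean_eq_tsum]
    simp only [this, mul_add, ENNReal.tsum_add, ENNReal.tsum_mul_right, PMF.tsum_coe, one_mul]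
    rw [← mean_eq_tsum, ih]
    push_cast
    ring

/-! ### The offspring distribution of the tree of leaves -/

/-- The factor `1 - p 0` undoes the normalisation of the conditioned law. -/
theorem filter_apply_mul {p : PMF ℕ} (h : NonDegenerate p) (g : ℕ → ℝ≥0∞) :
    (1 - p 0) * ∑' n, (p.filter {n : ℕ | n ≠ 0} h.exists_pos) n * g n =
      ∑' n, p (n + 1) * g (n + 1) := by
  have hs : p 0 + ∑' n, p (n + 1) = 1 := by
    rw [← tsum_eq_zero_add_tsum_succ p, p.tsum_coe]
  have hs' : ∑' n, p (n + 1) = 1 - p 0 :=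
    ENNReal.eq_sub_of_add_eq' ENNReal.one_ne_top (by rw [add_comm]; exact hs)
  have hne : 1 - p 0 ≠ 0 := (tsub_pos_of_lt h.zero_lt_one).ne'
  have hnt : 1 - p 0 ≠ ∞ := ENNReal.sub_ne_top ENNReal.one_ne_top
  have hsum : ∑' n, ({n : ℕ | n ≠ 0} : Set ℕ).indicator p n = 1 - p 0 := by
    rw [tsum_eq_zero_add_tsum_succ, ← hs']
    simp
  rw [tsum_eq_zero_add_tsum_succ fun n => (p.filter {n : ℕ | n ≠ 0} h.exists_pos) n * g n]
  simp only [PMF.filter_apply, hsum, mul_add, ← ENNReal.tsum_mul_left]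
  simp only [ne_eq, Set.mem_ofPred_eq, not_true_eq_false, not_false_eq_true, Set.indicator_of_notMem,
    Set.indicator_of_mem, zero_mul, mul_zero, zero_add, Nat.add_eq_zero_iff, one_ne_zero, and_false]
  refine tsum_congr fun n => ?_
  rw [← mul_assoc, mul_comm (1 - p 0), mul_assoc (p (n + 1)), ENNReal.inv_mul_cancel hne hnt,
    mul_one]

/-- With ρ the generating function of X - 1, one has φ(s) = p(0) + (1 - p(0))sρ(s), and the
geometric series gives ψ = p(0) + (1 - p(0))ρψ. Eliminating ρ yields the identity, arranged so as to
avoid subtraction and division in `ℝ≥0∞`. -/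
theorem leafOffspring_pgf {p : PMF ℕ} (h : NonDegenerate p) (s : ℝ≥0∞) :
    pgf (leafOffspring p h) s * (s + p 0) = p 0 * s + pgf (leafOffspring p h) s * pgf p s := by
  set r := (p.filter {n : ℕ | n ≠ 0} h.exists_pos).map fun x => x - 1 with hr
  have hχ : s * ((1 - p 0) * pgf r s) + p 0 = pgf p s := by
    rw [pgf, hr, tsum_map_mul, filter_apply_mul h fun n => s ^ (n - 1), pgf,
      tsum_eq_zero_add_tsum_succ fun n => p n * s ^ n, ← ENNReal.tsum_mul_left, add_comm]
    simp only [pow_zero, mul_one, Nat.add_sub_cancel]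
    congr 1
    exact tsum_congr fun n => by ring
  have hψ : pgf (leafOffspring p h) s = ∑' n, p 0 * ((1 - p 0) * pgf r s) ^ n := by
    rw [leafOffspring, pgf_bind]
    refine tsum_congr fun n => ?_
    rw [pgf_sumLaw, ← hr, mul_pow]
    change (1 - p 0) ^ n * p 0 * _ = _
    ring
  have hrec : pgf (leafOffspring p h) s =
      p 0 + (1 - p 0) * pgf r s * pgf (leafOffspring p h) s := by
    rw [hψ, ← ENNReal.tsum_mul_left, tsum_eq_zero_add_tsum_succ]
    simp only [pow_zero, mul_one]
    refine congrArg _ ?_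
    exact tsum_congr fun n => by ring
  rw [← hχ]
  nth_rewrite 1 [hrec]
  calc _ = p 0 * s + ((p 0 + (1 - p 0) * pgf r s * pgf (leafOffspring p h) s) * p 0 +
        (1 - p 0) * pgf r s * pgf (leafOffspring p h) s * s) := by ring
    _ = _ := by rw [← hrec]; ring

/-- The mean is E(N - 1)E(X - 1), with E(N - 1) = (1 - p(0))/p(0), while criticality of `p` gives (1
- p(0))E(X - 1) = 1 - (1 - p(0)) = p(0). -/
theorem leafOffspring_isCritical {p : PMF ℕ} (h : NonDegenerate p) (hc : IsCritical p) :
    IsCritical (leafOffspring p h) := by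
  set r := (p.filter {n : ℕ | n ≠ 0} h.exists_pos).map fun x => x - 1 with hr
  have hp0 : p 0 ≠ ∞ := p.apply_ne_top 0
  have hb : 1 - p 0 ≠ ∞ := ENNReal.sub_ne_top ENNReal.one_ne_top
  have hb' : p 0 + (1 - p 0) = 1 := add_tsub_cancel_of_le h.zero_lt_one.le
  have hmr : (1 - p 0) * mean r = p 0 := by
    have hs : p 0 + ∑' n, p (n + 1) = 1 := by
      rw [← tsum_eq_zero_add_tsum_succ p, p.tsum_coe]
    have hs' : ∑' n, p (n + 1) = 1 - p 0 :=
      ENNReal.eq_sub_of_add_eq' ENNReal.one_ne_top (by rw [add_comm]; exact hs)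
    have hm : ∑' n, p (n + 1) * (n : ℝ≥0∞) + (1 - p 0) = 1 := by
      rw [← hs', ← ENNReal.tsum_add, ← show mean p = 1 from hc, mean_eq_tsum,
        tsum_eq_zero_add_tsum_succ fun n => p n * (n : ℝ≥0∞)]
      simp [mul_add]
    rw [mean_eq_tsum, hr, tsum_map_mul, filter_apply_mul h fun n => ((n - 1 : ℕ) : ℝ≥0∞)]
    simp only [Nat.add_sub_cancel]
    exact (ENNReal.add_left_inj hb).1 (hm.trans hb'.symm)
  have hbr : ENNReal.ofReal (1 - p 0).toReal = 1 - p 0 := ENNReal.ofReal_toReal hb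
  have hb1 : ENNReal.ofReal (1 - (1 - p 0).toReal) = p 0 := by
    rw [ENNReal.ofReal_sub _ ENNReal.toReal_nonneg, hbr, ENNReal.ofReal_one,
      ENNReal.sub_sub_cancel ENNReal.one_ne_top h.zero_lt_one.le]
  have hlt : (1 - p 0).toReal < 1 := by
    rw [← sub_pos, ← ENNReal.ofReal_pos, hb1]
    exact h.zero_pos
  have hgeo : ∑' n : ℕ, (n : ℝ≥0∞) * (1 - p 0) ^ n = (1 - p 0) / p 0 ^ 2 := by
    have hn : ‖(1 - p 0).toReal‖ < 1 := by
      rwa [Real.norm_of_nonneg ENNReal.toReal_nonneg]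
    have hS := hasSum_coe_mul_geometric_of_norm_lt_one hn
    have e : ∀ n : ℕ, (n : ℝ≥0∞) * (1 - p 0) ^ n =
        ENNReal.ofReal (n * (1 - p 0).toReal ^ n) := fun n => by
      rw [ENNReal.ofReal_mul n.cast_nonneg, ENNReal.ofReal_natCast,
        ENNReal.ofReal_pow ENNReal.toReal_nonneg, hbr]
    simp only [e]
    rw [← ENNReal.ofReal_tsum_of_nonneg (fun n => by positivity) hS.summable, hS.tsum_eq,
      ENNReal.ofReal_div_of_pos (by nlinarith), hbr, ENNReal.ofReal_pow (by linarith), hb1]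
  rw [IsCritical, leafOffspring, mean_bind, ← hr]
  simp only [mean_sumLaw]
  calc ∑' n : ℕ, geometricLaw p h n * (n * mean r)
      = ∑' n : ℕ, (n : ℝ≥0∞) * (1 - p 0) ^ n * (p 0 * mean r) := by
        refine tsum_congr fun n => ?_
        change (1 - p 0) ^ n * p 0 * _ = _
        ring
    _ = ((1 - p 0) * mean r) * p 0 / p 0 ^ 2 := by
        rw [ENNReal.tsum_mul_right, hgeo, div_eq_mul_inv, div_eq_mul_inv]
        ring
    _ = 1 := by
        rw [hmr, ← sq]
        exact ENNReal.div_self (pow_ne_zero _ h.zero_pos.ne') (ENNReal.pow_ne_top hp0)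

/-- A law carried by {0, 1} has mean `q 1`, so mean 1 would leave no mass at 0. -/
theorem IsCritical.nonDegenerate {q : PMF ℕ} (hc : IsCritical q) (h0 : 0 < q 0) :
    NonDegenerate q := by
  have hsum : q 0 + (q 1 + ∑' n, q (n + 2)) = 1 := by
    rw [← q.tsum_coe, tsum_eq_zero_add_tsum_succ q,
      tsum_eq_zero_add_tsum_succ fun n => q (n + 1)]
  have hlt : q 0 + q 1 < 1 := by
    refine lt_of_le_of_ne (by rw [← hsum, ← add_assoc]; exact le_self_add) fun he => ?_
    rw [← add_assoc, he] at hsum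
    have hz : ∑' n, q (n + 2) = 0 := by
      have : (1 : ℝ≥0∞) + ∑' n, q (n + 2) = 1 + 0 := by rw [hsum, add_zero]
      exact (ENNReal.add_right_inj ENNReal.one_ne_top).1 this
    have hm : mean q = q 1 := by
      rw [mean, tsum_eq_single 1, Nat.cast_one, one_mul]
      rintro (_ | _ | n) hn
      · simp
      · exact absurd rfl hn
      · rw [ENNReal.tsum_eq_zero.1 hz n, mul_zero]
    have h1 : q 1 = 1 := hm.symm.trans hc
    rw [h1] at he
    have : q 0 + 1 = 0 + 1 := by rw [he, zero_add]
    exact h0.ne' ((ENNReal.add_left_inj ENNReal.one_ne_top).1 this)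
  exact ⟨h0, lt_of_le_of_lt le_self_add hlt, hlt⟩

theorem leafOffspring_nonDegenerate {p : PMF ℕ} (h : NonDegenerate p) (hc : IsCritical p) :
    NonDegenerate (leafOffspring p h) := by
  refine (leafOffspring_isCritical h hc).nonDegenerate ?_
  rw [pos_iff_ne_zero, ← PMF.mem_support_iff, leafOffspring, PMF.mem_support_bind_iff]
  refine ⟨0, ?_, by simp [sumLaw]⟩
  rw [PMF.mem_support_iff]
  change (1 - p 0) ^ 0 * p 0 ≠ 0
  simpa using h.zero_pos.ne'

/-! ### Uniqueness of the fixed point -/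

theorem pow_sub_pow_le_mul {s t : ℝ} (hs : 0 ≤ s) (hst : s ≤ t) (ht : t ≤ 1) (n : ℕ) :
    t ^ n - s ^ n ≤ n * (t - s) := by
  induction n with
  | zero => simp
  | succ n ih =>
    have h1 : t * (t ^ n - s ^ n) ≤ 1 * (t ^ n - s ^ n) :=
      mul_le_mul_of_nonneg_right ht (sub_nonneg.2 (pow_le_pow_left₀ hs hst n))
    have h2 : s ^ n * (t - s) ≤ 1 * (t - s) :=
      mul_le_mul_of_nonneg_right (pow_le_one₀ hs (hst.trans ht)) (sub_nonneg.2 hst)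
    push_cast
    calc t ^ (n + 1) - s ^ (n + 1) = t * (t ^ n - s ^ n) + s ^ n * (t - s) := by ring
      _ ≤ (n + 1) * (t - s) := by linarith

theorem pow_sub_pow_lt_mul {s t : ℝ} (hs : 0 ≤ s) (hst : s < t) (ht : t ≤ 1) (n : ℕ) :
    t ^ (n + 2) - s ^ (n + 2) < (n + 2 : ℕ) * (t - s) := by
  have h0 := pow_sub_pow_le_mul hs hst.le ht (n + 1)
  have h1 : t * (t ^ (n + 1) - s ^ (n + 1)) ≤ 1 * (t ^ (n + 1) - s ^ (n + 1)) :=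
    mul_le_mul_of_nonneg_right ht (sub_nonneg.2 (pow_le_pow_left₀ hs hst.le _))
  have h2 : s ^ (n + 1) * (t - s) < 1 * (t - s) :=
    mul_lt_mul_of_pos_right (pow_lt_one₀ hs (hst.trans_le ht) (by omega)) (sub_pos.2 hst)
  push_cast at h0 ⊢
  calc t ^ (n + 2) - s ^ (n + 2) = t * (t ^ (n + 1) - s ^ (n + 1)) + s ^ (n + 1) * (t - s) := by
        ring
    _ < (n + 2) * (t - s) := by linarith

/-- Mean 1 allows t to be written as Σ p(n)·n·t. The comparison is then termwise: t^n - s^n ≤ n(t -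
s), strictly for n ≥ 2, and some such n has positive mass. -/
theorem pgf_add_lt {p : PMF ℕ} (h : NonDegenerate p) (hc : IsCritical p) {s t : ℝ≥0∞}
    (hst : s < t) (ht : t ≤ 1) : pgf p t + s < pgf p s + t := by
  have htop : t ≠ ∞ := ne_top_of_le_ne_top ENNReal.one_ne_top ht
  have hs_ne_top : s ≠ ∞ := (hst.trans_le ht).ne_top
  lift t to NNReal using htop
  lift s to NNReal using hs_ne_top
  have hst' : (s : ℝ) < t := by exact_mod_cast hst
  have ht' : (t : ℝ) ≤ 1 := by exact_mod_cast ht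
  have hm : ∀ x : ℝ≥0∞, ∑' n, p n * (n * x) = x := fun x => by
    simp only [← mul_assoc]
    rw [ENNReal.tsum_mul_right, ← mean_eq_tsum, show mean p = 1 from hc, one_mul]
  have e1 : pgf p t + s = ∑' n, p n * ((t : ℝ≥0∞) ^ n + n * s) := by
    simp only [mul_add, ENNReal.tsum_add, hm]
    rfl
  have e2 : pgf p s + t = ∑' n, p n * ((s : ℝ≥0∞) ^ n + n * t) := by
    simp only [mul_add, ENNReal.tsum_add, hm]
    rfl
  have hle : ∀ n : ℕ, (t : ℝ≥0∞) ^ n + n * s ≤ (s : ℝ≥0∞) ^ n + n * t := fun n => by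
    have := pow_sub_pow_le_mul s.2 hst'.le ht' n
    norm_cast
    rw [← NNReal.coe_le_coe]
    push_cast
    simp only [NNReal.val_eq_coe] at this
    linarith
  obtain ⟨n, hn⟩ : ∃ n, p (n + 2) ≠ 0 := by
    by_contra! H
    have hsum : p 0 + (p 1 + ∑' n, p (n + 2)) = 1 := by
      rw [← p.tsum_coe, tsum_eq_zero_add_tsum_succ p,
        tsum_eq_zero_add_tsum_succ fun n => p (n + 1)]
    rw [ENNReal.tsum_eq_zero.2 H, add_zero] at hsum
    exact h.zero_add_one_lt_one.ne hsum
  have hlt : (t : ℝ≥0∞) ^ (n + 2) + (n + 2 : ℕ) * s < (s : ℝ≥0∞) ^ (n + 2) + (n + 2 : ℕ) * t := by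
    have := pow_sub_pow_lt_mul s.2 hst' ht' n
    norm_cast
    rw [← NNReal.coe_lt_coe]
    push_cast at this ⊢
    simp only [NNReal.val_eq_coe] at this
    linarith
  rw [e1, e2]
  refine ENNReal.tsum_lt_tsum ?_ (fun n => mul_le_mul_right (hle n) _)
    ((ENNReal.mul_lt_mul_iff_right hn (p.apply_ne_top _)).2 hlt)
  rw [← e1]
  exact ENNReal.add_ne_top.2 ⟨ne_top_of_le_ne_top ENNReal.one_ne_top (pgf_le_one p ht),
    ENNReal.coe_ne_top⟩

/-- Applied with a = p(0) and b = p(0)x, this identifies every solution of the leaf equation in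
[0,1], including x = 1. -/
theorem eq_of_add_eq_pgf_add {p : PMF ℕ} (h : NonDegenerate p) (hc : IsCritical p)
    {s t a b : ℝ≥0∞} (hs : s ≤ 1) (ht : t ≤ 1) (ha : a ≠ ∞) (hb : b ≠ ∞)
    (es : s + a = pgf p s + b) (et : t + a = pgf p t + b) : s = t := by
  have key : pgf p t + s = pgf p s + t := by
    have : pgf p t + s + (a + b) = pgf p s + t + (a + b) := by
      calc pgf p t + s + (a + b) = (s + a) + (pgf p t + b) := by ring
        _ = (pgf p s + b) + (t + a) := by rw [es, ← et]
        _ = _ := by ring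
    exact (ENNReal.add_left_inj (ENNReal.add_ne_top.2 ⟨ha, hb⟩)).1 this
  rcases lt_trichotomy s t with hlt | heq | hlt
  · exact absurd key (pgf_add_lt h hc hlt ht).ne
  · exact heq
  · exact absurd key.symm (pgf_add_lt h hc hlt hs).ne

/-! ### Random walks with non-negative steps -/

/-- The generating function of `q` as a formal power series. -/
noncomputable def genSeries (q : PMF ℕ) : PowerSeries ℝ := PowerSeries.mk fun n => (q n).toReal

/-- The probability that the sum of `n` independent variables with law `q` is `s`. -/
noncomputable def walkProb (q : PMF ℕ) (n s : ℕ) : ℝ := (genSeries q ^ n).coeff s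

theorem sumLaw_succ_apply (q : PMF ℕ) (n m : ℕ) :
    sumLaw q (n + 1) m =
      ∑ x ∈ Finset.HasAntidiagonal.antidiagonal m, sumLaw q n x.1 * q x.2 := by
  have h := tsum_sumLaw_succ_mul q n fun k => if k = m then 1 else 0
  have e1 : ∑' k, sumLaw q (n + 1) k * (if k = m then 1 else 0 : ℝ≥0∞) = sumLaw q (n + 1) m := by
    rw [tsum_eq_single m fun k hk => by simp [hk]]
    simp
  have e2 : ∀ s, ∑' k, q k * (if s + k = m then 1 else 0 : ℝ≥0∞) =
      if s ≤ m then q (m - s) else 0 := fun s => by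
    split_ifs with hs
    · rw [tsum_eq_single (m - s) fun k hk => ?_]
      · simp [Nat.add_sub_cancel' hs]
      · rw [if_neg (by omega), mul_zero]
    · refine ENNReal.tsum_eq_zero.2 fun k => ?_
      rw [if_neg (by omega), mul_zero]
  rw [← e1, h]
  simp only [e2]
  rw [tsum_eq_sum (s := Finset.range (m + 1)), Finset.Nat.sum_antidiagonal_eq_sum_range_succ
    (fun a b => sumLaw q n a * q b)]
  · refine Finset.sum_congr rfl fun s hs => ?_
    rw [if_pos (by simpa [Nat.lt_succ_iff] using hs)]
  · intro s hs
    rw [if_neg (by simpa [Nat.lt_succ_iff] using hs), mul_zero]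

theorem walkProb_eq (q : PMF ℕ) (n s : ℕ) : walkProb q n s = (sumLaw q n s).toReal := by
  induction n generalizing s with
  | zero =>
    rw [walkProb, pow_zero, PowerSeries.coeff_one, sumLaw, PMF.pure_apply]
    split_ifs <;> simp
  | succ n ih =>
    rw [walkProb, pow_succ, PowerSeries.coeff_mul, sumLaw_succ_apply, ENNReal.toReal_sum fun x _ =>
      ENNReal.mul_ne_top (PMF.apply_ne_top _ _) (PMF.apply_ne_top _ _)]
    refine Finset.sum_congr rfl fun x _ => ?_
    rw [ENNReal.toReal_mul, ← ih, genSeries, PowerSeries.coeff_mk, walkProb, genSeries]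

theorem walkProb_nonneg (q : PMF ℕ) (n s : ℕ) : 0 ≤ walkProb q n s := by
  rw [walkProb_eq]
  exact ENNReal.toReal_nonneg

theorem walkProb_one (q : PMF ℕ) (s : ℕ) : walkProb q 1 s = (q s).toReal := by
  rw [walkProb, pow_one, genSeries, PowerSeries.coeff_mk]

theorem walkProb_mul_le (q : PMF ℕ) (m n s t : ℕ) :
    walkProb q m s * walkProb q n t ≤ walkProb q (m + n) (s + t) := by
  rw [walkProb, walkProb, walkProb, pow_add, PowerSeries.coeff_mul]
  exact Finset.single_le_sum
    (f := fun x : ℕ × ℕ => (genSeries q ^ m).coeff x.1 * (genSeries q ^ n).coeff x.2)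
    (fun x _ => mul_nonneg (walkProb_nonneg q m x.1) (walkProb_nonneg q n x.2))
    (show (s, t) ∈ Finset.HasAntidiagonal.antidiagonal (s + t) by simp)

/-- The mean of one step given the sum of `n + 1` steps. -/
theorem sum_mul_walkProb (q : PMF ℕ) (n s : ℕ) :
    (n + 1) * ∑ x ∈ Finset.HasAntidiagonal.antidiagonal s, x.1 * (q x.1).toReal * walkProb q n x.2 =
      s * walkProb q (n + 1) s := by
  -- Exchangeability of the steps is read off from X(G^(n+1))' = (n+1)·XG'·G^n, by comparing
  -- coefficients.
  have h := PowerSeries.derivative_pow (genSeries q) (n + 1)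
  have h2 := congrArg (fun f => (PowerSeries.X * f).coeff s) h
  have e1 : ∀ f : PowerSeries ℝ, (PowerSeries.X * PowerSeries.derivative ℝ f).coeff s =
      s * f.coeff s := by
    intro f
    rcases s with _ | s
    · simp
    · rw [PowerSeries.coeff_succ_X_mul, PowerSeries.coeff_derivative]
      push_cast
      ring
  have e1' : ∀ s, (PowerSeries.X * PowerSeries.derivative ℝ (genSeries q)).coeff s =
      s * (q s).toReal := by
    intro s
    rcases s with _ | s
    · simp
    · rw [PowerSeries.coeff_succ_X_mul, PowerSeries.coeff_derivative, genSeries,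
        PowerSeries.coeff_mk]
      push_cast
      ring
  rw [e1] at h2
  rw [walkProb, h2, Nat.add_sub_cancel]
  have e3 : PowerSeries.X * (((n + 1 : ℕ) : PowerSeries ℝ) * genSeries q ^ n *
      PowerSeries.derivative ℝ (genSeries q)) =
      PowerSeries.C ((n + 1 : ℕ) : ℝ) *
        (PowerSeries.X * PowerSeries.derivative ℝ (genSeries q) * genSeries q ^ n) := by
    rw [map_natCast]
    ring
  rw [e3, PowerSeries.coeff_C_mul, PowerSeries.coeff_mul]
  push_cast
  congr 1
  refine Finset.sum_congr rfl fun x _ => ?_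
  rw [e1', walkProb]

/-! ### Concentration of the number of steps with a given value -/

theorem coeff_pow_nonneg {f : PowerSeries ℝ} (h0 : ∀ i, 0 ≤ f.coeff i) (n s : ℕ) :
    0 ≤ (f ^ n).coeff s := by
  induction n generalizing s with
  | zero => rw [pow_zero, PowerSeries.coeff_one]; split_ifs <;> norm_num
  | succ n ih =>
    rw [pow_succ, PowerSeries.coeff_mul]
    exact Finset.sum_nonneg fun x _ => mul_nonneg (ih _) (h0 _)

theorem coeff_pow_le {f : PowerSeries ℝ} {B : ℝ} (h0 : ∀ i, 0 ≤ f.coeff i)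
    (hB : ∀ s, ∑ i ∈ Finset.range s, f.coeff i ≤ B) (n s : ℕ) : (f ^ n).coeff s ≤ B ^ n := by
  have hB0 : 0 ≤ B := by simpa using hB 0
  induction n generalizing s with
  | zero => rw [pow_zero, PowerSeries.coeff_one]; split_ifs <;> norm_num
  | succ n ih =>
    rw [pow_succ', PowerSeries.coeff_mul]
    calc ∑ x ∈ Finset.HasAntidiagonal.antidiagonal s, f.coeff x.1 * (f ^ n).coeff x.2
        ≤ ∑ x ∈ Finset.HasAntidiagonal.antidiagonal s, f.coeff x.1 * B ^ n :=
          Finset.sum_le_sum fun x _ => mul_le_mul_of_nonneg_left (ih _) (h0 _)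
      _ = (∑ i ∈ Finset.range (s + 1), f.coeff i) * B ^ n := by
          rw [← Finset.sum_mul, Finset.Nat.sum_antidiagonal_eq_sum_range_succ
            (fun a _ => f.coeff a)]
      _ ≤ B * B ^ n := mul_le_mul_of_nonneg_right (hB _) (pow_nonneg hB0 n)
      _ = B ^ (n + 1) := (pow_succ' B n).symm

theorem sum_genSeries_le (q : PMF ℕ) (s : Finset ℕ) : ∑ i ∈ s, (q i).toReal ≤ 1 := by
  rw [← ENNReal.toReal_sum fun i _ => q.apply_ne_top i, ← ENNReal.toReal_one]
  refine ENNReal.toReal_mono ENNReal.one_ne_top ?_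
  rw [← q.tsum_coe]
  exact ENNReal.sum_le_tsum _

/-- The genSeries of `q` restricted to the complement of `{e}`. -/
noncomputable def restSeries (q : PMF ℕ) (e : ℕ) : PowerSeries ℝ :=
  PowerSeries.mk fun n => if n = e then 0 else (q n).toReal

theorem genSeries_eq (q : PMF ℕ) (e : ℕ) :
    genSeries q = PowerSeries.C (q e).toReal * PowerSeries.X ^ e + restSeries q e := by
  ext n
  rw [map_add, PowerSeries.coeff_C_mul, PowerSeries.coeff_X_pow, genSeries, restSeries,
    PowerSeries.coeff_mk, PowerSeries.coeff_mk]
  split_ifs with h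
  · simp [h]
  · simp

/-- The probability that the sum of `n` steps is `s` and that exactly `j` of them are `e`. -/
noncomputable def stepCount (q : PMF ℕ) (e n s j : ℕ) : ℝ :=
  n.choose j * (q e).toReal ^ j * (PowerSeries.X ^ (e * j) * restSeries q e ^ (n - j)).coeff s

theorem restSeries_nonneg (q : PMF ℕ) (e i : ℕ) : 0 ≤ (restSeries q e).coeff i := by
  rw [restSeries, PowerSeries.coeff_mk]
  split_ifs
  · exact le_rfl
  · exact ENNReal.toReal_nonneg

theorem stepCount_nonneg (q : PMF ℕ) (e n s j : ℕ) : 0 ≤ stepCount q e n s j := by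
  refine mul_nonneg (mul_nonneg (Nat.cast_nonneg _) (pow_nonneg ENNReal.toReal_nonneg _)) ?_
  rw [PowerSeries.coeff_X_pow_mul']
  split_ifs
  · exact coeff_pow_nonneg (restSeries_nonneg q e) _ _
  · exact le_rfl

/-- The variable y marks the steps equal to `e`; the left side is the binomial expansion of the
marked series. -/
theorem sum_stepCount_mul_pow (q : PMF ℕ) (e n s : ℕ) (y : ℝ) :
    ∑ j ∈ Finset.range (n + 1), stepCount q e n s j * y ^ j =
      ((PowerSeries.C (y * (q e).toReal) * PowerSeries.X ^ e + restSeries q e) ^ n).coeff s := by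
  rw [add_pow, map_sum]
  refine Finset.sum_congr rfl fun j _ => ?_
  have : (PowerSeries.C (y * (q e).toReal) * PowerSeries.X ^ e) ^ j * restSeries q e ^ (n - j) *
      (n.choose j : PowerSeries ℝ) = PowerSeries.C ((n.choose j : ℝ) * (y * (q e).toReal) ^ j) *
        (PowerSeries.X ^ (e * j) * restSeries q e ^ (n - j)) := by
    rw [map_mul PowerSeries.C (_ : ℝ) (_ ^ j), map_pow, map_natCast, pow_mul]
    ring
  rw [this, PowerSeries.coeff_C_mul, stepCount]
  ring

theorem sum_stepCount (q : PMF ℕ) (e n s : ℕ) :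
    ∑ j ∈ Finset.range (n + 1), stepCount q e n s j = walkProb q n s := by
  have := sum_stepCount_mul_pow q e n s 1
  simpa [← genSeries_eq, walkProb] using this

/-- Dropping the condition on the sum leaves the generating function of a binomial variable with
parameters n and `q e`. -/
theorem sum_stepCount_mul_pow_le (q : PMF ℕ) (e n s : ℕ) {y : ℝ} (hy : 0 ≤ y) :
    ∑ j ∈ Finset.range (n + 1), stepCount q e n s j * y ^ j ≤
      (1 + (q e).toReal * (y - 1)) ^ n := by
  rw [sum_stepCount_mul_pow]
  have hc : ∀ i, (PowerSeries.C (y * (q e).toReal) * PowerSeries.X ^ e + restSeries q e).coeff i =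
      (q i).toReal + if i = e then (q e).toReal * (y - 1) else 0 := fun i => by
    rw [map_add, PowerSeries.coeff_C_mul, PowerSeries.coeff_X_pow, restSeries,
      PowerSeries.coeff_mk]
    split_ifs with h
    · subst h; ring
    · ring
  refine coeff_pow_le (fun i => ?_) (fun N => ?_) n s
  · rw [map_add, PowerSeries.coeff_C_mul, PowerSeries.coeff_X_pow]
    refine add_nonneg (mul_nonneg (mul_nonneg hy ENNReal.toReal_nonneg) ?_)
      (restSeries_nonneg q e i)
    split_ifs <;> norm_num
  · simp only [hc]
    rw [Finset.sum_add_distrib, Finset.sum_ite_eq']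
    split_ifs with h
    · exact add_le_add (sum_genSeries_le q _) le_rfl
    · rw [add_zero]
      have h2 := sum_genSeries_le q (insert e (Finset.range N))
      rw [Finset.sum_insert h] at h2
      have : 0 ≤ (q e).toReal * y := mul_nonneg ENNReal.toReal_nonneg hy
      linarith

/-- Each of the n + 1 steps may be the one equal to `e`; removing it leaves n steps with sum `s`. In
coefficients this is (j+1)·C(n+1, j+1) = (n+1)·C(n, j). -/
theorem sum_mul_stepCount (q : PMF ℕ) (e n s : ℕ) :
    ∑ j ∈ Finset.range (n + 1 + 1), (j : ℝ) * stepCount q e (n + 1) (s + e) j =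
      (n + 1) * (q e).toReal * walkProb q n s := by
  rw [Finset.sum_range_succ', ← sum_stepCount q e, Finset.mul_sum]
  simp only [Nat.cast_zero, zero_mul, add_zero]
  refine Finset.sum_congr rfl fun j _ => ?_
  have h1 : ((n + 1).choose (j + 1) : ℝ) * (j + 1) = (n + 1) * n.choose j := by
    exact_mod_cast (Nat.add_one_mul_choose_eq n j).symm
  have h2 : (PowerSeries.X ^ (e * (j + 1)) * restSeries q e ^ (n + 1 - (j + 1))).coeff (s + e) =
      (PowerSeries.X ^ (e * j) * restSeries q e ^ (n - j)).coeff s := by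
    rw [mul_add, mul_one, add_comm (e * j), pow_add, mul_assoc, add_comm s,
      PowerSeries.coeff_X_pow_mul' , if_pos (by omega), Nat.add_sub_cancel_left,
      Nat.add_sub_add_right]
  rw [stepCount, stepCount, h2, pow_succ]
  push_cast
  calc _ = ((n + 1).choose (j + 1) : ℝ) * (j + 1) * ((q e).toReal ^ j * (q e).toReal *
        (PowerSeries.X ^ (e * j) * restSeries q e ^ (n - j)).coeff s) := by ring
    _ = _ := by rw [h1]; ring

/-- The one-step Chernoff bound, from exp x ≤ 1 + x + x² and 1 + u ≤ exp u: the tilt costs δ²/4 out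
of the available δ²/2. -/
theorem exp_tilt_le {α δ x : ℝ} (hα : 0 ≤ α) (hα1 : α ≤ 1) (hδ : 0 < δ) (hδ1 : δ ≤ 1)
    (hx : |x| = δ / 2) :
    Real.exp (-(x * α + δ ^ 2 / 2)) * (1 + α * (Real.exp x - 1)) ≤ Real.exp (-(δ ^ 2 / 4)) := by
  have h1 : Real.exp x - 1 ≤ x + δ ^ 2 / 4 := by
    have := (abs_le.1 (Real.abs_exp_sub_one_sub_id_le (x := x) (by rw [hx]; linarith))).2
    have h2 : x ^ 2 = δ ^ 2 / 4 := by rw [← sq_abs, hx]; ring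
    linarith
  have h3 : 1 + α * (Real.exp x - 1) ≤ Real.exp (x * α + δ ^ 2 / 4) := by
    refine le_trans ?_ (Real.add_one_le_exp _)
    have : α * (Real.exp x - 1) ≤ α * (x + δ ^ 2 / 4) := mul_le_mul_of_nonneg_left h1 hα
    have : α * (δ ^ 2 / 4) ≤ 1 * (δ ^ 2 / 4) := mul_le_mul_of_nonneg_right hα1 (by positivity)
    nlinarith
  calc _ ≤ Real.exp (-(x * α + δ ^ 2 / 2)) * Real.exp (x * α + δ ^ 2 / 4) :=
        mul_le_mul_of_nonneg_left h3 (Real.exp_pos _).le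
    _ = _ := by rw [← Real.exp_add]; ring_nf

/-- When |j - a| exceeds D, one of the two exponentials is at least 1, and |j - a| ≤ n always. -/
theorem abs_sub_le_tilt {n j a θ D : ℝ} (hn : 0 ≤ n) (hj0 : 0 ≤ j) (hjn : j ≤ n) (ha0 : 0 ≤ a)
    (han : a ≤ n) (hθ : 0 ≤ θ) (hD : 0 ≤ D) :
    |j - a| ≤ D + n * Real.exp (θ * (j - a - D)) + n * Real.exp (-θ * (j - a + D)) := by
  have hp1 := mul_nonneg hn (Real.exp_pos (θ * (j - a - D))).le
  have hp2 := mul_nonneg hn (Real.exp_pos (-θ * (j - a + D))).le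
  have habs : |j - a| ≤ n := abs_le.2 ⟨by linarith, by linarith⟩
  by_cases h : |j - a| ≤ D
  · linarith
  push Not at h
  rcases le_total 0 (j - a) with h0 | h0
  · rw [abs_of_nonneg h0] at h
    have : n ≤ n * Real.exp (θ * (j - a - D)) :=
      le_mul_of_one_le_right hn (Real.one_le_exp (mul_nonneg hθ (by linarith)))
    linarith
  · rw [abs_of_nonpos h0] at h
    have : n ≤ n * Real.exp (-θ * (j - a + D)) :=
      le_mul_of_one_le_right hn (Real.one_le_exp (by nlinarith))
    linarith

/-- Let J count the steps equal to `e` among n + 1, and α = q(e). By `sum_mul_stepCount`, α times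
the difference is the expectation of J/(n+1) - α on the event that the sum is s + e. Deviations up
to δ contribute the first term; larger ones are exponentially rare by Chernoff, whatever the sum. -/
theorem abs_walkProb_sub_le (q : PMF ℕ) (e n s : ℕ) {δ : ℝ} (hδ : 0 < δ) (hδ1 : δ ≤ 1) :
    (q e).toReal * |walkProb q n s - walkProb q (n + 1) (s + e)| ≤
      δ * walkProb q (n + 1) (s + e) + 2 * Real.exp (-(δ ^ 2 / 4)) ^ (n + 1) := by
  set α := (q e).toReal with hα
  set N : ℝ := n + 1 with hN
  have hNpos : 0 < N := by positivity
  have hα0 : 0 ≤ α := ENNReal.toReal_nonneg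
  have hα1 : α ≤ 1 := by simpa using sum_genSeries_le q {e}
  set π := stepCount q e (n + 1) (s + e) with hπ
  have hπ0 : ∀ j, 0 ≤ π j := stepCount_nonneg q e (n + 1) (s + e)
  have hsum := sum_stepCount q e (n + 1) (s + e)
  have hmean := sum_mul_stepCount q e n s
  have htail : ∀ x : ℝ, |x| = δ / 2 → ∑ j ∈ Finset.range (n + 1 + 1),
      π j * Real.exp (x * (j - α * N) - δ / 2 * (δ * N)) ≤
        Real.exp (-(δ ^ 2 / 4)) ^ (n + 1) := by
    intro x hx
    have h1 := sum_stepCount_mul_pow_le q e (n + 1) (s + e) (Real.exp_pos x).le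
    have h2 := exp_tilt_le hα0 hα1 hδ hδ1 hx
    calc ∑ j ∈ Finset.range (n + 1 + 1), π j * Real.exp (x * (j - α * N) - δ / 2 * (δ * N))
        = Real.exp (-(x * α + δ ^ 2 / 2)) ^ (n + 1) *
            ∑ j ∈ Finset.range (n + 1 + 1), π j * Real.exp x ^ j := by
          rw [Finset.mul_sum]
          refine Finset.sum_congr rfl fun j _ => ?_
          rw [← Real.exp_nat_mul, ← Real.exp_nat_mul, mul_left_comm (Real.exp _) (π j), ← Real.exp_add, hN]
          congr 2
          push_cast
          ring
      _ ≤ Real.exp (-(x * α + δ ^ 2 / 2)) ^ (n + 1) * (1 + α * (Real.exp x - 1)) ^ (n + 1) :=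
          mul_le_mul_of_nonneg_left h1 (by positivity)
      _ = (Real.exp (-(x * α + δ ^ 2 / 2)) * (1 + α * (Real.exp x - 1))) ^ (n + 1) :=
          (mul_pow _ _ _).symm
      _ ≤ _ := by
          refine pow_le_pow_left₀ (mul_nonneg (Real.exp_pos _).le ?_) h2 _
          have : 0 ≤ α * Real.exp x := mul_nonneg hα0 (Real.exp_pos x).le
          linarith
  have key : |∑ j ∈ Finset.range (n + 1 + 1), ((j : ℝ) - α * N) * π j| ≤
      δ * N * walkProb q (n + 1) (s + e) + N * Real.exp (-(δ ^ 2 / 4)) ^ (n + 1) +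
        N * Real.exp (-(δ ^ 2 / 4)) ^ (n + 1) := by
    have hd2 : |δ / 2| = δ / 2 := abs_of_pos (by positivity)
    refine (Finset.abs_sum_le_sum_abs _ _).trans ?_
    calc ∑ j ∈ Finset.range (n + 1 + 1), |((j : ℝ) - α * N) * π j|
        ≤ ∑ j ∈ Finset.range (n + 1 + 1), (δ * N * π j +
            N * (π j * Real.exp (δ / 2 * (j - α * N) - δ / 2 * (δ * N))) +
            N * (π j * Real.exp (-(δ / 2) * (j - α * N) - δ / 2 * (δ * N)))) := by
          refine Finset.sum_le_sum fun j hj => ?_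
          have hjN : (j : ℝ) ≤ N := by
            rw [hN]
            exact_mod_cast Nat.lt_succ_iff.1 (Finset.mem_range.1 hj)
          have h := abs_sub_le_tilt hNpos.le (Nat.cast_nonneg j) hjN (mul_nonneg hα0 hNpos.le)
            (mul_le_of_le_one_left hNpos.le hα1) (θ := δ / 2) (D := δ * N) (by positivity)
            (by positivity)
          rw [abs_mul, abs_of_nonneg (hπ0 j)]
          refine (mul_le_mul_of_nonneg_right h (hπ0 j)).trans_eq ?_
          rw [mul_sub (δ / 2) _ (δ * N), mul_add (-(δ / 2)) _ (δ * N), neg_mul (δ / 2) (δ * N),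
            ← sub_eq_add_neg]
          ring
      _ ≤ _ := by
          rw [Finset.sum_add_distrib, Finset.sum_add_distrib, ← Finset.mul_sum, ← Finset.mul_sum,
            ← Finset.mul_sum, hsum]
          gcongr
          · exact htail _ hd2
          · exact htail _ (by rw [abs_neg, hd2])
  have hid : ∑ j ∈ Finset.range (n + 1 + 1), ((j : ℝ) - α * N) * π j =
      N * (α * (walkProb q n s - walkProb q (n + 1) (s + e))) := by
    simp only [sub_mul]
    rw [Finset.sum_sub_distrib, ← Finset.mul_sum, hsum, hmean]
    ring
  rw [hid, abs_mul, abs_of_pos hNpos, abs_mul, abs_of_nonneg hα0] at key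
  refine le_of_mul_le_mul_left (key.trans_eq ?_) hNpos
  ring

/-- A lower bound decaying slower than every exponential makes the exponential error of
`abs_walkProb_sub_le` negligible. -/
theorem walkProb_isEquivalent {q : PMF ℕ} {e : ℕ} (he : q e ≠ 0) {n s : ℕ → ℕ}
    (hn : Tendsto n atTop atTop)
    (hsub : ∀ r : ℝ, 0 < r → r < 1 → ∃ C > 0, ∀ᶠ t in atTop,
      C * r ^ n t ≤ walkProb q (n t + 1) (s t + e)) :
    Asymptotics.IsEquivalent atTop (fun t => walkProb q (n t) (s t))
      (fun t => walkProb q (n t + 1) (s t + e)) := by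
  rw [Asymptotics.IsEquivalent, Asymptotics.isLittleO_iff]
  intro ε hε
  have hα : 0 < (q e).toReal := ENNReal.toReal_pos he (q.apply_ne_top e)
  set α := (q e).toReal
  obtain ⟨δ, hδ, hδ1, hδε⟩ : ∃ δ : ℝ, 0 < δ ∧ δ ≤ 1 ∧ δ ≤ α * ε / 2 :=
    ⟨min 1 (α * ε / 2), by positivity, min_le_left _ _, min_le_right _ _⟩
  set ρ := Real.exp (-(δ ^ 2 / 4)) with hρ
  have hρ0 : 0 < ρ := Real.exp_pos _
  have hρ1 : ρ < 1 := Real.exp_lt_one_iff.2 (neg_lt_zero.2 (by positivity))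
  -- Any rate strictly between the error rate `ρ` and 1 makes the error over the lower bound, of
  -- order (ρ/r)^n, vanish.
  obtain ⟨r, hr, hr1⟩ := exists_between hρ1
  have hr0 : 0 < r := hρ0.trans hr
  obtain ⟨C, hC, hev⟩ := hsub r hr0 hr1
  have hlim : Tendsto (fun t => (ρ / r) ^ n t) atTop (𝓝 0) :=
    (tendsto_pow_atTop_nhds_zero_of_lt_one (by positivity) ((div_lt_one hr0).2 hr)).comp hn
  filter_upwards [hev, hlim.eventually (gt_mem_nhds (show 0 < α * ε * C / 4 by positivity))]
    with t h1 h2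
  have h3 := abs_walkProb_sub_le q e (n t) (s t) hδ hδ1
  set w := walkProb q (n t + 1) (s t + e)
  have hw : 0 ≤ w := walkProb_nonneg _ _ _
  change ‖walkProb q (n t) (s t) - w‖ ≤ ε * ‖w‖
  rw [Real.norm_eq_abs, Real.norm_of_nonneg hw]
  have h4 : 2 * ρ ^ (n t + 1) ≤ α * ε / 2 * w := by
    have h5 : ρ ^ n t ≤ α * ε * C / 4 * r ^ n t := by
      rw [div_pow, div_lt_iff₀ (by positivity)] at h2
      exact h2.le
    have h6 : ρ ^ (n t + 1) ≤ ρ ^ n t := pow_le_pow_of_le_one hρ0.le hρ1.le (by omega)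
    have h7 : α * ε / 4 * (C * r ^ n t) ≤ α * ε / 4 * w :=
      mul_le_mul_of_nonneg_left h1 (by positivity)
    linarith
  have h8 : δ * w ≤ α * ε / 2 * w := mul_le_mul_of_nonneg_right hδε hw
  refine le_of_mul_le_mul_left ?_ hα
  linarith

/-! ### Lower bounds for the random walk -/

theorem period_eq_setGcd {q : PMF ℕ} (h : NonDegenerate q) :
    period q = Nat.setGcd q.support := by
  have hd : Nat.setGcd q.support ≠ 0 := by
    obtain ⟨n, hn, hq⟩ := h.exists_pos
    rw [Ne, Nat.setGcd_eq_zero_iff]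
    exact fun H => hn (H hq)
  have : {k : ℕ | q.toMeasure {n : ℕ | k ∣ n} = 1} = {k | k ∣ Nat.setGcd q.support} := by
    ext k
    rw [Set.mem_ofPred_eq, PMF.toMeasure_apply_eq_one_iff _ (MeasurableSet.of_discrete),
      Set.mem_ofPred_eq, Nat.dvd_setGcd_iff]
    rfl
  rw [period, this]
  refine le_antisymm (csSup_le ⟨1, one_dvd _⟩ fun k hk => Nat.le_of_dvd (Nat.pos_of_ne_zero hd) hk)
    (le_csSup ⟨Nat.setGcd q.support, fun k hk => Nat.le_of_dvd (Nat.pos_of_ne_zero hd) hk⟩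
      (dvd_refl _))

theorem period_pos {q : PMF ℕ} (h : NonDegenerate q) : 0 < period q := by
  rw [period_eq_setGcd h]
  refine Nat.pos_of_ne_zero fun H => ?_
  obtain ⟨n, hn, hq⟩ := h.exists_pos
  exact hn (Nat.setGcd_eq_zero_iff.1 H hq)

theorem period_dvd {q : PMF ℕ} (h : NonDegenerate q) {n : ℕ} (hn : q n ≠ 0) : period q ∣ n := by
  rw [period_eq_setGcd h]
  exact Nat.setGcd_dvd_of_mem ((PMF.mem_support_iff _ _).2 hn)

theorem walkProb_zero_zero (q : PMF ℕ) : walkProb q 0 0 = 1 := by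
  rw [walkProb, pow_zero, PowerSeries.coeff_one, if_pos rfl]

theorem walkProb_eq_zero_of_not_dvd {q : PMF ℕ} (h : NonDegenerate q) {n s : ℕ}
    (hs : ¬ period q ∣ s) : walkProb q n s = 0 := by
  induction n generalizing s with
  | zero =>
    rw [walkProb, pow_zero, PowerSeries.coeff_one, if_neg]
    rintro rfl
    exact hs (dvd_zero _)
  | succ n ih =>
    rw [walkProb, pow_succ, PowerSeries.coeff_mul]
    refine Finset.sum_eq_zero fun x hx => ?_
    by_cases hd : period q ∣ x.1
    · have hx2 : q x.2 = 0 := by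
        by_contra H
        refine hs ?_
        rw [← Finset.HasAntidiagonal.mem_antidiagonal.1 hx]
        exact dvd_add hd (period_dvd h H)
      rw [genSeries, PowerSeries.coeff_mk, hx2, ENNReal.toReal_zero, mul_zero]
    · rw [← walkProb, ih hd, zero_mul]

theorem pow_mul_walkProb_le (q : PMF ℕ) (n s i : ℕ) :
    (q 0).toReal ^ i * walkProb q n s ≤ walkProb q (n + i) s := by
  induction i with
  | zero => simp
  | succ i ih =>
    calc (q 0).toReal ^ (i + 1) * walkProb q n s
        = ((q 0).toReal ^ i * walkProb q n s) * walkProb q 1 0 := by rw [walkProb_one]; ring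
      _ ≤ walkProb q (n + i) s * walkProb q 1 0 :=
          mul_le_mul_of_nonneg_right ih (walkProb_nonneg _ _ _)
      _ ≤ walkProb q (n + (i + 1)) s := walkProb_mul_le q (n + i) 1 s 0

theorem pow_walkProb_le (q : PMF ℕ) (n j : ℕ) :
    walkProb q n n ^ j ≤ walkProb q (j * n) (j * n) := by
  induction j with
  | zero => simp [walkProb_zero_zero]
  | succ j ih =>
    rw [pow_succ, Nat.succ_mul]
    exact (mul_le_mul_of_nonneg_right ih (walkProb_nonneg _ _ _)).trans (walkProb_mul_le q _ _ _ _)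

/-- A step e ≥ 1 padded with e - 1 null steps is a walk of e steps with sum e, and such walks can be
concatenated. -/
theorem walkProb_self_pos_of_mem_closure {q : PMF ℕ} (h : NonDegenerate q) {n : ℕ}
    (hn : n ∈ AddSubmonoid.closure q.support) : 0 < walkProb q n n := by
  have h0 : 0 < (q 0).toReal := ENNReal.toReal_pos h.zero_pos.ne' (q.apply_ne_top 0)
  induction hn using AddSubmonoid.closure_induction with
  | mem e he =>
    rcases e with _ | e
    · rw [walkProb_zero_zero]; exact one_pos
    · have he' : 0 < walkProb q 1 (e + 1) := by
        rw [walkProb_one]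
        exact ENNReal.toReal_pos ((PMF.mem_support_iff _ _).1 he) (q.apply_ne_top _)
      have := pow_mul_walkProb_le q 1 (e + 1) e
      rw [add_comm 1 e] at this
      exact lt_of_lt_of_le (by positivity) this
  | zero => rw [walkProb_zero_zero]; exact one_pos
  | add a b _ _ ha hb => exact lt_of_lt_of_le (mul_pos ha hb) (walkProb_mul_le q a b a b)

theorem exists_forall_walkProb_self_pos {q : PMF ℕ} (h : NonDegenerate q) :
    ∃ m, ∀ n ≥ m, period q ∣ n → 0 < walkProb q n n := by
  obtain ⟨m, hm⟩ := Nat.exists_mem_closure_of_ge q.support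
  exact ⟨m, fun n hn hd => walkProb_self_pos_of_mem_closure h
    (hm n hn (by rwa [← period_eq_setGcd h]))⟩

/-- Supermultiplicativity on the diagonal: write n = jk + i with m ≤ i < m + k. The j blocks of
length k give r^(jk), and the finitely many admissible remainders i share a positive lower bound. -/
theorem exists_le_walkProb_self {q : PMF ℕ} (h : NonDegenerate q) {r : ℝ} (hr0 : 0 < r)
    (hr1 : r < 1) {k : ℕ} (hk : 0 < k) (hrk : r ^ k ≤ walkProb q k k) :
    ∃ C > 0, ∃ m, ∀ n ≥ m, period q ∣ n → C * r ^ n ≤ walkProb q n n := by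
  obtain ⟨m, hm⟩ := exists_forall_walkProb_self_pos h
  have hkd : period q ∣ k := by
    by_contra H
    rw [walkProb_eq_zero_of_not_dvd h H] at hrk
    exact absurd hrk (not_le.2 (pow_pos hr0 k))
  obtain ⟨C, hC, hCm⟩ : ∃ C > 0, ∀ i ∈ (Finset.Ico m (m + k)).filter (period q ∣ ·),
      C ≤ walkProb q i i := by
    by_cases hne : ((Finset.Ico m (m + k)).filter (period q ∣ ·)).Nonempty
    · obtain ⟨i, hi, hmin⟩ := Finset.exists_min_image _ (fun i => walkProb q i i) hne
      simp only [Finset.mem_filter, Finset.mem_Ico] at hi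
      exact ⟨walkProb q i i, hm i hi.1.1 hi.2, hmin⟩
    · rw [Finset.not_nonempty_iff_eq_empty] at hne
      exact ⟨1, one_pos, by simp [hne]⟩
  refine ⟨C, hC, m, fun n hn hd => ?_⟩
  set j := (n - m) / k with hj
  have hdm := Nat.div_add_mod (n - m) k
  have hml := Nat.mod_lt (n - m) hk
  rw [← hj, mul_comm] at hdm
  set i := m + (n - m) % k with hi
  have hn' : n = j * k + i := by omega
  have hid : period q ∣ i := (Nat.dvd_add_right (hkd.mul_left j)).1 (hn' ▸ hd)
  have h1 : C ≤ walkProb q i i := hCm i (by simp [hid]; omega)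
  calc C * r ^ n = r ^ i * ((r ^ k) ^ j * C) := by rw [hn']; ring
    _ ≤ 1 * ((r ^ k) ^ j * C) :=
        mul_le_mul_of_nonneg_right (pow_le_one₀ hr0.le hr1.le) (by positivity)
    _ ≤ walkProb q (j * k) (j * k) * walkProb q i i := by
        rw [one_mul]
        refine mul_le_mul ?_ h1 hC.le (walkProb_nonneg _ _ _)
        exact (pow_le_pow_left₀ (by positivity) hrk j).trans (pow_walkProb_le q k j)
    _ ≤ walkProb q n n := hn' ▸ walkProb_mul_le q (j * k) i (j * k) i

/-! ### The total progeny -/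

/-- `v` is the law of the total progeny of a Galton–Watson tree with offspring distribution `q`. -/
def IsTotalProgeny (q v : PMF ℕ) : Prop := ∀ x < 1, pgf v x = x * pgf q (pgf v x)

/-- In a forest of k + 1 trees, deleting the first root leaves a forest of k + j trees, j being its
number of children. -/
theorem IsTotalProgeny.sumLaw_succ {q v : PMF ℕ} (hv : IsTotalProgeny q v) (k : ℕ) :
    sumLaw v (k + 1) = (q.bind fun j => sumLaw v (k + j)).map (· + 1) := by
  refine pmf_eq_of_pgf_eq fun x hx => ?_
  rw [pgf_map_succ, pgf_bind, pgf_sumLaw]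
  simp only [pgf_sumLaw, pow_add]
  have : ∑' j, q j * (pgf v x ^ k * pgf v x ^ j) = pgf v x ^ k * pgf q (pgf v x) := by
    rw [pgf.eq_1 q, ← ENNReal.tsum_mul_left]
    exact tsum_congr fun j => by ring
  rw [this, pow_one]
  nth_rewrite 2 [hv x hx]
  ring

/-- In the critical case the mean m satisfies m = 1 + m. -/
theorem IsTotalProgeny.mean_eq_top {q v : PMF ℕ} (hv : IsTotalProgeny q v) (hc : IsCritical q) :
    mean v = ∞ := by
  have h := congrArg mean (hv.sumLaw_succ 0)
  simp only [zero_add] at h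
  rw [mean_map_succ, mean_bind, mean_sumLaw] at h
  simp only [mean_sumLaw, ← mul_assoc] at h
  rw [ENNReal.tsum_mul_right, ← mean_eq_tsum, show mean q = 1 from hc] at h
  by_contra H
  have h2 : mean v + 0 = mean v + 1 := by simpa using h
  exact zero_ne_one ((ENNReal.add_right_inj H).1 h2)

theorem map_succ_apply (q : PMF ℕ) (n : ℕ) : q.map (· + 1) (n + 1) = q n := by
  rw [PMF.map_apply, tsum_eq_single n, if_pos rfl]
  exact fun m hm => if_neg (by omega)

theorem map_succ_apply_zero (q : PMF ℕ) : q.map (· + 1) 0 = 0 := by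
  rw [PMF.map_apply]
  exact ENNReal.tsum_eq_zero.2 fun m => if_neg (by omega)

theorem IsTotalProgeny.sumLaw_eq_zero {q v : PMF ℕ} (hv : IsTotalProgeny q v) {n k : ℕ}
    (hnk : n < k) : sumLaw v k n = 0 := by
  induction n generalizing k with
  | zero =>
    obtain ⟨k, rfl⟩ := Nat.exists_eq_succ_of_ne_zero hnk.ne'
    rw [Nat.succ_eq_add_one, hv.sumLaw_succ, map_succ_apply_zero]
  | succ n ih =>
    obtain ⟨k, rfl⟩ := Nat.exists_eq_succ_of_ne_zero (Nat.ne_zero_of_lt hnk)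
    rw [Nat.succ_eq_add_one, hv.sumLaw_succ, map_succ_apply, PMF.bind_apply]
    refine ENNReal.tsum_eq_zero.2 fun j => ?_
    rw [ih (by omega), mul_zero]

/-- The hitting time theorem. -/
theorem IsTotalProgeny.mul_sumLaw {q v : PMF ℕ} (hv : IsTotalProgeny q v) (k m : ℕ) :
    ((m + k : ℕ) : ℝ) * (sumLaw v k (m + k)).toReal = k * walkProb q (m + k) m := by
  obtain ⟨n, hn⟩ : ∃ n, n = m + k := ⟨_, rfl⟩
  induction n generalizing k m with
  | zero =>
    obtain ⟨rfl, rfl⟩ : m = 0 ∧ k = 0 := by omega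
    simp
  | succ n ih =>
    rcases k with _ | k
    · obtain ⟨m, rfl⟩ : ∃ m', m = m' + 1 := ⟨n, by omega⟩
      simp [sumLaw]
    have hn' : n = m + k := by omega
    have h1 : (sumLaw v (k + 1) (m + (k + 1))).toReal =
        ∑ x ∈ Finset.HasAntidiagonal.antidiagonal m,
          (q x.1).toReal * (sumLaw v (k + x.1) (m + k)).toReal := by
      rw [hv.sumLaw_succ, ← add_assoc, map_succ_apply, PMF.bind_apply,
        tsum_eq_sum (s := Finset.range (m + 1)), ENNReal.toReal_sum,
        Finset.Nat.sum_antidiagonal_eq_sum_range_succ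
          (fun a _ => (q a).toReal * (sumLaw v (k + a) (m + k)).toReal)]
      · simp only [ENNReal.toReal_mul]
      · exact fun j _ => ENNReal.mul_ne_top (PMF.apply_ne_top _ _) (PMF.apply_ne_top _ _)
      · intro j hj
        rw [hv.sumLaw_eq_zero (by simp at hj; omega), mul_zero]
    -- The inductive step ends by cancelling n, so n = 0 is treated apart.
    rcases Nat.eq_zero_or_pos n with h0 | hpos
    · obtain ⟨rfl, rfl⟩ : m = 0 ∧ k = 0 := by omega
      rw [h1]
      simp [sumLaw, walkProb_one]
    -- Once the first root is removed, the induction hypothesis applies with k + j trees; the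
    -- resulting factor k + j splits into a convolution and the exchangeability sum of
    -- `sum_mul_walkProb`.
    have h2 : (n : ℝ) * (sumLaw v (k + 1) (m + (k + 1))).toReal =
        ∑ x ∈ Finset.HasAntidiagonal.antidiagonal m,
          (k + x.1) * (q x.1).toReal * walkProb q n x.2 := by
      rw [h1, Finset.mul_sum]
      refine Finset.sum_congr rfl fun x hx => ?_
      have hx' := Finset.HasAntidiagonal.mem_antidiagonal.1 hx
      have := ih (k + x.1) x.2 (by omega)
      rw [show x.2 + (k + x.1) = m + k by omega, ← hn'] at this
      rw [← hn', mul_left_comm, this]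
      push_cast
      ring
    have h3 : walkProb q (n + 1) m = ∑ x ∈ Finset.HasAntidiagonal.antidiagonal m,
        (q x.1).toReal * walkProb q n x.2 := by
      rw [walkProb, pow_succ', PowerSeries.coeff_mul]
      refine Finset.sum_congr rfl fun x _ => ?_
      rw [genSeries, PowerSeries.coeff_mk]
      rfl
    have h4 := sum_mul_walkProb q n m
    have h5 : (n : ℝ) * (sumLaw v (k + 1) (m + (k + 1))).toReal = k * walkProb q (n + 1) m +
        ∑ x ∈ Finset.HasAntidiagonal.antidiagonal m, x.1 * (q x.1).toReal * walkProb q n x.2 := by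
      rw [h2, h3, Finset.mul_sum, ← Finset.sum_add_distrib]
      exact Finset.sum_congr rfl fun x _ => by ring
    have hnr : (n : ℝ) = m + k := by rw [hn']; push_cast; ring
    have hn0 : (n : ℝ) ≠ 0 := by positivity
    rw [← add_assoc, ← hn'] at h5 ⊢
    refine mul_left_cancel₀ hn0 ?_
    push_cast
    calc (n : ℝ) * ((n + 1) * (sumLaw v (k + 1) (n + 1)).toReal)
        = (n + 1) * (n * (sumLaw v (k + 1) (n + 1)).toReal) := by ring
      _ = (n + 1) * (k * walkProb q (n + 1) m) + m * walkProb q (n + 1) m := by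
          rw [h5, mul_add, h4]
      _ = n * ((k + 1) * walkProb q (n + 1) m) := by rw [hnr]; ring

theorem sumLaw_one (v : PMF ℕ) : sumLaw v 1 = v :=
  pmf_eq_of_pgf_eq fun x _ => by rw [pgf_sumLaw, pow_one]

theorem IsTotalProgeny.mul_apply_succ {q v : PMF ℕ} (hv : IsTotalProgeny q v) (m : ℕ) :
    ((m + 1 : ℕ) : ℝ) * (v (m + 1)).toReal = walkProb q (m + 1) m := by
  have := hv.mul_sumLaw 1 m
  rwa [sumLaw_one, Nat.cast_one, one_mul] at this

/-- The mean of v is Σ W(m+1, m), with W = `walkProb q`, by the hitting time theorem. One step e + 2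
and e null steps lead from (m+1, m) to the diagonal, so geometric decay on the diagonal would make
this sum finite, against `mean_eq_top`. -/
theorem IsTotalProgeny.exists_pow_le_walkProb {q v : PMF ℕ} (hv : IsTotalProgeny q v)
    (h : NonDegenerate q) (hc : IsCritical q) {r : ℝ} (hr0 : 0 < r) (hr1 : r < 1) :
    ∃ k > 0, r ^ k ≤ walkProb q k k := by
  by_contra! H
  obtain ⟨e, he⟩ : ∃ e, q (e + 2) ≠ 0 := by
    by_contra! H
    have hsum : q 0 + (q 1 + ∑' n, q (n + 2)) = 1 := by
      rw [← q.tsum_coe, tsum_eq_zero_add_tsum_succ q,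
        tsum_eq_zero_add_tsum_succ fun n => q (n + 1)]
    rw [ENNReal.tsum_eq_zero.2 H, add_zero] at hsum
    exact h.zero_add_one_lt_one.ne hsum
  have h0 : 0 < (q 0).toReal := ENNReal.toReal_pos h.zero_pos.ne' (q.apply_ne_top 0)
  have he0 : 0 < (q (e + 2)).toReal := ENNReal.toReal_pos he (q.apply_ne_top _)
  set D := (q 0).toReal ^ e * (q (e + 2)).toReal with hD
  have hDpos : 0 < D := by positivity
  have hle : ∀ m : ℕ, walkProb q (m + 1) m ≤ D⁻¹ * r ^ m := by
    intro m
    rw [inv_mul_eq_div, le_div_iff₀ hDpos]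
    calc walkProb q (m + 1) m * D
        = (q 0).toReal ^ e * (walkProb q (m + 1) m * walkProb q 1 (e + 2)) := by
          rw [walkProb_one, hD]; ring
      _ ≤ (q 0).toReal ^ e * walkProb q (m + 1 + 1) (m + (e + 2)) :=
          mul_le_mul_of_nonneg_left (walkProb_mul_le _ _ _ _ _) (by positivity)
      _ ≤ walkProb q (m + (e + 2)) (m + (e + 2)) := by
          have := pow_mul_walkProb_le q (m + 1 + 1) (m + (e + 2)) e
          rwa [show m + 1 + 1 + e = m + (e + 2) by ring] at this
      _ ≤ r ^ (m + (e + 2)) := (H _ (by omega)).le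
      _ ≤ r ^ m := pow_le_pow_of_le_one hr0.le hr1.le (by omega)
  have hsum : Summable fun m : ℕ => D⁻¹ * r ^ m :=
    (summable_geometric_of_lt_one hr0.le hr1).mul_left _
  have hfin : ∑' n : ℕ, v n * (n : ℝ≥0∞) ≤ ∑' m : ℕ, ENNReal.ofReal (D⁻¹ * r ^ m) := by
    rw [tsum_eq_zero_add_tsum_succ fun n => v n * (n : ℝ≥0∞)]
    simp only [Nat.cast_zero, mul_zero, zero_add]
    refine ENNReal.tsum_le_tsum fun m => ?_
    refine ENNReal.le_ofReal_iff_toReal_le (ENNReal.mul_ne_top (PMF.apply_ne_top _ _)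
      (ENNReal.natCast_ne_top _)) (by positivity) |>.2 ?_
    rw [ENNReal.toReal_mul, ENNReal.toReal_natCast, mul_comm, hv.mul_apply_succ]
    exact hle m
  rw [← mean_eq_tsum, hv.mean_eq_top hc, ← ENNReal.ofReal_tsum_of_nonneg (fun m => by positivity)
    hsum] at hfin
  exact absurd hfin (not_le.2 ENNReal.ofReal_lt_top)

/-! ### Ratio limits -/

/-- The required subexponential lower bound comes from the diagonal padded by null steps, which is
why the number of steps must be at least the sum. -/
theorem IsTotalProgeny.walkProb_step {q v : PMF ℕ} (hv : IsTotalProgeny q v)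
    (h : NonDegenerate q) (hc : IsCritical q) {e i j : ℕ} (he : q e ≠ 0) (hj : period q ∣ j)
    (hij : j + e ≤ i + 1) :
    Asymptotics.IsEquivalent atTop
      (fun t : ℕ => walkProb q (period q * t + i) (period q * t + j))
      (fun t : ℕ => walkProb q (period q * t + (i + 1)) (period q * t + (j + e))) := by
  have hd := period_pos h
  have h0 : 0 < (q 0).toReal := ENNReal.toReal_pos h.zero_pos.ne' (q.apply_ne_top 0)
  simp only [← add_assoc]
  refine walkProb_isEquivalent (n := fun t => period q * t + i) (s := fun t => period q * t + j) he
    (tendsto_atTop_mono (fun t => (Nat.le_mul_of_pos_left t hd).trans (Nat.le_add_right _ _))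
      tendsto_id) fun r hr0 hr1 => ?_
  obtain ⟨k, hk, hrk⟩ := hv.exists_pow_le_walkProb h hc hr0 hr1
  obtain ⟨C, hC, m, hm⟩ := exists_le_walkProb_self h hr0 hr1 hk hrk
  obtain ⟨l, hl⟩ := Nat.exists_eq_add_of_le hij
  refine ⟨(q 0).toReal ^ l * (C * r), by positivity, ?_⟩
  filter_upwards [eventually_ge_atTop m] with t ht
  have hmt : m ≤ period q * t + (j + e) := by
    have := Nat.le_mul_of_pos_left t hd
    omega
  have h1 := hm _ hmt ((dvd_mul_right _ t).add (hj.add (period_dvd h he)))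
  have h2 := pow_mul_walkProb_le q (period q * t + (j + e)) (period q * t + (j + e)) l
  calc (q 0).toReal ^ l * (C * r) * r ^ (period q * t + i)
      = (q 0).toReal ^ l * (C * r ^ (period q * t + (i + 1))) := by ring
    _ ≤ (q 0).toReal ^ l * (C * r ^ (period q * t + (j + e))) := by
        gcongr (q 0).toReal ^ l * (C * ?_)
        exact pow_le_pow_of_le_one hr0.le hr1.le (by omega)
    _ ≤ (q 0).toReal ^ l * walkProb q (period q * t + (j + e)) (period q * t + (j + e)) := by
        gcongr
    _ ≤ _ := by
        rw [show period q * t + (j + e) + l = period q * t + i + 1 by omega] at h2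
        rwa [add_assoc _ j e]

theorem IsTotalProgeny.walkProb_add_left {q v : PMF ℕ} (hv : IsTotalProgeny q v)
    (h : NonDegenerate q) (hc : IsCritical q) {i j : ℕ} (k : ℕ) (hj : period q ∣ j)
    (hij : j ≤ i) :
    Asymptotics.IsEquivalent atTop
      (fun t : ℕ => walkProb q (period q * t + i) (period q * t + j))
      (fun t : ℕ => walkProb q (period q * t + (i + k)) (period q * t + j)) := by
  induction k with
  | zero => exact Asymptotics.IsEquivalent.refl
  | succ k ih =>
    exact ih.trans (hv.walkProb_step h hc (e := 0) h.zero_pos.ne' hj (by omega))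

/-- Inserting null steps is asymptotically free, so the numbers of steps on both sides can be
aligned and only the displacement `a`, a sum of elements of the support, matters. -/
theorem IsTotalProgeny.walkProb_chain {q v : PMF ℕ} (hv : IsTotalProgeny q v)
    (h : NonDegenerate q) (hc : IsCritical q) {a : ℕ}
    (ha : a ∈ AddSubmonoid.closure q.support) {i j i' : ℕ} (hj : period q ∣ j) (hij : j ≤ i)
    (hij' : j + a ≤ i') :
    Asymptotics.IsEquivalent atTop
      (fun t : ℕ => walkProb q (period q * t + i) (period q * t + j))
      (fun t : ℕ => walkProb q (period q * t + i') (period q * t + (j + a))) := by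
  induction ha using AddSubmonoid.closure_induction generalizing i j i' with
  | mem e he =>
    have he' : q e ≠ 0 := (PMF.mem_support_iff _ _).1 he
    have h1 := hv.walkProb_add_left h hc (i' + e) hj hij
    have h2 := hv.walkProb_step h hc (i := i + (i' + e)) he' hj (by omega)
    have h3 := hv.walkProb_add_left h hc (i := i') (i + e + 1) (hj.add (period_dvd h he')) hij'
    rw [show i' + (i + e + 1) = i + (i' + e) + 1 by omega] at h3
    exact (h1.trans h2).trans h3.symm
  | zero =>
    have h1 := hv.walkProb_add_left h hc i' hj hij
    have h2 := hv.walkProb_add_left h hc i hj (i := i') (by omega)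
    rw [add_comm i' i] at h2
    exact h1.trans h2.symm
  | add a b ha hb iha ihb =>
    have had : period q ∣ a := by
      rw [period_eq_setGcd h]
      exact Nat.setGcd_dvd_of_mem_closure ha
    rw [← add_assoc] at hij' ⊢
    exact (iha hj hij le_rfl).trans (ihb (hj.add had) le_rfl hij')

theorem IsTotalProgeny.walkProb_period {q v : PMF ℕ} (hv : IsTotalProgeny q v)
    (h : NonDegenerate q) (hc : IsCritical q) :
    Asymptotics.IsEquivalent atTop
      (fun t : ℕ => walkProb q (period q * t + 1) (period q * t))
      (fun t : ℕ => walkProb q (period q * (t + 1) + 1) (period q * (t + 1))) := by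
  obtain ⟨m, hm⟩ := Nat.exists_mem_closure_of_ge q.support
  rw [← period_eq_setGcd h] at hm
  have hd := period_pos h
  have hmd := Nat.le_mul_of_pos_left m hd
  -- The period d itself need not be a sum of support elements, but d + dm and dm are for this m;
  -- both sequences are compared with the one displaced by d + dm.
  have h1 := hv.walkProb_chain h hc (hm (period q + period q * m) (by omega)
    ((dvd_refl _).add (dvd_mul_right _ _))) (i := 1) (i' := period q + period q * m + 1)
    (dvd_zero _) (by omega) (by omega)
  have h2 := hv.walkProb_chain h hc (hm (period q * m) (by omega) (dvd_mul_right _ _))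
    (i := period q + 1) (i' := period q + period q * m + 1) (dvd_refl _) (by omega) (by omega)
  rw [zero_add] at h1
  have h3 := h1.trans h2.symm
  simp only [add_zero] at h3
  simpa only [mul_add, mul_one, add_assoc] using h3

theorem IsTotalProgeny.apply_succ {q v : PMF ℕ} (hv : IsTotalProgeny q v) (m : ℕ) :
    (v (m + 1)).toReal = walkProb q (m + 1) m / (m + 1 : ℕ) := by
  rw [eq_div_iff (by positivity), mul_comm, hv.mul_apply_succ]

theorem IsTotalProgeny.isEquivalent_period {q v : PMF ℕ} (hv : IsTotalProgeny q v)
    (h : NonDegenerate q) (hc : IsCritical q) :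
    Asymptotics.IsEquivalent atTop
      (fun t : ℕ => (v (period q * (t + 1) + 1)).toReal)
      (fun t : ℕ => (v (period q * t + 1)).toReal) := by
  simp only [hv.apply_succ]
  refine (hv.walkProb_period h hc).symm.div ?_
  have hd : 0 < (period q : ℝ) := by exact_mod_cast period_pos h
  rw [Asymptotics.IsEquivalent, Asymptotics.isLittleO_iff]
  intro ε hε
  filter_upwards [eventually_ge_atTop ⌈1 / ε⌉₊] with t ht
  have ht' : 1 / ε ≤ t := Nat.ceil_le.1 ht
  rw [div_le_iff₀ hε] at ht'
  have e : ((fun t : ℕ => ((period q * (t + 1) + 1 : ℕ) : ℝ)) -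
      fun t : ℕ => ((period q * t + 1 : ℕ) : ℝ)) t = period q := by
    simp only [Pi.sub_apply]
    push_cast
    ring
  rw [e, Real.norm_of_nonneg hd.le, Real.norm_of_nonneg (Nat.cast_nonneg _)]
  push_cast
  nlinarith

theorem IsTotalProgeny.apply_eq_zero {q v : PMF ℕ} (hv : IsTotalProgeny q v)
    (h : NonDegenerate q) {m : ℕ} (hm : ¬ period q ∣ m) : v (m + 1) = 0 := by
  have := hv.apply_succ m
  rw [walkProb_eq_zero_of_not_dvd h hm, zero_div, ENNReal.toReal_eq_zero_iff] at this
  exact this.resolve_right (v.apply_ne_top _)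

theorem IsTotalProgeny.exists_forall_pos {q v : PMF ℕ} (hv : IsTotalProgeny q v)
    (h : NonDegenerate q) : ∃ m, ∀ n ≥ m, period q ∣ n → v (n + 1) ≠ 0 := by
  obtain ⟨m, hm⟩ := exists_forall_walkProb_self_pos h
  refine ⟨m, fun n hn hd H => ?_⟩
  have h1 := hv.mul_apply_succ n
  rw [H, ENNReal.toReal_zero, mul_zero] at h1
  have h2 := pow_mul_walkProb_le q n n 1
  have h0 : 0 < (q 0).toReal := ENNReal.toReal_pos h.zero_pos.ne' (q.apply_ne_top 0)
  have := mul_pos h0 (hm n hn hd)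
  rw [pow_one, ← h1] at h2
  exact absurd h2 (not_le.2 this)

/-- Off the progression 1 + dℕ, d the period, both values vanish, so the ratio limit along it
becomes an estimate for all large n. -/
theorem IsTotalProgeny.eventually_abs_sub_le {q v : PMF ℕ} (hv : IsTotalProgeny q v)
    (h : NonDegenerate q) (hc : IsCritical q) {ε : ℝ} (hε : 0 < ε) :
    ∀ᶠ n in atTop, |(v (n + period q)).toReal - (v n).toReal| ≤ ε * (v n).toReal := by
  have hE := hv.isEquivalent_period h hc
  rw [Asymptotics.IsEquivalent, Asymptotics.isLittleO_iff] at hE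
  obtain ⟨T, hT⟩ := eventually_atTop.1 (hE hε)
  filter_upwards [eventually_ge_atTop (period q * T + 1)] with n hn
  obtain ⟨m, rfl⟩ : ∃ m, n = m + 1 := ⟨n - 1, by omega⟩
  by_cases hd : period q ∣ m
  · obtain ⟨t, rfl⟩ := hd
    have ht : T ≤ t := Nat.le_of_mul_le_mul_left (by omega : period q * T ≤ period q * t)
      (period_pos h)
    have := hT t ht
    rw [Pi.sub_apply, Real.norm_eq_abs, Real.norm_of_nonneg ENNReal.toReal_nonneg] at this
    rwa [show period q * t + 1 + period q = period q * (t + 1) + 1 by ring]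
  · have hd' : ¬ period q ∣ m + period q := fun H => hd ((Nat.dvd_add_left (dvd_refl _)).1 H)
    rw [show m + 1 + period q = m + period q + 1 by ring, hv.apply_eq_zero h hd,
      hv.apply_eq_zero h hd']
    simp

/-! ### Windows -/

open Classical in
/-- The indicator function of `n + D`. -/
noncomputable def window (D : Set ℕ) (n m : ℕ) : ℝ≥0∞ := if n ≤ m ∧ m - n ∈ D then 1 else 0

/-- The mass which `q` gives to `n + D`. -/
noncomputable def windowMass (q : PMF ℕ) (D : Set ℕ) (n : ℕ) : ℝ≥0∞ := ∑' m, q m * window D n m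

theorem window_sub (D : Set ℕ) {n s : ℕ} (hs : s ≤ n) (m : ℕ) :
    window D (n - s) m = window D n (s + m) := by
  have e : (n - s ≤ m ∧ m - (n - s) ∈ D) ↔ n ≤ s + m ∧ s + m - n ∈ D := by
    rw [show m - (n - s) = s + m - n by omega]
    exact and_congr_left fun _ => by omega
  unfold window
  split_ifs <;> tauto

theorem window_le_one (D : Set ℕ) (n m : ℕ) : window D n m ≤ 1 := by
  rw [window]
  split_ifs <;> simp

theorem windowMass_le_one (q : PMF ℕ) (D : Set ℕ) (n : ℕ) : windowMass q D n ≤ 1 := by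
  rw [← q.tsum_coe]
  exact ENNReal.tsum_le_tsum fun m => mul_le_of_le_one_right' (window_le_one D n m)

theorem windowMass_ne_top (q : PMF ℕ) (D : Set ℕ) (n : ℕ) : windowMass q D n ≠ ∞ :=
  ne_top_of_le_ne_top ENNReal.one_ne_top (windowMass_le_one q D n)

/-- A law whose windows of shape `D` have asymptotically non-increasing masses, up to a factor
tending to `1`. -/
structure LongTailed (q : PMF ℕ) (D : Set ℕ) : Prop where
  eventually_ne_zero : ∀ᶠ n in atTop, windowMass q D n ≠ 0
  one_le_liminf : ∀ a : ℕ,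
    1 ≤ liminf (fun n => windowMass q D (n - a) / windowMass q D n) atTop

/-- Fatou's lemma for the counting measure. -/
theorem tsum_mul_liminf_le {ι : Type*} [Countable ι] {w : ι → ℝ≥0∞} (hw : ∀ s, w s ≠ ∞)
    (f : ℕ → ι → ℝ≥0∞) :
    ∑' s, w s * liminf (fun n => f n s) atTop ≤ liminf (fun n => ∑' s, w s * f n s) atTop := by
  let _ : MeasurableSpace ι := ⊤
  calc ∑' s, w s * liminf (fun n => f n s) atTop
      = ∑' s, liminf (fun n => w s * f n s) atTop :=
        tsum_congr fun s => (ENNReal.liminf_const_mul_of_ne_top (hw s)).symm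
    _ = ∫⁻ s, liminf (fun n => w s * f n s) atTop ∂Measure.count := (lintegral_count _).symm
    _ ≤ liminf (fun n => ∫⁻ s, w s * f n s ∂Measure.count) atTop :=
        lintegral_liminf_le fun n => measurable_of_countable _
    _ = _ := by simp only [lintegral_count]

theorem liminf_add_liminf_le (f g : ℕ → ℝ≥0∞) :
    liminf f atTop + liminf g atTop ≤ liminf (fun n => f n + g n) atTop := by
  have := tsum_mul_liminf_le (w := fun _ : Bool => 1) (fun _ => ENNReal.one_ne_top)
    fun n b => if b then f n else g n
  simpa [tsum_bool] using this

/-- The sum of the first k variables and the last variable cannot both be below n/2 when the total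
is at least n, so the two contributions are disjoint. The cut at n/2 also keeps the subtractions
from being truncated. -/
theorem windowMass_sumLaw_succ_ge (q : PMF ℕ) (D : Set ℕ) (k n : ℕ) :
    ∑' s, sumLaw q k s * (if 2 * s < n then windowMass q D (n - s) else 0) +
      ∑' j, q j * (if 2 * j < n then windowMass (sumLaw q k) D (n - j) else 0) ≤
    windowMass (sumLaw q (k + 1)) D n := by
  have e1 : ∀ s, sumLaw q k s * (if 2 * s < n then windowMass q D (n - s) else 0) =
      ∑' j, sumLaw q k s * (q j * (if 2 * s < n then window D n (s + j) else 0)) := by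
    intro s
    rw [ENNReal.tsum_mul_left]
    congr 1
    split_ifs with hs
    · rw [windowMass]
      exact tsum_congr fun j => by rw [window_sub D (by omega)]
    · simp
  have e2 : ∀ j, q j * (if 2 * j < n then windowMass (sumLaw q k) D (n - j) else 0) =
      ∑' s, sumLaw q k s * (q j * (if 2 * j < n then window D n (s + j) else 0)) := by
    intro j
    split_ifs with hj
    · rw [windowMass, ← ENNReal.tsum_mul_left]
      refine tsum_congr fun s => ?_
      rw [window_sub D (by omega), add_comm j]
      ring
    · simp
  rw [tsum_congr e1, tsum_congr e2, ENNReal.tsum_comm (f := fun j s => sumLaw q k s *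
    (q j * (if 2 * j < n then window D n (s + j) else 0))), ← ENNReal.tsum_add, windowMass,
    tsum_sumLaw_succ_mul]
  refine ENNReal.tsum_le_tsum fun s => ?_
  rw [← ENNReal.tsum_add, ← ENNReal.tsum_mul_left]
  refine ENNReal.tsum_le_tsum fun j => ?_
  rw [← mul_add, ← mul_add]
  gcongr
  by_cases hn : n ≤ s + j
  · by_cases hs : 2 * s < n
    · rw [if_pos hs, if_neg (by omega), add_zero]
    · rw [if_neg hs, zero_add]
      split_ifs
      · exact le_rfl
      · exact zero_le
  · have : window D n (s + j) = 0 := if_neg fun H => hn H.1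
    simp [this]

/-- Induction on k by the single big jump: for a fixed value of the small part, the cut at half is
eventually inactive, and Fatou's lemma sums over these values. The shift `a` is kept general because
it absorbs the small part. -/
theorem LongTailed.le_liminf {q : PMF ℕ} {D : Set ℕ} (h : LongTailed q D) (k a : ℕ) :
    (k : ℝ≥0∞) ≤ liminf (fun n => windowMass (sumLaw q k) D (n - a) / windowMass q D n) atTop := by
  induction k generalizing a with
  | zero => simp
  | succ k ih =>
    have hlim : ∀ (r : PMF ℕ) (s : ℕ),
        liminf (fun n => windowMass r D (n - (a + s)) / windowMass q D n) atTop ≤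
        liminf (fun n => (if 2 * s < n - a then windowMass r D (n - a - s) else 0) /
          windowMass q D n) atTop := by
      intro r s
      refine liminf_le_liminf ?_
      filter_upwards [eventually_gt_atTop (2 * s + a)] with n hn
      rw [if_pos (by omega), Nat.sub_sub]
    have h2 : (1 : ℝ≥0∞) ≤ liminf (fun n => ∑' s, sumLaw q k s *
        ((if 2 * s < n - a then windowMass q D (n - a - s) else 0) / windowMass q D n)) atTop := by
      refine le_trans ?_ (tsum_mul_liminf_le (fun s => PMF.apply_ne_top _ s) _)
      calc (1 : ℝ≥0∞) = ∑' s, sumLaw q k s * 1 := by simp [PMF.tsum_coe]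
        _ ≤ _ := ENNReal.tsum_le_tsum fun s =>
          mul_le_mul_right ((h.one_le_liminf (a + s)).trans (hlim q s)) _
    have h3 : (k : ℝ≥0∞) ≤ liminf (fun n => ∑' j, q j *
        ((if 2 * j < n - a then windowMass (sumLaw q k) D (n - a - j) else 0) /
          windowMass q D n)) atTop := by
      refine le_trans ?_ (tsum_mul_liminf_le (fun s => PMF.apply_ne_top _ s) _)
      calc (k : ℝ≥0∞) = ∑' j, q j * k := by rw [ENNReal.tsum_mul_right, PMF.tsum_coe, one_mul]
        _ ≤ _ := ENNReal.tsum_le_tsum fun j =>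
          mul_le_mul_right ((ih (a + j)).trans (hlim (sumLaw q k) j)) _
    calc ((k + 1 : ℕ) : ℝ≥0∞) = 1 + k := by push_cast; ring
      _ ≤ _ := (add_le_add h2 h3).trans (liminf_add_liminf_le _ _)
      _ ≤ _ := by
        refine liminf_le_liminf (Eventually.of_forall fun n => ?_)
        have := ENNReal.div_le_div_right (windowMass_sumLaw_succ_ge q D k (n - a))
          (windowMass q D n)
        refine le_trans (le_of_eq ?_) this
        simp only [div_eq_mul_inv, add_mul, ← ENNReal.tsum_mul_right, mul_assoc]

/-- Tails are non-increasing, so the ratios are at least 1 for every n. -/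
theorem longTailed_univ {q : PMF ℕ} (hq : ∀ n, windowMass q Set.univ n ≠ 0) :
    LongTailed q Set.univ := by
  refine ⟨Eventually.of_forall hq, fun a => ?_⟩
  refine le_liminf_of_le (by isBoundedDefault) (Eventually.of_forall fun n => ?_)
  rw [ENNReal.le_div_iff_mul_le (Or.inl (hq n)) (Or.inl (windowMass_ne_top _ _ _)), one_mul]
  refine ENNReal.tsum_le_tsum fun m => ?_
  gcongr
  rw [window, window]
  simp only [Set.mem_univ, and_true]
  split_ifs with h1 h2
  · exact le_rfl
  · omega
  · exact zero_le
  · exact le_rfl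

theorem windowMass_Iio_succ (q : PMF ℕ) {d : ℕ} (hd : 0 < d) (n : ℕ) :
    q n + windowMass q (Set.Iio d) (n + 1) = windowMass q (Set.Iio d) n + q (n + d) := by
  have e : ∀ a, q a = ∑' m, q m * (if m = a then 1 else 0) := fun a => by
    rw [tsum_eq_single a fun m hm => by simp [hm]]
    simp
  rw [e n, e (n + d), windowMass, windowMass, ← ENNReal.tsum_add, ← ENNReal.tsum_add]
  refine tsum_congr fun m => ?_
  rw [← mul_add, ← mul_add, window, window]
  congr 1
  simp only [Set.mem_Iio]
  split_ifs <;> first | omega | simp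

/-- Moving a window of length d by one trades the point n for n + d, whose masses are asymptotically
close; finitely many moves still cost a factor close to 1. -/
theorem IsTotalProgeny.longTailed_Iio {q v : PMF ℕ} (hv : IsTotalProgeny q v)
    (h : NonDegenerate q) (hc : IsCritical q) : LongTailed v (Set.Iio (period q)) := by
  have hd := period_pos h
  have hne : ∀ᶠ n in atTop, windowMass v (Set.Iio (period q)) n ≠ 0 := by
    obtain ⟨m, hm⟩ := hv.exists_forall_pos h
    filter_upwards [eventually_gt_atTop m] with n hn
    set d := period q
    have hdm := Nat.div_add_mod (n - 1 + (d - 1)) d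
    have hml := Nat.mod_lt (n - 1 + (d - 1)) hd
    -- The least multiple of d that is at least n - 1, so that k + 1 lies in [n, n + d).
    set k := d * ((n - 1 + (d - 1)) / d) with hk
    have hvk := hm k (by omega) (dvd_mul_right _ _)
    intro H
    have := ENNReal.tsum_eq_zero.1 H (k + 1)
    rw [mul_eq_zero] at this
    refine this.elim hvk fun hw => ?_
    rw [window, if_pos ⟨by omega, by rw [Set.mem_Iio]; omega⟩] at hw
    exact one_ne_zero hw
  refine ⟨hne, fun a => ?_⟩
  have hstep : ∀ K : NNReal, 1 < K → ∀ᶠ n in atTop, windowMass v (Set.Iio (period q)) (n + 1) ≤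
      K * windowMass v (Set.Iio (period q)) n := by
    intro K hK
    have hK' : (0 : ℝ) < K - 1 := sub_pos.2 (by exact_mod_cast hK)
    filter_upwards [hv.eventually_abs_sub_le h hc hK'] with n hn
    have h1 : v (n + period q) ≤ K * v n := by
      rw [← ENNReal.toReal_le_toReal (v.apply_ne_top _)
        (ENNReal.mul_ne_top ENNReal.coe_ne_top (v.apply_ne_top _)), ENNReal.toReal_mul,
        ENNReal.coe_toReal]
      have := (abs_le.1 hn).2
      linarith
    have h2 := windowMass_Iio_succ v hd n
    have h3 : v n ≤ windowMass v (Set.Iio (period q)) n := by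
      refine le_trans (le_of_eq ?_) (ENNReal.le_tsum n)
      rw [window, if_pos ⟨le_rfl, by simpa using hd⟩, mul_one]
    have hK1 : (K : ℝ≥0∞) = 1 + (K - 1 : NNReal) := by
      norm_cast
      exact (add_tsub_cancel_of_le hK.le).symm
    refine (ENNReal.add_le_add_iff_left (v.apply_ne_top n)).1 ?_
    calc v n + windowMass v (Set.Iio (period q)) (n + 1)
        ≤ windowMass v (Set.Iio (period q)) n + (1 + (K - 1 : NNReal)) * v n := by
          rw [h2, ← hK1]
          gcongr
      _ = v n + (windowMass v (Set.Iio (period q)) n + (K - 1 : NNReal) * v n) := by ring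
      _ ≤ v n + (windowMass v (Set.Iio (period q)) n +
            (K - 1 : NNReal) * windowMass v (Set.Iio (period q)) n) := by gcongr
      _ = v n + K * windowMass v (Set.Iio (period q)) n := by rw [hK1]; ring
  have hshift : ∀ (a : ℕ) (K : NNReal), 1 < K → ∀ᶠ n in atTop,
      windowMass v (Set.Iio (period q)) (n + a) ≤ K * windowMass v (Set.Iio (period q)) n := by
    intro a
    induction a with
    | zero =>
      intro K hK
      refine Eventually.of_forall fun n => ?_
      exact le_mul_of_one_le_left' (by exact_mod_cast hK.le)
    | succ a ih =>
      intro K hK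
      -- The allowed factor K is shared between the first `a` moves and the last one.
      have hs : 1 < NNReal.sqrt K := by rwa [← NNReal.sqrt_one, NNReal.sqrt_lt_sqrt]
      filter_upwards [ih _ hs, (tendsto_add_atTop_nat a).eventually (hstep _ hs)] with n h1 h2
      calc windowMass v (Set.Iio (period q)) (n + (a + 1))
          ≤ NNReal.sqrt K * windowMass v (Set.Iio (period q)) (n + a) := h2
        _ ≤ NNReal.sqrt K * (NNReal.sqrt K * windowMass v (Set.Iio (period q)) n) := by gcongr
        _ = K * windowMass v (Set.Iio (period q)) n := by
          rw [← mul_assoc, ← ENNReal.coe_mul, NNReal.mul_self_sqrt]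
  refine le_of_forall_lt fun c hc1 => ?_
  obtain ⟨c', hcc', hc'1⟩ := exists_between hc1
  refine hcc'.trans_le (le_liminf_of_le (by isBoundedDefault) ?_)
  have hc'0 : c' ≠ 0 := (zero_le.trans_lt hcc').ne'
  have hc't : c' ≠ ∞ := hc'1.ne_top
  have hK : 1 < (c'⁻¹).toNNReal := by
    rw [← ENNReal.coe_lt_coe, ENNReal.coe_toNNReal (ENNReal.inv_ne_top.2 hc'0)]
    exact ENNReal.one_lt_inv.2 hc'1
  have hev := hshift a _ hK
  obtain ⟨N, hN⟩ := eventually_atTop.1 hev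
  filter_upwards [eventually_ge_atTop (N + a), hne] with n hn hn0
  have h1 := hN (n - a) (by omega)
  rw [Nat.sub_add_cancel (by omega), ENNReal.coe_toNNReal (ENNReal.inv_ne_top.2 hc'0)] at h1
  rw [ENNReal.le_div_iff_mul_le (Or.inl hn0) (Or.inl (windowMass_ne_top _ _ _))]
  calc c' * windowMass v (Set.Iio (period q)) n
      ≤ c' * (c'⁻¹ * windowMass v (Set.Iio (period q)) (n - a)) := by gcongr
    _ = windowMass v (Set.Iio (period q)) (n - a) := by
        rw [← mul_assoc, ENNReal.mul_inv_cancel hc'0 hc't, one_mul]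

namespace PlaneTree

/-! ### Decomposition of a tree at its root -/

theorem mem_of_prefix {t : PlaneTree} {u v : List ℕ} (h : u <+: v) (hv : v ∈ t.nodes) :
    u ∈ t.nodes := by
  obtain ⟨w, rfl⟩ := h
  induction w using List.reverseRecOn with
  | nil => simpa using hv
  | append_singleton w i ih =>
    rw [← List.append_assoc] at hv
    exact ih (t.parent_mem _ _ hv)

theorem append_mem_iff {t : PlaneTree} {u : List ℕ} (hu : u ∈ t.nodes) (i : ℕ) :
    u ++ [i] ∈ t.nodes ↔ i < t.outdegree u := by
  obtain ⟨k, hk⟩ := t.children u hu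
  have : t.outdegree u = k := by
    rw [outdegree, show {i : ℕ | u ++ [i] ∈ t.nodes} = Set.Iio k from Set.ext hk]
    simp
  rw [this, hk]

theorem outdegree_eq_iff {t : PlaneTree} {u : List ℕ} (hu : u ∈ t.nodes) (k : ℕ) :
    t.outdegree u = k ↔ ∀ i, u ++ [i] ∈ t.nodes ↔ i < k := by
  constructor
  · rintro rfl i
    exact append_mem_iff hu i
  · intro H
    rw [outdegree, show {i : ℕ | u ++ [i] ∈ t.nodes} = Set.Iio k from Set.ext H]
    simp

/-- The bound on i is needed because `subtree i t` contains the root even when there is no child i.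
-/
theorem cons_mem_iff {t : PlaneTree} (i : ℕ) (v : List ℕ) :
    i :: v ∈ t.nodes ↔ i < t.outdegree [] ∧ v ∈ (subtree i t).nodes := by
  rw [← append_mem_iff t.root_mem]
  change i :: v ∈ t.nodes ↔ [i] ∈ t.nodes ∧ (v = [] ∨ i :: v ∈ t.nodes)
  constructor
  · exact fun h => ⟨mem_of_prefix ⟨v, rfl⟩ h, Or.inr h⟩
  · rintro ⟨h1, rfl | h2⟩
    · exact h1
    · exact h2

theorem outdegree_subtree (t : PlaneTree) (i : ℕ) (u : List ℕ) :
    (subtree i t).outdegree u = t.outdegree (i :: u) := by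
  rw [outdegree, outdegree]
  congr 1
  ext j
  change u ++ [j] = [] ∨ i :: (u ++ [j]) ∈ t.nodes ↔ i :: u ++ [j] ∈ t.nodes
  simp

theorem restrict_eq_iff {h : ℕ} {s t : PlaneTree} :
    restrict h s = restrict h t ↔ ∀ u : List ℕ, u.length ≤ h → (u ∈ s.nodes ↔ u ∈ t.nodes) := by
  rw [PlaneTree.ext_iff, Set.ext_iff]
  change (∀ u, u ∈ s.nodes ∧ u.length ≤ h ↔ u ∈ t.nodes ∧ u.length ≤ h) ↔ _
  exact forall_congr' fun u => by tauto

theorem outdegree_congr {h : ℕ} {s t : PlaneTree} (e : restrict h s = restrict h t) {u : List ℕ}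
    (hu : u.length < h) : s.outdegree u = t.outdegree u := by
  rw [outdegree, outdegree]
  congr 1
  ext i
  exact restrict_eq_iff.1 e _ (by simpa using hu)

theorem restrict_subtree {h : ℕ} {s t : PlaneTree} (e : restrict (h + 1) s = restrict (h + 1) t)
    (i : ℕ) : restrict h (subtree i s) = restrict h (subtree i t) := by
  rw [restrict_eq_iff]
  intro v hv
  change (v = [] ∨ i :: v ∈ s.nodes) ↔ (v = [] ∨ i :: v ∈ t.nodes)
  rw [restrict_eq_iff.1 e (i :: v) (by simpa using hv)]

theorem restrict_succ_eq_iff {h : ℕ} {s t : PlaneTree} :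
    restrict (h + 1) s = restrict (h + 1) t ↔ s.outdegree [] = t.outdegree [] ∧
      ∀ i : Fin (t.outdegree []), restrict h (subtree i s) = restrict h (subtree i t) := by
  constructor
  · exact fun e => ⟨outdegree_congr e (by simp), fun i => restrict_subtree e i⟩
  · rintro ⟨h1, h2⟩
    rw [restrict_eq_iff]
    rintro (_ | ⟨i, v⟩) hu
    · exact iff_of_true s.root_mem t.root_mem
    · rw [cons_mem_iff, cons_mem_iff, h1]
      refine and_congr_right fun hi => ?_
      exact restrict_eq_iff.1 (h2 ⟨i, hi⟩) v (by simpa using hu)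

theorem cons_injective (i : ℕ) : Function.Injective (List.cons i) := fun _ _ h => by simpa using h

theorem nodes_eq (t : PlaneTree) :
    t.nodes = {[]} ∪ ⋃ i : Fin (t.outdegree []), List.cons (i : ℕ) '' (subtree i t).nodes := by
  ext u
  rcases u with _ | ⟨i, v⟩
  · simp [t.root_mem]
  · rw [cons_mem_iff]
    simp only [Set.mem_union, Set.mem_singleton_iff, reduceCtorEq, false_or, Set.mem_iUnion,
      Set.mem_image, List.cons.injEq]
    constructor
    · exact fun ⟨h1, h2⟩ => ⟨⟨i, h1⟩, v, h2, rfl, rfl⟩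
    · rintro ⟨j, w, h2, rfl, rfl⟩
      exact ⟨j.2, h2⟩

theorem leaves_eq {t : PlaneTree} (ht : t.outdegree [] ≠ 0) :
    t.leaves = ⋃ i : Fin (t.outdegree []), List.cons (i : ℕ) '' (subtree i t).leaves := by
  ext u
  rcases u with _ | ⟨i, v⟩
  · simp [leaves, ht]
  · change i :: v ∈ t.nodes ∧ _ ↔ _
    rw [cons_mem_iff]
    simp only [Set.mem_iUnion, Set.mem_image, List.cons.injEq]
    constructor
    · exact fun ⟨⟨h1, h2⟩, h3⟩ => ⟨⟨i, h1⟩, v, ⟨h2, (outdegree_subtree t i v).trans h3⟩, rfl, rfl⟩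
    · rintro ⟨j, w, ⟨h2, h3⟩, rfl, rfl⟩
      exact ⟨⟨j.2, h2⟩, (outdegree_subtree t j w).symm.trans h3⟩

theorem encard_iUnion_cons {n : ℕ} (A : Fin n → Set (List ℕ)) :
    (⋃ i : Fin n, List.cons (i : ℕ) '' A i).encard = ∑ i, (A i).encard := by
  rw [Set.encard_iUnion_of_finite, finsum_eq_sum_of_fintype]
  · exact Finset.sum_congr rfl fun i _ => (cons_injective i).encard_image _
  · intro i j hij
    refine Set.disjoint_left.2 ?_
    rintro _ ⟨v, _, rfl⟩ ⟨w, _, hw⟩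
    simp only [List.cons.injEq] at hw
    exact hij (Fin.ext hw.1.symm)

theorem size_eq (t : PlaneTree) :
    t.size = 1 + ∑ i : Fin (t.outdegree []), (subtree i t).size := by
  rw [size, nodes_eq t, Set.encard_union_eq, Set.encard_singleton, encard_iUnion_cons]
  · rfl
  · rw [Set.disjoint_singleton_left]
    simp

theorem numLeaves_eq {t : PlaneTree} (ht : t.outdegree [] ≠ 0) :
    t.numLeaves = ∑ i : Fin (t.outdegree []), (subtree i t).numLeaves := by
  rw [numLeaves, leaves_eq ht, encard_iUnion_cons]
  rfl

theorem numLeaves_eq_one {t : PlaneTree} (ht : t.outdegree [] = 0) : t.numLeaves = 1 := by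
  have : t.leaves = {[]} := by
    ext u
    rcases u with _ | ⟨i, v⟩
    · simp [leaves, ht, t.root_mem]
    · change i :: v ∈ t.nodes ∧ _ ↔ _
      rw [cons_mem_iff, ht]
      simp
  rw [numLeaves, this, Set.encard_singleton]

/-! ### Topology and measurability -/

theorem dist_le_iff {s t : PlaneTree} (h : ℕ) :
    dist s t ≤ ((2 : ℝ) ^ h)⁻¹ ↔ restrict h s = restrict h t := by
  change treeDist s t ≤ _ ↔ _
  by_cases hst : s = t
  · subst hst
    simp [treeDist]
  · rw [treeDist, if_neg hst, inv_le_inv₀ (by positivity) (by positivity),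
      pow_le_pow_iff_right₀ (by norm_num)]
    constructor
    · intro hh
      exact restrict_mono hh (Nat.sSup_mem ⟨0, restrict_zero s t⟩ (agreement_bddAbove hst))
    · intro hh
      exact le_csSup (agreement_bddAbove hst) hh

theorem isOpen_iff_restrict {U : Set PlaneTree} :
    IsOpen U ↔ ∀ t ∈ U, ∃ h, ∀ s, restrict h s = restrict h t → s ∈ U := by
  rw [Metric.isOpen_iff]
  refine forall₂_congr fun t _ => ?_
  constructor
  · rintro ⟨ε, hε, hball⟩
    obtain ⟨h, hh⟩ := exists_pow_lt_of_lt_one hε (by norm_num : (2 : ℝ)⁻¹ < 1)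
    refine ⟨h, fun s hs => hball ?_⟩
    rw [Metric.mem_ball]
    exact ((dist_le_iff h).2 hs).trans_lt (by rwa [← inv_pow])
  · rintro ⟨h, hh⟩
    refine ⟨((2 : ℝ) ^ h)⁻¹, by positivity, fun s hs => hh s ?_⟩
    exact (dist_le_iff h).1 (Metric.mem_ball.1 hs).le

theorem isOpen_of_restrict {U : Set PlaneTree} (h : ℕ)
    (H : ∀ s t, restrict h s = restrict h t → t ∈ U → s ∈ U) : IsOpen U :=
  isOpen_iff_restrict.2 fun t ht => ⟨h, fun s hs => H s t hs ht⟩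

theorem measurableSet_restrict_eq (h : ℕ) (t : PlaneTree) :
    MeasurableSet {s | restrict h s = restrict h t} :=
  (isOpen_of_restrict h fun _ _ e ht => e.trans ht).measurableSet

theorem measurable_outdegree_nil : Measurable fun t : PlaneTree => t.outdegree [] := by
  refine measurable_to_countable' fun n => IsOpen.measurableSet ?_
  refine isOpen_of_restrict 1 fun s t e ht => ?_
  rw [Set.mem_preimage, Set.mem_singleton_iff] at ht ⊢
  rw [outdegree_congr e (by simp), ht]

theorem measurable_subtree (i : ℕ) : Measurable (subtree i) := by
  refine Continuous.measurable ⟨fun U hU => ?_⟩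
  rw [isOpen_iff_restrict] at hU ⊢
  intro t ht
  obtain ⟨h, hh⟩ := hU _ ht
  exact ⟨h + 1, fun s hs => hh _ (restrict_subtree hs i)⟩

/-- Having at least n elements means containing some finite set of n words, which is an open
condition. -/
theorem measurable_encard {A : PlaneTree → Set (List ℕ)} (hA : ∀ u, IsOpen {t | u ∈ A t}) :
    Measurable fun t => (A t).encard := by
  have hle : ∀ n : ℕ, MeasurableSet {t | (n : ℕ∞) ≤ (A t).encard} := by
    intro n
    have : {t | (n : ℕ∞) ≤ (A t).encard} =
        ⋃ F : {F : Finset (List ℕ) // F.card = n}, ⋂ u ∈ F.1, {t | u ∈ A t} := by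
      ext t
      simp only [Set.mem_ofPred_eq, Set.mem_iUnion, Set.mem_iInter]
      constructor
      · intro hn
        obtain ⟨B, hB, hBn⟩ := Set.exists_subset_encard_eq hn
        have hfin : B.Finite := Set.finite_of_encard_eq_coe hBn
        refine ⟨⟨hfin.toFinset, ?_⟩, fun u hu => hB (hfin.mem_toFinset.1 hu)⟩
        rw [hfin.encard_eq_coe_toFinset_card] at hBn
        exact_mod_cast hBn
      · rintro ⟨⟨F, rfl⟩, hF⟩
        rw [← Set.encard_coe_eq_coe_finsetCard]
        exact Set.encard_le_encard fun u hu => hF u hu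
    rw [this]
    exact (isOpen_iUnion fun F => isOpen_biInter_finset fun u _ => hA u).measurableSet
  refine measurable_to_countable' fun m => ?_
  induction m using ENat.recTopCoe with
  | top =>
    have : (fun t => (A t).encard) ⁻¹' {⊤} = ⋂ n : ℕ, {t | (n : ℕ∞) ≤ (A t).encard} := by
      ext t
      simp only [Set.mem_preimage, Set.mem_singleton_iff, Set.mem_iInter, Set.mem_ofPred_eq]
      exact ⟨fun h n => h ▸ le_top, fun h => ENat.eq_top_iff_forall_ge.2 h⟩
    rw [this]
    exact MeasurableSet.iInter hle
  | coe n =>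
    have : (fun t => (A t).encard) ⁻¹' {(n : ℕ∞)} =
        {t | (n : ℕ∞) ≤ (A t).encard} \ {t | ((n + 1 : ℕ) : ℕ∞) ≤ (A t).encard} := by
      ext t
      simp only [Set.mem_preimage, Set.mem_singleton_iff, Set.mem_sdiff, Set.mem_ofPred_eq, not_le]
      rw [Nat.cast_add, Nat.cast_one, ENat.lt_natCast_add_one_iff]
      exact ⟨fun h => ⟨h.ge, h.le⟩, fun h => le_antisymm h.2 h.1⟩
    rw [this]
    exact (hle n).diff (hle (n + 1))

theorem measurable_size : Measurable size :=
  measurable_encard fun u => isOpen_of_restrict u.length fun _ _ e ht =>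
    (restrict_eq_iff.1 e u le_rfl).2 ht

theorem measurable_numLeaves : Measurable numLeaves :=
  measurable_encard fun u => isOpen_of_restrict (u.length + 1) fun _ _ e ht =>
    ⟨(restrict_eq_iff.1 e u (Nat.le_succ _)).2 ht.1, by
      rw [outdegree_congr e (Nat.lt_succ_self _)]
      exact ht.2⟩

/-! ### Vertices below and at a given height -/

/-- The vertices of height less than `h`. -/
noncomputable def nodesBelow : ℕ → PlaneTree → Finset (List ℕ)
  | 0, _ => ∅
  | h + 1, t => insert [] (Finset.univ.biUnion fun i : Fin (t.outdegree []) =>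
      (nodesBelow h (subtree i t)).map ⟨List.cons (i : ℕ), cons_injective i⟩)

/-- The vertices of height `h`. -/
noncomputable def levelNodes : ℕ → PlaneTree → Finset (List ℕ)
  | 0, _ => {[]}
  | h + 1, t => Finset.univ.biUnion fun i : Fin (t.outdegree []) =>
      (levelNodes h (subtree i t)).map ⟨List.cons (i : ℕ), cons_injective i⟩

theorem mem_nodesBelow {h : ℕ} {t : PlaneTree} {u : List ℕ} :
    u ∈ nodesBelow h t ↔ u ∈ t.nodes ∧ u.length < h := by
  induction h generalizing t u with
  | zero => simp [nodesBelow]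
  | succ h ih =>
    rcases u with _ | ⟨i, v⟩
    · simp [nodesBelow, t.root_mem]
    · rw [cons_mem_iff]
      simp only [nodesBelow, Finset.mem_insert, reduceCtorEq, false_or, Finset.mem_biUnion,
        Finset.mem_univ, true_and, Finset.mem_map, Function.Embedding.coeFn_mk, List.cons.injEq,
        ih, List.length_cons, add_lt_add_iff_right]
      constructor
      · rintro ⟨j, w, ⟨h1, h2⟩, rfl, rfl⟩
        exact ⟨⟨j.2, h1⟩, h2⟩
      · rintro ⟨⟨h1, h2⟩, h3⟩
        exact ⟨⟨i, h1⟩, v, ⟨h2, h3⟩, rfl, rfl⟩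

theorem mem_levelNodes {h : ℕ} {t : PlaneTree} {u : List ℕ} :
    u ∈ levelNodes h t ↔ u ∈ t.nodes ∧ u.length = h := by
  induction h generalizing t u with
  | zero =>
    simp only [levelNodes, Finset.mem_singleton, List.length_eq_zero_iff]
    exact ⟨fun h => ⟨h ▸ t.root_mem, h⟩, fun h => h.2⟩
  | succ h ih =>
    rcases u with _ | ⟨i, v⟩
    · simp [levelNodes]
    · rw [cons_mem_iff]
      simp only [levelNodes, Finset.mem_biUnion,
        Finset.mem_univ, true_and, Finset.mem_map, Function.Embedding.coeFn_mk, List.cons.injEq,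
        ih, List.length_cons, add_left_inj]
      constructor
      · rintro ⟨j, w, ⟨h1, h2⟩, rfl, rfl⟩
        exact ⟨⟨j.2, h1⟩, h2⟩
      · rintro ⟨⟨h1, h2⟩, h3⟩
        exact ⟨⟨i, h1⟩, v, ⟨h2, h3⟩, rfl, rfl⟩

theorem pairwiseDisjoint_map_cons {n : ℕ} (F : Fin n → Finset (List ℕ)) :
    ((Finset.univ : Finset (Fin n)) : Set (Fin n)).PairwiseDisjoint fun i =>
      (F i).map ⟨List.cons (i : ℕ), cons_injective i⟩ := by
  intro i _ j _ hij
  refine Finset.disjoint_left.2 fun u hu hu' => ?_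
  obtain ⟨v, _, rfl⟩ := Finset.mem_map.1 hu
  obtain ⟨w, _, hw⟩ := Finset.mem_map.1 hu'
  simp only [Function.Embedding.coeFn_mk, List.cons.injEq] at hw
  exact hij (Fin.ext hw.1.symm)

theorem card_levelNodes_succ (h : ℕ) (t : PlaneTree) :
    (levelNodes (h + 1) t).card =
      ∑ i : Fin (t.outdegree []), (levelNodes h (subtree i t)).card := by
  rw [levelNodes, Finset.card_biUnion (pairwiseDisjoint_map_cons _)]
  simp only [Finset.card_map]

/-- The probability that the vertices of height less than `h` have the prescribed outdegrees. -/
noncomputable def weight (p : PMF ℕ) (h : ℕ) (t : PlaneTree) : ℝ≥0∞ :=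
  ∏ u ∈ nodesBelow h t, p (t.outdegree u)

theorem weight_succ (p : PMF ℕ) (h : ℕ) (t : PlaneTree) :
    weight p (h + 1) t =
      p (t.outdegree []) * ∏ i : Fin (t.outdegree []), weight p h (subtree i t) := by
  rw [weight, nodesBelow, Finset.prod_insert (by simp),
    Finset.prod_biUnion (pairwiseDisjoint_map_cons _)]
  simp only [Finset.prod_map, Function.Embedding.coeFn_mk, weight, outdegree_subtree]

theorem nodesBelow_congr {h : ℕ} {s t : PlaneTree} :
    restrict h s = restrict h t ↔ nodesBelow (h + 1) s = nodesBelow (h + 1) t := by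
  rw [restrict_eq_iff, Finset.ext_iff]
  simp only [mem_nodesBelow, Nat.lt_succ_iff]
  exact forall_congr' fun u => by tauto

/-- A cut tree is determined by its finite set of vertices, and there are countably many finite sets
of words. -/
theorem countable_range_restrict (h : ℕ) : (Set.range (restrict h)).Countable := by
  have hfac : ∀ t, restrict h t = restrict h (restrict h t) := fun t => by
    rw [restrict_eq_iff]
    intro u hu
    change _ ↔ u ∈ t.nodes ∧ u.length ≤ h
    tauto
  refine Set.MapsTo.countable_of_injOn (f := nodesBelow (h + 1)) (Set.mapsTo_univ _ _) ?_
    Set.countable_univ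
  rintro _ ⟨s, rfl⟩ _ ⟨t, rfl⟩ e
  rw [← nodesBelow_congr, ← hfac, ← hfac] at e
  exact e

end PlaneTree

/-! ### Powers with extended natural exponents -/

open Classical in
/-- `x ^ m`, with the convention `x ^ ∞ = 0`. -/
noncomputable def xpow (x : ℝ≥0∞) (m : ℕ∞) : ℝ≥0∞ := ∑' n : ℕ, if m = n then x ^ n else 0

theorem xpow_coe (x : ℝ≥0∞) (n : ℕ) : xpow x n = x ^ n := by
  rw [xpow, tsum_eq_single n, if_pos rfl]
  intro m hm
  rw [if_neg]
  exact_mod_cast hm.symm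

theorem xpow_top (x : ℝ≥0∞) : xpow x ⊤ = 0 := by
  simp [xpow]

theorem xpow_add (x : ℝ≥0∞) (a b : ℕ∞) : xpow x (a + b) = xpow x a * xpow x b := by
  induction a using ENat.recTopCoe with
  | top => simp [xpow_top]
  | coe a =>
    induction b using ENat.recTopCoe with
    | top => simp [xpow_top]
    | coe b => rw [← Nat.cast_add, xpow_coe, xpow_coe, xpow_coe, pow_add]

theorem xpow_sum {ι : Type*} (x : ℝ≥0∞) (s : Finset ι) (f : ι → ℕ∞) :
    xpow x (∑ i ∈ s, f i) = ∏ i ∈ s, xpow x (f i) := by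
  classical
  induction s using Finset.induction_on with
  | empty => simpa using xpow_coe x 0
  | insert i s hi ih => rw [Finset.sum_insert hi, Finset.prod_insert hi, xpow_add, ih]

theorem measurable_xpow (x : ℝ≥0∞) : Measurable (xpow x) := measurable_of_countable _

/-- Since x^∞ = 0 even for x = 1, the value at 1 is the mass of the event that `f` is finite. -/
theorem lintegral_xpow {Ω : Type*} [MeasurableSpace Ω] (μ : Measure Ω) {f : Ω → ℕ∞}
    (hf : Measurable f) (x : ℝ≥0∞) :
    ∫⁻ ω, xpow x (f ω) ∂μ = ∑' n : ℕ, μ {ω | f ω = n} * x ^ n := by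
  classical
  simp only [xpow]
  have hm : ∀ n : ℕ, Measurable fun ω => if f ω = (n : ℕ∞) then x ^ n else 0 := fun n =>
    (measurable_of_countable fun m : ℕ∞ => if m = (n : ℕ∞) then x ^ n else 0).comp hf
  rw [lintegral_tsum fun n => (hm n).aemeasurable]
  refine tsum_congr fun n => ?_
  have e : (fun ω => if f ω = (n : ℕ∞) then x ^ n else 0) =
      {ω | f ω = (n : ℕ∞)}.indicator fun _ => x ^ n := by
    ext ω
    simp [Set.indicator_apply]
  have hs : MeasurableSet {ω | f ω = (n : ℕ∞)} := hf (measurableSet_singleton _)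
  rw [e, lintegral_indicator_const hs, mul_comm]

/-! ### Galton–Watson trees -/

section GaltonWatson

variable {Ω : Type*} [MeasurableSpace Ω] {p : PMF ℕ} {τ : Ω → PlaneTree} {P : Measure Ω}

theorem IsGaltonWatsonTree.measurableSet_outdegree (hτ : IsGaltonWatsonTree p τ P) (n : ℕ) :
    MeasurableSet {ω | (τ ω).outdegree [] = n} :=
  measurable_outdegree_nil.comp hτ.measurable (measurableSet_singleton n)

/-- The branching property as an unconditioned product formula. The cases n = 0 and p(n) = 0, which
it does not cover, are immediate. -/
theorem IsGaltonWatsonTree.lintegral_prod (hτ : IsGaltonWatsonTree p τ P) [IsProbabilityMeasure P]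
    {n : ℕ} {f : Fin n → PlaneTree → ℝ≥0∞} (hf : ∀ i, Measurable (f i)) :
    ∫⁻ ω in {ω | (τ ω).outdegree [] = n}, ∏ i, f i (subtree i (τ ω)) ∂P =
      p n * ∏ i, ∫⁻ ω, f i (τ ω) ∂P := by
  rw [← hτ.root_law n]
  set A := {ω | (τ ω).outdegree [] = n} with hA
  have hAm : MeasurableSet A := measurable_outdegree_nil.comp hτ.measurable
    (measurableSet_singleton n)
  rcases Nat.eq_zero_or_pos n with rfl | hn
  · simp
  by_cases hPA : P A = 0
  · rw [hPA, zero_mul, Measure.restrict_eq_zero.2 hPA, lintegral_zero_measure]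
  obtain ⟨hind, hlaw⟩ := hτ.branching n hn hPA
  have h1 := lintegral_prod_eq_prod_lintegral_of_indepFun Finset.univ
    (fun (i : Fin n) ω => f i (subtree i (τ ω))) (hind.comp f hf)
    fun i => (hf i).comp ((measurable_subtree i).comp hτ.measurable)
  have h2 : ∀ i : Fin n, ∫⁻ ω, f i (subtree i (τ ω)) ∂P[|A] = ∫⁻ ω, f i (τ ω) ∂P := by
    intro i
    have hm := lintegral_map (μ := P[|A]) (hf i) ((measurable_subtree (i : ℕ)).comp hτ.measurable)
    rw [← lintegral_map (hf i) hτ.measurable, ← (hlaw i).map_eq]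
    exact hm.symm
  rw [Finset.prod_congr rfl fun i _ => h2 i] at h1
  rw [← h1, ProbabilityTheory.cond, lintegral_smul_measure, smul_eq_mul, ← mul_assoc,
    ENNReal.mul_inv_cancel hPA (measure_ne_top P A), one_mul]

theorem IsGaltonWatsonTree.lintegral_eq_tsum (hτ : IsGaltonWatsonTree p τ P)
    (f : Ω → ℝ≥0∞) :
    ∫⁻ ω, f ω ∂P = ∑' n, ∫⁻ ω in {ω | (τ ω).outdegree [] = n}, f ω ∂P := by
  have hU : ⋃ n, {ω | (τ ω).outdegree [] = n} = Set.univ :=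
    Set.eq_univ_of_forall fun ω => Set.mem_iUnion.2 ⟨_, rfl⟩
  rw [← lintegral_iUnion hτ.measurableSet_outdegree, hU, Measure.restrict_univ]
  exact fun m n hmn => Set.disjoint_left.2 fun ω (h1 : _ = m) (h2 : _ = n) => hmn (h1.symm.trans h2)

/-- The generating function of the number of leaves. -/
noncomputable def leafGen (τ : Ω → PlaneTree) (P : Measure Ω) (x : ℝ≥0∞) : ℝ≥0∞ :=
  ∫⁻ ω, xpow x (τ ω).numLeaves ∂P

/-- The generating function of the number of vertices. -/
noncomputable def sizeGen (τ : Ω → PlaneTree) (P : Measure Ω) (x : ℝ≥0∞) : ℝ≥0∞ :=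
  ∫⁻ ω, xpow x (τ ω).size ∂P

theorem xpow_le_one {x : ℝ≥0∞} (hx : x ≤ 1) (m : ℕ∞) : xpow x m ≤ 1 := by
  induction m using ENat.recTopCoe with
  | top => simp [xpow_top]
  | coe n => rw [xpow_coe]; exact pow_le_one' hx n

theorem lintegral_xpow_le_one [IsProbabilityMeasure P] {x : ℝ≥0∞} (hx : x ≤ 1) (f : Ω → ℕ∞) :
    ∫⁻ ω, xpow x (f ω) ∂P ≤ 1 := by
  calc ∫⁻ ω, xpow x (f ω) ∂P ≤ ∫⁻ _, 1 ∂P := lintegral_mono fun ω => xpow_le_one hx _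
    _ = 1 := by simp

theorem IsGaltonWatsonTree.sizeGen_eq (hτ : IsGaltonWatsonTree p τ P) [IsProbabilityMeasure P]
    (x : ℝ≥0∞) : sizeGen τ P x = x * pgf p (sizeGen τ P x) := by
  nth_rewrite 1 [sizeGen]
  rw [hτ.lintegral_eq_tsum, pgf, ← ENNReal.tsum_mul_left]
  refine tsum_congr fun n => ?_
  calc ∫⁻ ω in {ω | (τ ω).outdegree [] = n}, xpow x (τ ω).size ∂P
      = ∫⁻ ω in {ω | (τ ω).outdegree [] = n},
          x * ∏ i : Fin n, xpow x (subtree i (τ ω)).size ∂P := by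
        refine setLIntegral_congr_fun (hτ.measurableSet_outdegree n) fun ω hω => ?_
        obtain rfl : (τ ω).outdegree [] = n := hω
        rw [size_eq, xpow_add, xpow_sum]
        congr 1
        simpa using xpow_coe x 1
    _ = x * (p n * ∏ i : Fin n, ∫⁻ ω, xpow x (τ ω).size ∂P) := by
        have hprod := hτ.lintegral_prod (n := n) (f := fun _ s => xpow x s.size)
          fun _ => (measurable_xpow x).comp measurable_size
        rw [lintegral_const_mul, hprod]
        exact Finset.measurable_fun_prod _ fun i _ => (measurable_xpow x).comp
          (measurable_size.comp ((measurable_subtree i).comp hτ.measurable))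
    _ = _ := by rw [Finset.prod_const, Finset.card_univ, Fintype.card_fin]; rfl

/-- A childless root is itself one leaf, which replaces the term p(0) of φ by p(0)x; otherwise the
leaves are those of the sub-trees. -/
theorem IsGaltonWatsonTree.leafGen_eq (hτ : IsGaltonWatsonTree p τ P) [IsProbabilityMeasure P]
    (x : ℝ≥0∞) : leafGen τ P x + p 0 = pgf p (leafGen τ P x) + p 0 * x := by
  have h0 : ∫⁻ ω in {ω | (τ ω).outdegree [] = 0}, xpow x (τ ω).numLeaves ∂P = p 0 * x := by
    rw [← hτ.root_law 0, mul_comm, ← setLIntegral_const]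
    refine setLIntegral_congr_fun (hτ.measurableSet_outdegree 0) fun ω hω => ?_
    rw [numLeaves_eq_one hω]
    simpa using xpow_coe x 1
  have h1 : ∀ n, ∫⁻ ω in {ω | (τ ω).outdegree [] = n + 1}, xpow x (τ ω).numLeaves ∂P =
      p (n + 1) * leafGen τ P x ^ (n + 1) := by
    intro n
    calc ∫⁻ ω in {ω | (τ ω).outdegree [] = n + 1}, xpow x (τ ω).numLeaves ∂P
        = ∫⁻ ω in {ω | (τ ω).outdegree [] = n + 1},
            ∏ i : Fin (n + 1), xpow x (subtree i (τ ω)).numLeaves ∂P := by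
          refine setLIntegral_congr_fun (hτ.measurableSet_outdegree _) fun ω hω => ?_
          have hω' : (τ ω).outdegree [] = n + 1 := hω
          rw [numLeaves_eq (by omega), xpow_sum, hω']
      _ = p (n + 1) * ∏ i : Fin (n + 1), ∫⁻ ω, xpow x (τ ω).numLeaves ∂P :=
          hτ.lintegral_prod fun _ => (measurable_xpow x).comp measurable_numLeaves
      _ = _ := by rw [Finset.prod_const, Finset.card_univ, Fintype.card_fin]; rfl
  have h2 : leafGen τ P x = p 0 * x + ∑' n, p (n + 1) * leafGen τ P x ^ (n + 1) := by
    nth_rewrite 1 [leafGen]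
    rw [hτ.lintegral_eq_tsum, tsum_eq_zero_add_tsum_succ, h0]
    simp only [h1]
  rw [pgf, tsum_eq_zero_add_tsum_succ fun n => p n * leafGen τ P x ^ n, pow_zero, mul_one]
  nth_rewrite 1 [h2]
  ring

/-- The number of leaves on the event that `τ` coincides with `t` up to height `h`. -/
theorem IsGaltonWatsonTree.lintegral_restrict_eq (hτ : IsGaltonWatsonTree p τ P)
    [IsProbabilityMeasure P] (h : ℕ) (t : PlaneTree) :
    ∃ ℓ : ℕ, ∀ x, ∫⁻ ω in {ω | restrict h (τ ω) = restrict h t}, xpow x (τ ω).numLeaves ∂P =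
      weight p h t * (x ^ ℓ * leafGen τ P x ^ (levelNodes h t).card) := by
  -- Here ℓ is the number of leaves of t of height less than h, while each vertex of height h
  -- carries an independent copy of τ and gives one factor of the generating function.
  induction h generalizing t with
  | zero =>
    refine ⟨0, fun x => ?_⟩
    have : {ω | restrict 0 (τ ω) = restrict 0 t} = Set.univ :=
      Set.eq_univ_of_forall fun ω => restrict_zero _ _
    rw [this, Measure.restrict_univ]
    simp [weight, nodesBelow, levelNodes, leafGen]
  | succ h ih =>
    by_cases ht : t.outdegree [] = 0
    · refine ⟨1, fun x => ?_⟩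
      have e : {ω | restrict (h + 1) (τ ω) = restrict (h + 1) t} =
          {ω | (τ ω).outdegree [] = 0} := by
        ext ω
        simp only [Set.mem_ofPred_eq]
        rw [restrict_succ_eq_iff, ht]
        refine and_iff_left fun i => absurd i.2 ?_
        omega
      have hz : (levelNodes (h + 1) t).card = 0 := by
        rw [card_levelNodes_succ]
        exact Finset.sum_eq_zero fun i _ => absurd i.2 (by omega)
      have hw : weight p (h + 1) t = p 0 := by
        rw [weight_succ, Finset.prod_eq_one fun i _ => absurd i.2 (by omega), ht, mul_one]
      rw [e, hz, hw, pow_zero, pow_one, mul_one, ← hτ.root_law 0, mul_comm, ← setLIntegral_const]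
      refine setLIntegral_congr_fun (hτ.measurableSet_outdegree 0) fun ω hω => ?_
      rw [numLeaves_eq_one hω]
      simpa using xpow_coe x 1
    · choose ℓ hℓ using fun i : Fin (t.outdegree []) => ih (subtree i t)
      refine ⟨∑ i, ℓ i, fun x => ?_⟩
      let g : Fin (t.outdegree []) → PlaneTree → ℝ≥0∞ := fun i =>
        {s | restrict h s = restrict h (subtree i t)}.indicator fun s => xpow x s.numLeaves
      have hg : ∀ i, Measurable (g i) := fun i =>
        ((measurable_xpow x).comp measurable_numLeaves).indicator (measurableSet_restrict_eq h _)
      have hgi : ∀ i, ∫⁻ ω, g i (τ ω) ∂P = weight p h (subtree i t) *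
          (x ^ ℓ i * leafGen τ P x ^ (levelNodes h (subtree i t)).card) := by
        intro i
        rw [← hℓ i x]
        exact lintegral_indicator (hτ.measurable (measurableSet_restrict_eq h (subtree i t))) _
      have hm : MeasurableSet {ω | restrict (h + 1) (τ ω) = restrict (h + 1) t} :=
        hτ.measurable (measurableSet_restrict_eq (h + 1) t)
      calc ∫⁻ ω in {ω | restrict (h + 1) (τ ω) = restrict (h + 1) t}, xpow x (τ ω).numLeaves ∂P
          = ∫⁻ ω in {ω | (τ ω).outdegree [] = t.outdegree []}, ∏ i, g i (subtree i (τ ω)) ∂P := by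
            rw [← lintegral_indicator hm, ← lintegral_indicator (hτ.measurableSet_outdegree _)]
            refine lintegral_congr fun ω => ?_
            by_cases hd : (τ ω).outdegree [] = t.outdegree []
            · rw [Set.indicator_of_mem (s := {ω | (τ ω).outdegree [] = t.outdegree []}) hd]
              by_cases hr : restrict (h + 1) (τ ω) = restrict (h + 1) t
              · rw [Set.indicator_of_mem
                  (s := {ω | restrict (h + 1) (τ ω) = restrict (h + 1) t}) hr,
                  numLeaves_eq (by omega), xpow_sum, hd]
                refine Finset.prod_congr rfl fun i _ => ?_
                exact (Set.indicator_of_mem (s := {s | restrict h s = restrict h (subtree i t)})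
                  (restrict_subtree hr i) fun s => xpow x s.numLeaves).symm
              · rw [Set.indicator_of_notMem
                  (s := {ω | restrict (h + 1) (τ ω) = restrict (h + 1) t}) hr]
                rw [restrict_succ_eq_iff, not_and, not_forall] at hr
                obtain ⟨i, hi⟩ := hr hd
                exact (Finset.prod_eq_zero (Finset.mem_univ i)
                  (Set.indicator_of_notMem (s := {s | restrict h s = restrict h (subtree i t)})
                    hi _)).symm
            · rw [Set.indicator_of_notMem (s := {ω | (τ ω).outdegree [] = t.outdegree []}) hd,
                Set.indicator_of_notMem]
              exact fun hr => hd (restrict_succ_eq_iff.1 hr).1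
        _ = p (t.outdegree []) * ∏ i : Fin (t.outdegree []), (weight p h (subtree i t) *
              (x ^ ℓ i * leafGen τ P x ^ (levelNodes h (subtree i t)).card)) := by
            rw [hτ.lintegral_prod hg]
            simp only [hgi]
        _ = _ := by
            rw [weight_succ, card_levelNodes_succ, Finset.prod_mul_distrib,
              Finset.prod_mul_distrib, Finset.prod_pow_eq_pow_sum, Finset.prod_pow_eq_pow_sum]
            ring

end GaltonWatson

/-! ### Kesten's tree -/

theorem PlaneTree.append_mem_ofDegrees_iff {κ : List ℕ → ℕ} {u : List ℕ}
    (hu : u ∈ (ofDegrees κ).nodes) (j : ℕ) : u ++ [j] ∈ (ofDegrees κ).nodes ↔ j < κ u := by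
  refine ⟨fun h => h u j (List.prefix_refl _), fun hj v i hv => ?_⟩
  rcases List.prefix_concat_iff.1 hv with h | h
  · obtain ⟨rfl, hi⟩ := List.append_inj' h rfl
    obtain rfl : i = j := by simpa using hi
    exact hj
  · exact hu v i h

theorem PlaneTree.outdegree_ofDegrees {κ : List ℕ → ℕ} {u : List ℕ}
    (hu : u ∈ (ofDegrees κ).nodes) : (ofDegrees κ).outdegree u = κ u :=
  (outdegree_eq_iff hu _).2 (append_mem_ofDegrees_iff hu)

theorem length_specialNode (ω : List ℕ → ℕ × (ℕ × ℕ)) (n : ℕ) :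
    (specialNode ω n).length = n := by
  induction n with
  | zero => rfl
  | succ n ih => rw [specialNode, List.length_append, ih]; rfl

theorem specialNode_prefix (ω : List ℕ → ℕ × (ℕ × ℕ)) {m n : ℕ} (hmn : m ≤ n) :
    specialNode ω m <+: specialNode ω n := by
  induction n, hmn using Nat.le_induction with
  | base => exact List.prefix_refl _
  | succ n _ ih => exact ih.trans (List.prefix_append _ _)

theorem eq_specialNode_of_prefix {ω : List ℕ → ℕ × (ℕ × ℕ)} {u : List ℕ} {h : ℕ}
    (hu : u <+: specialNode ω h) : u = specialNode ω u.length := by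
  have hl : u.length ≤ h := by
    have := hu.length_le
    rwa [length_specialNode] at this
  have := List.prefix_of_prefix_length_le hu (specialNode_prefix ω hl)
    (length_specialNode ω _).ge
  exact this.eq_of_length (length_specialNode ω _).symm

theorem exists_eq_specialNode_iff {ω : List ℕ → ℕ × (ℕ × ℕ)} {u : List ℕ} {h : ℕ}
    (hu : u.length ≤ h) : (∃ n, u = specialNode ω n) ↔ u <+: specialNode ω h := by
  constructor
  · rintro ⟨n, rfl⟩
    rw [length_specialNode] at hu
    exact specialNode_prefix ω hu
  · exact fun H => ⟨_, eq_specialNode_of_prefix H⟩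

theorem specialNode_mem {ω : List ℕ → ℕ × (ℕ × ℕ)} (hω : ∀ u, (ω u).2.2 < (ω u).2.1) (n : ℕ) :
    specialNode ω n ∈ (kestenOf ω).nodes := by
  induction n with
  | zero => exact (kestenOf ω).root_mem
  | succ n ih =>
    rw [specialNode]
    refine (append_mem_ofDegrees_iff ih _).2 ?_
    rw [if_pos ⟨n, rfl⟩]
    exact hω _

open Classical in
/-- The constraint at `u` which makes `t` the tree of the data, up to the height of `v`, with
special vertex `v`. -/
noncomputable def spineConstraint (t : PlaneTree) (v u : List ℕ) : Set (ℕ × (ℕ × ℕ)) :=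
  if u <+: v then Set.univ ×ˢ {(t.outdegree u, v.getD u.length 0)}
  else {t.outdegree u} ×ˢ Set.univ

theorem measurableSet_spineConstraint (t : PlaneTree) (v u : List ℕ) :
    MeasurableSet (spineConstraint t v u) := MeasurableSet.of_discrete

/-- The size bias k and the uniform choice 1/k cancel: a special vertex with a prescribed special
child costs as much as a normal one. -/
theorem specialLaw_apply {p : PMF ℕ} (h : NonDegenerate p) (hc : IsCritical p) {k i : ℕ}
    (hik : i < k) : specialLaw p h hc.mean_ne_top (k, i) = p k := by
  have hk : k ≠ 0 := by omega
  have hk' : (k : ℝ≥0∞) ≠ 0 := by exact_mod_cast hk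
  rw [specialLaw, PMF.bind_apply, tsum_eq_single k]
  · rw [PMF.map_apply, tsum_eq_single i, if_pos rfl, PMF.uniformOfFinset_apply,
      if_pos (by simp; omega), Finset.card_range, Nat.sub_add_cancel (by omega)]
    · change (k : ℝ≥0∞) * p k / mean p * (k : ℝ≥0∞)⁻¹ = p k
      rw [show mean p = 1 from hc, div_one, mul_right_comm,
        ENNReal.mul_inv_cancel hk' (ENNReal.natCast_ne_top k), one_mul]
    · intro j hj
      rw [if_neg]
      intro H
      exact hj (Prod.ext_iff.1 H).2.symm
  · intro k' hk'
    rw [PMF.map_apply, ENNReal.tsum_eq_zero.2, mul_zero]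
    intro j
    rw [if_neg]
    intro H
    exact hk' (Prod.ext_iff.1 H).1.symm

theorem specialLaw_support {p : PMF ℕ} (h : NonDegenerate p) (hm : mean p ≠ ∞) :
    (specialLaw p h hm).support ⊆ {x | x.2 < x.1} := by
  intro x hx
  rw [specialLaw, PMF.mem_support_bind_iff] at hx
  obtain ⟨k, hk, hx⟩ := hx
  rw [PMF.mem_support_map_iff] at hx
  obtain ⟨j, hj, rfl⟩ := hx
  rw [PMF.mem_support_uniformOfFinset_iff, Finset.mem_range] at hj
  have hk0 : k ≠ 0 := by
    rintro rfl
    rw [PMF.mem_support_iff] at hk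
    refine hk ?_
    change ((0 : ℕ) : ℝ≥0∞) * p 0 / mean p = 0
    simp
  rw [Set.mem_ofPred_eq]
  dsimp only
  omega

theorem prod_spineConstraint {p : PMF ℕ} (h : NonDegenerate p) (hc : IsCritical p) {n : ℕ}
    {t : PlaneTree} {v u : List ℕ} (hv : v ∈ levelNodes n t) (hu : u ∈ nodesBelow n t) :
    (p.toMeasure.prod (specialLaw p h hc.mean_ne_top).toMeasure) (spineConstraint t v u) =
      p (t.outdegree u) := by
  rw [mem_levelNodes] at hv
  rw [mem_nodesBelow] at hu
  rw [spineConstraint]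
  split_ifs with huv
  · rw [Measure.prod_prod, measure_univ, one_mul, PMF.toMeasure_apply_singleton _ _
      (measurableSet_singleton _)]
    refine specialLaw_apply h hc ?_
    obtain ⟨w, rfl⟩ := huv
    rcases w with _ | ⟨i, w⟩
    · simp at hv
      omega
    · rw [← append_mem_iff hu.1]
      refine mem_of_prefix ?_ hv.1
      exact ⟨w, by simp⟩
  · rw [Measure.prod_prod, measure_univ, mul_one, PMF.toMeasure_apply_singleton _ _
      (measurableSet_singleton _)]

theorem kestenData_pi {p : PMF ℕ} (h : NonDegenerate p) (hc : IsCritical p) {n : ℕ}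
    {t : PlaneTree} {v : List ℕ} (hv : v ∈ levelNodes n t) :
    kestenData p h hc.mean_ne_top (Set.pi (nodesBelow n t) (spineConstraint t v)) =
      weight p n t := by
  rw [kestenData, Measure.infinitePi_pi _ fun u _ => measurableSet_spineConstraint t v u, weight]
  exact Finset.prod_congr rfl fun u hu => prod_spineConstraint h hc hv hu

theorem kestenData_ae {p : PMF ℕ} (h : NonDegenerate p) (hm : mean p ≠ ∞) :
    ∀ᵐ ω ∂kestenData p h hm, ∀ u, (ω u).2.2 < (ω u).2.1 := by
  rw [ae_all_iff]
  intro u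
  have h1 : ∀ᵐ x ∂p.toMeasure.prod (specialLaw p h hm).toMeasure, x.2.2 < x.2.1 := by
    have h2 : ∀ᵐ y ∂(specialLaw p h hm).toMeasure, y.2 < y.1 := by
      rw [ae_iff, PMF.toMeasure_apply_eq_zero_iff _ MeasurableSet.of_discrete]
      exact Set.disjoint_left.2 fun y hy hy' => hy' (specialLaw_support h hm hy)
    exact Measure.quasiMeasurePreserving_snd.ae h2
  exact (measurePreserving_eval_infinitePi
    (fun _ : List ℕ => p.toMeasure.prod (specialLaw p h hm).toMeasure) u).quasiMeasurePreserving.ae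
    h1

theorem mem_spineConstraint {ω : List ℕ → ℕ × (ℕ × ℕ)} {n : ℕ} {t : PlaneTree}
    (e : restrict n (kestenOf ω) = restrict n t) {u : List ℕ} (hu : u ∈ nodesBelow n t) :
    ω u ∈ spineConstraint t (specialNode ω n) u := by
  classical
  rw [mem_nodesBelow] at hu
  have huk : u ∈ (kestenOf ω).nodes := (restrict_eq_iff.1 e u hu.2.le).2 hu.1
  have hd : t.outdegree u = if ∃ n, u = specialNode ω n then (ω u).2.1 else (ω u).1 := by
    rw [← outdegree_congr e hu.2]
    exact outdegree_ofDegrees huk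
  rw [spineConstraint]
  rw [exists_eq_specialNode_iff hu.2.le] at hd
  split_ifs at hd ⊢ with hs
  · refine ⟨trivial, ?_⟩
    rw [hd]
    -- The rank of the special child of `u` is the next letter of the special vertex of generation
    -- n.
    have h1 : u ++ [(ω u).2.2] <+: specialNode ω n := by
      have h2 := eq_specialNode_of_prefix hs
      have h3 := specialNode_prefix ω (show u.length + 1 ≤ n from hu.2)
      rwa [specialNode, ← h2] at h3
    obtain ⟨w, hw⟩ := h1
    rw [← hw]
    simp
  · exact ⟨hd.symm, trivial⟩

/-- Every open set is a countable union of cylinders, and a cylinder is a countable intersection of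
membership conditions. -/
theorem PlaneTree.measurable_of_measurableSet_mem {α : Type*} [MeasurableSpace α]
    {f : α → PlaneTree} (hf : ∀ u, MeasurableSet {a | u ∈ (f a).nodes}) : Measurable f := by
  have hcyl : ∀ h t, MeasurableSet {a | restrict h (f a) = restrict h t} := by
    intro h t
    have : {a | restrict h (f a) = restrict h t} =
        ⋂ u : {u : List ℕ // u.length ≤ h}, {a | u.1 ∈ (f a).nodes ↔ u.1 ∈ t.nodes} := by
      ext a
      simp only [Set.mem_ofPred_eq, restrict_eq_iff, Set.mem_iInter, Subtype.forall]
    rw [this]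
    refine MeasurableSet.iInter fun u => ?_
    by_cases hu : u.1 ∈ t.nodes
    · simpa only [hu, iff_true] using hf u.1
    · simp only [hu, iff_false]
      exact (hf u.1).compl
  refine measurable_of_isOpen fun U hU => ?_
  have hU' : f ⁻¹' U = ⋃ h : ℕ, ⋃ c ∈ restrict h '' {t | ∀ s, restrict h s = restrict h t → s ∈ U},
      {a | restrict h (f a) = c} := by
    ext a
    simp only [Set.mem_preimage, Set.mem_iUnion, Set.mem_ofPred_eq, exists_prop]
    constructor
    · intro ha
      obtain ⟨h, hh⟩ := isOpen_iff_restrict.1 hU _ ha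
      exact ⟨h, _, ⟨f a, hh, rfl⟩, rfl⟩
    · rintro ⟨h, _, ⟨t, ht, rfl⟩, hs⟩
      exact ht _ hs
  rw [hU']
  refine MeasurableSet.iUnion fun h => MeasurableSet.biUnion
    ((countable_range_restrict h).mono (Set.image_subset_range _ _)) ?_
  rintro _ ⟨t, _, rfl⟩
  exact hcyl h t

theorem measurableSet_specialNode_eq (n : ℕ) (v : List ℕ) :
    MeasurableSet {ω : List ℕ → ℕ × (ℕ × ℕ) | v = specialNode ω n} := by
  induction n generalizing v with
  | zero => exact MeasurableSet.const (v = [])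
  | succ n ih =>
    have : {ω : List ℕ → ℕ × (ℕ × ℕ) | v = specialNode ω (n + 1)} =
        ⋃ w : List ℕ, {ω | w = specialNode ω n} ∩ {ω | v = w ++ [(ω w).2.2]} := by
      ext ω
      simp [specialNode]
    rw [this]
    refine MeasurableSet.iUnion fun w => (ih w).inter ?_
    have hw : Measurable fun ω : List ℕ → ℕ × (ℕ × ℕ) => ω w := measurable_pi_apply w
    have hs : MeasurableSet {x : ℕ × (ℕ × ℕ) | v = w ++ [x.2.2]} := MeasurableSet.of_discrete
    exact hw hs

theorem measurable_kestenOf : Measurable kestenOf := by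
  classical
  refine measurable_of_measurableSet_mem fun u => ?_
  have hκ : ∀ v, Measurable fun ω : List ℕ → ℕ × (ℕ × ℕ) =>
      if ∃ n, v = specialNode ω n then (ω v).2.1 else (ω v).1 := fun v => by
    refine Measurable.ite ?_ (measurable_pi_apply v).snd.fst (measurable_pi_apply v).fst
    have : {ω : List ℕ → ℕ × (ℕ × ℕ) | ∃ n, v = specialNode ω n} =
        ⋃ n, {ω | v = specialNode ω n} := by
      ext ω
      simp
    rw [this]
    exact MeasurableSet.iUnion fun n => measurableSet_specialNode_eq n v
  have : {ω | u ∈ (kestenOf ω).nodes} = ⋂ v : List ℕ, ⋂ i : ℕ, ⋂ _ : v ++ [i] <+: u,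
      {ω | i < if ∃ n, v = specialNode ω n then (ω v).2.1 else (ω v).1} := by
    ext ω
    simp only [Set.mem_iInter]
    rfl
  rw [this]
  exact MeasurableSet.iInter fun v => MeasurableSet.iInter fun i => MeasurableSet.iInter fun _ =>
    hκ v (MeasurableSet.of_discrete (s := Set.Ioi i))

/-- A union bound over the vertex of height n that is special: each choice has probability `weight p
n t`. No matching lower bound is needed. -/
theorem kestenLaw_restrict_le {p : PMF ℕ} (h : NonDegenerate p) (hc : IsCritical p) (n : ℕ)
    (t : PlaneTree) :
    kestenLaw p h hc.mean_ne_top {s | restrict n s = restrict n t} ≤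
      (levelNodes n t).card * weight p n t := by
  rw [kestenLaw, Measure.map_apply measurable_kestenOf (measurableSet_restrict_eq n t)]
  calc kestenData p h hc.mean_ne_top (kestenOf ⁻¹' {s | restrict n s = restrict n t})
      ≤ kestenData p h hc.mean_ne_top (⋃ v ∈ levelNodes n t,
          Set.pi (nodesBelow n t) (spineConstraint t v)) := by
        refine measure_mono_ae ?_
        filter_upwards [kestenData_ae h hc.mean_ne_top] with ω hω
        intro e
        have e' : restrict n (kestenOf ω) = restrict n t := e
        refine Set.mem_biUnion (x := specialNode ω n) ?_ fun u hu => mem_spineConstraint e' hu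
        refine mem_levelNodes.2 ⟨?_, length_specialNode ω n⟩
        exact (restrict_eq_iff.1 e' _ (length_specialNode ω n).le).1 (specialNode_mem hω n)
    _ ≤ ∑ v ∈ levelNodes n t, kestenData p h hc.mean_ne_top
          (Set.pi (nodesBelow n t) (spineConstraint t v)) := measure_biUnion_finset_le _ _
    _ = _ := by
        rw [Finset.sum_congr rfl fun v hv => kestenData_pi h hc hv, Finset.sum_const,
          nsmul_eq_mul]

/-! ### The law of the number of leaves -/

theorem measure_eq_top_eq_zero {Ω : Type*} [MeasurableSpace Ω] {P : Measure Ω}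
    [IsProbabilityMeasure P] {f : Ω → ℕ∞} (hf : Measurable f)
    (h1 : ∑' n : ℕ, P {ω | f ω = n} = 1) : P {ω | f ω = ⊤} = 0 := by
  have hU : {ω | f ω = ⊤} = (⋃ n : ℕ, {ω | f ω = n})ᶜ := by
    ext ω
    simp only [Set.mem_ofPred_eq, Set.mem_compl_iff, Set.mem_iUnion, not_exists]
    exact ⟨fun h n => by simp [h], fun h => by
      by_contra H
      obtain ⟨n, hn⟩ := ENat.ne_top_iff_exists.1 H
      exact h n hn.symm⟩
  have hm : ∀ n : ℕ, MeasurableSet {ω | f ω = n} := fun n => hf (measurableSet_singleton _)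
  rw [hU, prob_compl_eq_zero_iff (MeasurableSet.iUnion hm), measure_iUnion _ hm, h1]
  exact fun m n hmn => Set.disjoint_left.2 fun ω (h1 : _ = _) (h2 : _ = _) =>
    hmn (by exact_mod_cast h1.symm.trans h2)

section GaltonWatson

variable {Ω : Type*} [MeasurableSpace Ω] {p : PMF ℕ} {τ : Ω → PlaneTree} {P : Measure Ω}
  [IsProbabilityMeasure P]

/-- At x = 1 the constant 1 also solves the leaf equation, so uniqueness makes the number of leaves
almost surely finite. -/
theorem IsGaltonWatsonTree.tsum_leaves (hτ : IsGaltonWatsonTree p τ P) (hp : NonDegenerate p)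
    (hc : IsCritical p) : ∑' n : ℕ, P {ω | (τ ω).numLeaves = n} = 1 := by
  have h1 : leafGen τ P 1 = 1 := by
    refine eq_of_add_eq_pgf_add hp hc (lintegral_xpow_le_one le_rfl _) le_rfl (p.apply_ne_top 0)
      (b := p 0 * 1) ?_ (hτ.leafGen_eq 1) ?_
    · rw [mul_one]
      exact p.apply_ne_top 0
    · rw [pgf_one, mul_one]
  have hL : Measurable fun ω => (τ ω).numLeaves := measurable_numLeaves.comp hτ.measurable
  rw [leafGen, lintegral_xpow P hL] at h1
  simpa using h1

/-- The law of the number of leaves of a critical Galton–Watson tree. -/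
noncomputable def leafLaw (hτ : IsGaltonWatsonTree p τ P) (hp : NonDegenerate p)
    (hc : IsCritical p) : PMF ℕ :=
  ⟨fun n => P {ω | (τ ω).numLeaves = n}, by
    rw [ENNReal.summable.hasSum_iff]
    exact hτ.tsum_leaves hp hc⟩

theorem pgf_leafLaw (hτ : IsGaltonWatsonTree p τ P) (hp : NonDegenerate p) (hc : IsCritical p)
    (x : ℝ≥0∞) : pgf (leafLaw hτ hp hc) x = leafGen τ P x :=
  (lintegral_xpow P (measurable_numLeaves.comp hτ.measurable) x).symm

/-- Substitute F + p(0) = φ(F) + p(0)x into `leafOffspring_pgf` at F; the finite term ψ(F)φ(F)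
cancels, leaving p(0)F = p(0)xψ(F). -/
theorem isTotalProgeny_leafLaw (hτ : IsGaltonWatsonTree p τ P) (hp : NonDegenerate p)
    (hc : IsCritical p) : IsTotalProgeny (leafOffspring p hp) (leafLaw hτ hp hc) := by
  intro x hx
  rw [pgf_leafLaw]
  set F := leafGen τ P x
  have hF1 : F ≤ 1 := lintegral_xpow_le_one hx.le _
  have h1 := leafOffspring_pgf hp F
  rw [hτ.leafGen_eq x, mul_add, add_comm] at h1
  have hfin : pgf (leafOffspring p hp) F * pgf p F ≠ ∞ :=
    ne_top_of_le_ne_top ENNReal.one_ne_top (mul_le_one' (pgf_le_one _ hF1) (pgf_le_one _ hF1))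
  rw [ENNReal.add_left_inj hfin] at h1
  have h2 : p 0 * F = p 0 * (x * pgf (leafOffspring p hp) F) := by
    rw [← h1]
    ring
  exact (ENNReal.mul_right_inj hp.zero_pos.ne' (p.apply_ne_top 0)).1 h2

/-- Conversely, S = xψ(S) implies the leaf equation after division by ψ(S), which is positive
because ψ has a positive constant term. Uniqueness concludes. -/
theorem sizeGen_eq_leafGen (hτ : IsGaltonWatsonTree p τ P) (hp : NonDegenerate p)
    (hc : IsCritical p) {Ω₀ : Type*} [MeasurableSpace Ω₀] {P₀ : Measure Ω₀}
    [IsProbabilityMeasure P₀] {τ₀ : Ω₀ → PlaneTree}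
    (hτ₀ : IsGaltonWatsonTree (leafOffspring p hp) τ₀ P₀) {x : ℝ≥0∞} (hx : x ≤ 1) :
    leafGen τ P x = sizeGen τ₀ P₀ x := by
  have hS1 : sizeGen τ₀ P₀ x ≤ 1 := lintegral_xpow_le_one hx _
  refine eq_of_add_eq_pgf_add hp hc (lintegral_xpow_le_one hx _) hS1 (p.apply_ne_top 0)
    (b := p 0 * x) (ENNReal.mul_ne_top (p.apply_ne_top 0)
      (ne_top_of_le_ne_top ENNReal.one_ne_top hx)) (hτ.leafGen_eq x) ?_
  have hS := hτ₀.sizeGen_eq x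
  set S := sizeGen τ₀ P₀ x
  have h1 := leafOffspring_pgf hp S
  have hψ0 : pgf (leafOffspring p hp) S ≠ 0 := by
    have hle : leafOffspring p hp 0 * S ^ 0 ≤ pgf (leafOffspring p hp) S :=
      ENNReal.le_tsum (f := fun n => leafOffspring p hp n * S ^ n) 0
    rw [pow_zero, mul_one] at hle
    exact ((leafOffspring_nonDegenerate hp hc).zero_pos.trans_le hle).ne'
  have hψt : pgf (leafOffspring p hp) S ≠ ∞ :=
    ne_top_of_le_ne_top ENNReal.one_ne_top (pgf_le_one _ hS1)
  refine (ENNReal.mul_right_inj hψ0 hψt).1 ?_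
  rw [h1]
  nth_rewrite 1 [hS]
  ring

theorem identDistrib_numLeaves_size (hτ : IsGaltonWatsonTree p τ P) (hp : NonDegenerate p)
    (hc : IsCritical p) {Ω₀ : Type*} [MeasurableSpace Ω₀] {P₀ : Measure Ω₀}
    [IsProbabilityMeasure P₀] {τ₀ : Ω₀ → PlaneTree}
    (hτ₀ : IsGaltonWatsonTree (leafOffspring p hp) τ₀ P₀) :
    IdentDistrib (fun ω => (τ ω).numLeaves) (fun ω => (τ₀ ω).size) P P₀ := by
  have hL : Measurable fun ω => (τ ω).numLeaves := measurable_numLeaves.comp hτ.measurable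
  have hS : Measurable fun ω => (τ₀ ω).size := measurable_size.comp hτ₀.measurable
  have hgen : ∀ x ≤ 1, ∑' n : ℕ, P {ω | (τ ω).numLeaves = n} * x ^ n =
      ∑' n : ℕ, P₀ {ω | (τ₀ ω).size = n} * x ^ n := fun x hx => by
    rw [← lintegral_xpow P hL, ← lintegral_xpow P₀ hS]
    exact sizeGen_eq_leafGen hτ hp hc hτ₀ hx
  have h1 := hτ.tsum_leaves hp hc
  have h2 : ∑' n : ℕ, P₀ {ω | (τ₀ ω).size = n} = 1 := by
    have := hgen 1 le_rfl
    simp only [one_pow, mul_one] at this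
    rw [← this, h1]
  have hn := coeff_eq_of_tsum_mul_pow_eq (h1 ▸ ENNReal.one_ne_top) (h2 ▸ ENNReal.one_ne_top)
    fun x hx => hgen x hx.le
  refine ⟨hL.aemeasurable, hS.aemeasurable, Measure.ext_of_singleton fun m => ?_⟩
  rw [Measure.map_apply hL (measurableSet_singleton m),
    Measure.map_apply hS (measurableSet_singleton m)]
  induction m using ENat.recTopCoe with
  | top => exact (measure_eq_top_eq_zero hL h1).trans (measure_eq_top_eq_zero hS h2).symm
  | coe n => exact hn n

/-! ### Conditioning on the number of leaves -/

/-- The event that the number of leaves belongs to `n + D`. -/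
def leafEvent (τ : Ω → PlaneTree) (D : Set ℕ) (n : ℕ) : Set Ω :=
  {ω | ∃ k : ℕ, (τ ω).numLeaves = k ∧ n ≤ k ∧ k - n ∈ D}

theorem measurableSet_leafEvent (hτ : Measurable τ) (D : Set ℕ) (n : ℕ) :
    MeasurableSet (leafEvent τ D n) := by
  have : MeasurableSet {m : ℕ∞ | ∃ k : ℕ, m = k ∧ n ≤ k ∧ k - n ∈ D} := MeasurableSet.of_discrete
  exact (measurable_numLeaves.comp hτ) this

theorem measure_inter_leafEvent {P : Measure Ω} (hτ : Measurable τ) (A : Set Ω) (D : Set ℕ) (n : ℕ) :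
    P (leafEvent τ D n ∩ A) =
      ∑' k : ℕ, P.restrict A {ω | (τ ω).numLeaves = k} * window D n k := by
  classical
  have hm : ∀ k : ℕ, MeasurableSet {ω | (τ ω).numLeaves = k} := fun k =>
    (measurable_numLeaves.comp hτ) (measurableSet_singleton _)
  have hU : leafEvent τ D n = ⋃ k : ℕ, (if n ≤ k ∧ k - n ∈ D then {ω | (τ ω).numLeaves = k}
      else ∅) := by
    ext ω
    simp only [leafEvent, Set.mem_ofPred_eq, Set.mem_iUnion]
    refine exists_congr fun k => ?_
    split_ifs with hk <;> simp [hk]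
  rw [← Measure.restrict_apply (measurableSet_leafEvent hτ D n), hU, measure_iUnion]
  · refine tsum_congr fun k => ?_
    rw [window]
    split_ifs <;> simp
  · intro i j hij
    refine Set.disjoint_left.2 fun ω h1 h2 => hij ?_
    dsimp only at h1 h2
    split_ifs at h1 h2
    · have h1' : (τ ω).numLeaves = i := h1
      have h2' : (τ ω).numLeaves = j := h2
      exact_mod_cast h1'.symm.trans h2'
    all_goals first | exact absurd h1 (Set.notMem_empty _) | exact absurd h2 (Set.notMem_empty _)
  · intro k
    split_ifs
    · exact hm k
    · exact MeasurableSet.empty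

theorem measure_leafEvent (hτ : IsGaltonWatsonTree p τ P) (hp : NonDegenerate p)
    (hc : IsCritical p) (D : Set ℕ) (n : ℕ) :
    P (leafEvent τ D n) = windowMass (leafLaw hτ hp hc) D n := by
  have := measure_inter_leafEvent (P := P) hτ.measurable Set.univ D n
  rw [Set.inter_univ, Measure.restrict_univ] at this
  exact this

/-- The coefficientwise form of `lintegral_restrict_eq`; n ≥ ℓ makes n - ℓ a true difference. -/
theorem exists_measure_restrict_inter_leafEvent (hτ : IsGaltonWatsonTree p τ P)
    (hp : NonDegenerate p) (hc : IsCritical p) (D : Set ℕ) (h : ℕ) (t : PlaneTree) :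
    ∃ ℓ : ℕ, ∀ n ≥ ℓ, P (leafEvent τ D n ∩ {ω | restrict h (τ ω) = restrict h t}) =
      weight p h t *
        windowMass (sumLaw (leafLaw hτ hp hc) (levelNodes h t).card) D (n - ℓ) := by
  obtain ⟨ℓ, hℓ⟩ := hτ.lintegral_restrict_eq h t
  refine ⟨ℓ, fun n hn => ?_⟩
  set A := {ω | restrict h (τ ω) = restrict h t}
  set q := sumLaw (leafLaw hτ hp hc) (levelNodes h t).card with hq
  have hw : weight p h t ≤ 1 := Finset.prod_le_one' fun u _ => PMF.coe_le_one p _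
  have hL : Measurable fun ω => (τ ω).numLeaves := measurable_numLeaves.comp hτ.measurable
  have hsum : ∀ g : ℕ → ℝ≥0∞, ∑' k, weight p h t * (q.map fun m => ℓ + m) k * g k =
      weight p h t * ∑' m, q m * g (ℓ + m) := fun g => by
    simp only [mul_assoc]
    rw [ENNReal.tsum_mul_left, tsum_map_mul]
  have hcoeff : ∀ k : ℕ, P.restrict A {ω | (τ ω).numLeaves = k} =
      weight p h t * (q.map fun m => ℓ + m) k := by
    refine coeff_eq_of_tsum_mul_pow_eq ?_ ?_ fun x hx => ?_
    · refine ne_top_of_le_ne_top ENNReal.one_ne_top ?_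
      rw [← hτ.tsum_leaves hp hc]
      exact ENNReal.tsum_le_tsum fun k => Measure.restrict_apply_le _ _
    · rw [ENNReal.tsum_mul_left, PMF.tsum_coe, mul_one]
      exact ne_top_of_le_ne_top ENNReal.one_ne_top hw
    · rw [← lintegral_xpow _ hL, hℓ x, hsum fun k => x ^ k, ← pgf_leafLaw hτ hp hc, ← pgf_sumLaw,
        ← hq, pgf, ← ENNReal.tsum_mul_left]
      congr 1
      exact tsum_congr fun m => by ring
  rw [measure_inter_leafEvent hτ.measurable]
  simp only [hcoeff]
  rw [hsum, windowMass]
  congr 1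
  exact tsum_congr fun m => by rw [window_sub D hn]

/-! ### Convergence in distribution -/

/-- An open set is the increasing union over h of the cylinders of height h which it contains. These
are countably many and disjoint, so Fatou's lemma passes from cylinders to their union. -/
theorem measure_isOpen_le_liminf {K : Measure PlaneTree} {μ : ℕ → Measure PlaneTree}
    (H : ∀ h t, K {s | restrict h s = restrict h t} ≤
      liminf (fun n => μ n {s | restrict h s = restrict h t}) atTop)
    {U : Set PlaneTree} (hU : IsOpen U) : K U ≤ liminf (fun n => μ n U) atTop := by
  let V : ℕ → Set PlaneTree := fun h => {t | ∀ s, restrict h s = restrict h t → s ∈ U}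
  have hVU : ∀ h, V h ⊆ U := fun h t ht => ht t rfl
  have hmono : Monotone V := fun h k hhk t ht s hs => ht s (restrict_mono hhk hs)
  have hUV : U = ⋃ h, V h := by
    refine Set.Subset.antisymm (fun t ht => ?_) (Set.iUnion_subset hVU)
    exact Set.mem_iUnion.2 (isOpen_iff_restrict.1 hU t ht)
  have hV : ∀ h, K (V h) ≤ liminf (fun n => μ n U) atTop := by
    intro h
    have hcount : (restrict h '' V h).Countable :=
      (countable_range_restrict h).mono (Set.image_subset_range _ _)
    have hVe : V h = ⋃ c ∈ restrict h '' V h, {s | restrict h s = c} := by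
      ext s
      simp only [Set.mem_iUnion, Set.mem_ofPred_eq, exists_prop]
      constructor
      · exact fun hs => ⟨_, Set.mem_image_of_mem _ hs, rfl⟩
      · rintro ⟨_, ⟨t, ht, rfl⟩, hs⟩ s' hs'
        exact ht s' (hs'.trans hs)
    have hmeas : ∀ ν : Measure PlaneTree, ν (V h) =
        ∑' c : restrict h '' V h, ν {s | restrict h s = c} := fun ν => by
      nth_rewrite 1 [hVe]
      refine measure_biUnion hcount ?_ ?_
      · exact fun c _ c' _ hcc => Set.disjoint_left.2 fun s (h1 : _ = _) (h2 : _ = _) =>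
          hcc (h1.symm.trans h2)
      · rintro _ ⟨t, _, rfl⟩
        exact measurableSet_restrict_eq h t
    have : Countable (restrict h '' V h) := hcount.to_subtype
    calc K (V h) = ∑' c : restrict h '' V h, K {s | restrict h s = c} := hmeas K
      _ ≤ ∑' c : restrict h '' V h, 1 * liminf (fun n => μ n {s | restrict h s = c}) atTop := by
          refine ENNReal.tsum_le_tsum fun c => ?_
          obtain ⟨_, t, _, rfl⟩ := c
          rw [one_mul]
          exact H h t
      _ ≤ liminf (fun n => ∑' c : restrict h '' V h, 1 * μ n {s | restrict h s = c}) atTop :=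
          tsum_mul_liminf_le (fun _ => ENNReal.one_ne_top) _
      _ ≤ liminf (fun n => μ n U) atTop := by
          refine liminf_le_liminf (Eventually.of_forall fun n => ?_)
          simp only [one_mul, ← hmeas]
          exact measure_mono (hVU h)
  have hK : K U = ⨆ h, K (V h) := by rw [← hmono.measure_iUnion, ← hUV]
  rw [hK]
  exact iSup_le hV

/-- The conditional mass of a cylinder is its weight times a ratio of window masses whose liminf is
at least the number of vertices at the cut height. The events `B n` are taken up to null sets, since
{L₀(τ) ≥ n} contains the trees with infinitely many leaves. -/
theorem tendstoInDistribution_of_longTailed (hτ : IsGaltonWatsonTree p τ P)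
    (hp : NonDegenerate p) (hc : IsCritical p) {Ω' : Type*} [MeasurableSpace Ω']
    {P' : Measure Ω'} [IsProbabilityMeasure P'] {τstar : Ω' → PlaneTree}
    (hτstar : HasLaw τstar (kestenLaw p hp hc.mean_ne_top) P') {D : Set ℕ}
    (hD : LongTailed (leafLaw hτ hp hc) D) {B : ℕ → Set Ω}
    (hBm : ∀ n, MeasurableSet (B n)) (hB : ∀ n, B n =ᵐ[P] leafEvent τ D n) {S : ℕ → Type*}
    [∀ n, MeasurableSpace (S n)] {Q : ∀ n, Measure (S n)} [∀ n, IsProbabilityMeasure (Q n)]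
    {T : ∀ n, S n → PlaneTree} (hT : ∀ n, Measurable (T n))
    (hQ : ∀ n, P (B n) ≠ 0 → (Q n).map (T n) = (P[|B n]).map τ) :
    TendstoInDistribution T atTop τstar Q P' := by
  refine ⟨fun n => (hT n).aemeasurable, hτstar.aemeasurable, ?_⟩
  -- For probability measures, lower bounds on open sets suffice, so no upper bound on window masses
  -- is required.
  refine tendsto_of_forall_isOpen_le_liminf' fun U hU => ?_
  change P'.map τstar U ≤ liminf (fun n => (Q n).map (T n) U) atTop
  rw [hτstar.map_eq]
  refine measure_isOpen_le_liminf (fun h t => ?_) hU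
  obtain ⟨ℓ, hℓ⟩ := exists_measure_restrict_inter_leafEvent hτ hp hc D h t
  have hwt : weight p h t ≠ ∞ := ne_top_of_le_ne_top ENNReal.one_ne_top
    (Finset.prod_le_one' fun u _ => PMF.coe_le_one p _)
  calc kestenLaw p hp hc.mean_ne_top {s | restrict h s = restrict h t}
      ≤ weight p h t * (levelNodes h t).card :=
        (kestenLaw_restrict_le hp hc h t).trans_eq (mul_comm _ _)
    _ ≤ weight p h t * liminf (fun n =>
          windowMass (sumLaw (leafLaw hτ hp hc) (levelNodes h t).card) D (n - ℓ) /
            windowMass (leafLaw hτ hp hc) D n) atTop := by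
        gcongr
        exact hD.le_liminf _ ℓ
    _ = liminf (fun n => weight p h t *
          (windowMass (sumLaw (leafLaw hτ hp hc) (levelNodes h t).card) D (n - ℓ) /
            windowMass (leafLaw hτ hp hc) D n)) atTop :=
        (ENNReal.liminf_const_mul_of_ne_top hwt).symm
    _ ≤ _ := by
        refine liminf_le_liminf ?_
        filter_upwards [eventually_ge_atTop ℓ, hD.eventually_ne_zero] with n hn hn0
        have hPB : P (B n) = windowMass (leafLaw hτ hp hc) D n := by
          rw [measure_congr (hB n), measure_leafEvent hτ hp hc]
        have hPA : P (B n ∩ {ω | restrict h (τ ω) = restrict h t}) =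
            P (leafEvent τ D n ∩ {ω | restrict h (τ ω) = restrict h t}) :=
          measure_congr ((hB n).inter (ae_eq_refl _))
        rw [hQ n (hPB ▸ hn0), Measure.map_apply hτ.measurable (measurableSet_restrict_eq h t),
          cond_apply (hBm n)]
        change _ ≤ (P (B n))⁻¹ * P (B n ∩ {ω | restrict h (τ ω) = restrict h t})
        rw [hPA, hℓ n hn, hPB, ENNReal.div_eq_inv_mul, mul_left_comm]

end GaltonWatson

end RandomTree

/-! ### Assembly of the three statements -/

theorem mainTheorem7
    (p : PMF ℕ) (hp : NonDegenerate p) (hcrit : IsCritical p)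
    {Ω : Type*} [MeasurableSpace Ω] (P : Measure Ω) [IsProbabilityMeasure P]
    (τ : Ω → PlaneTree) (hτ : IsGaltonWatsonTree p τ P)
    {Ω' : Type*} [MeasurableSpace Ω'] (P' : Measure Ω') [IsProbabilityMeasure P']
    (τstar : Ω' → PlaneTree) (hτstar : HasLaw τstar (kestenLaw p hp hcrit.mean_ne_top) P') :
    -- the leaves of `τ` are distributed as the vertices of a critical Galton–Watson tree
    (NonDegenerate (leafOffspring p hp) ∧ IsCritical (leafOffspring p hp) ∧
      ∀ (Ω₀ : Type*) [MeasurableSpace Ω₀] (P₀ : Measure Ω₀) [IsProbabilityMeasure P₀]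
        (τ₀ : Ω₀ → PlaneTree), IsGaltonWatsonTree (leafOffspring p hp) τ₀ P₀ →
        IdentDistrib (fun ω => (τ ω).numLeaves) (fun ω => (τ₀ ω).size) P P₀) ∧
    -- conditioning on `L₀(τ) ∈ [n, n + d₀)`
    ((∀ᶠ n : ℕ in atTop, P {ω | (n : ℕ∞) ≤ (τ ω).numLeaves ∧
        (τ ω).numLeaves < ((n + period (leafOffspring p hp) : ℕ) : ℕ∞)} ≠ 0) ∧
      ∀ (S : ℕ → Type*) [∀ n, MeasurableSpace (S n)] (Q : ∀ n, Measure (S n))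
        [∀ n, IsProbabilityMeasure (Q n)] (T : ∀ n, S n → PlaneTree),
        (∀ n, Measurable (T n)) →
        (∀ n : ℕ, P {ω | (n : ℕ∞) ≤ (τ ω).numLeaves ∧
            (τ ω).numLeaves < ((n + period (leafOffspring p hp) : ℕ) : ℕ∞)} ≠ 0 →
          (Q n).map (T n) = (P[|{ω | (n : ℕ∞) ≤ (τ ω).numLeaves ∧
            (τ ω).numLeaves < ((n + period (leafOffspring p hp) : ℕ) : ℕ∞)}]).map τ) →
        TendstoInDistribution T atTop τstar Q P') ∧
    -- conditioning on `L₀(τ) ≥ n`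
    ((∀ n : ℕ, P {ω | (n : ℕ∞) ≤ (τ ω).numLeaves} ≠ 0) ∧
      ∀ (S : ℕ → Type*) [∀ n, MeasurableSpace (S n)] (Q : ∀ n, Measure (S n))
        [∀ n, IsProbabilityMeasure (Q n)] (T : ∀ n, S n → PlaneTree),
        (∀ n, Measurable (T n)) →
        (∀ n : ℕ, (Q n).map (T n) = (P[|{ω | (n : ℕ∞) ≤ (τ ω).numLeaves}]).map τ) →
        TendstoInDistribution T atTop τstar Q P') := by
  have hv := isTotalProgeny_leafLaw hτ hp hcrit
  have hq := leafOffspring_nonDegenerate hp hcrit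
  have hqc := leafOffspring_isCritical hp hcrit
  have hL : Measurable fun ω => (τ ω).numLeaves := measurable_numLeaves.comp hτ.measurable
  have hev1 : ∀ n : ℕ, {ω | (n : ℕ∞) ≤ (τ ω).numLeaves ∧
      (τ ω).numLeaves < ((n + period (leafOffspring p hp) : ℕ) : ℕ∞)} =
      leafEvent τ (Set.Iio (period (leafOffspring p hp))) n := by
    intro n
    ext ω
    simp only [leafEvent, Set.mem_ofPred_eq, Set.mem_Iio]
    constructor
    · rintro ⟨h1, h2⟩
      obtain ⟨k, hk⟩ := ENat.ne_top_iff_exists.1 h2.ne_top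
      rw [← hk] at h1 h2 ⊢
      norm_cast at h1 h2
      exact ⟨k, rfl, h1, by omega⟩
    · rintro ⟨k, hk, h1, h2⟩
      rw [hk]
      norm_cast
      omega
  have hev2 : ∀ n : ℕ, {ω | (n : ℕ∞) ≤ (τ ω).numLeaves} =ᵐ[P] leafEvent τ Set.univ n := by
    intro n
    have htop : ∀ᵐ ω ∂P, (τ ω).numLeaves ≠ ⊤ := by
      rw [ae_iff]
      simpa using measure_eq_top_eq_zero hL (hτ.tsum_leaves hp hcrit)
    filter_upwards [htop] with ω hω
    obtain ⟨k, hk⟩ := ENat.ne_top_iff_exists.1 hω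
    refine propext ?_
    change (n : ℕ∞) ≤ (τ ω).numLeaves ↔ ∃ k : ℕ, (τ ω).numLeaves = k ∧ n ≤ k ∧ k - n ∈ Set.univ
    rw [← hk]
    constructor
    · exact fun h => ⟨k, rfl, by exact_mod_cast h, trivial⟩
    · rintro ⟨j, hj, h1, _⟩
      rw [hj]
      exact_mod_cast h1
  have hm2 : ∀ n : ℕ, MeasurableSet {ω | (n : ℕ∞) ≤ (τ ω).numLeaves} := fun n =>
    hL (MeasurableSet.of_discrete (s := {m : ℕ∞ | (n : ℕ∞) ≤ m}))
  -- The progeny law charges d(n + m) + 1, with d the period and m the threshold beyond which all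
  -- multiples of d are reached.
  have hmass : ∀ n, windowMass (leafLaw hτ hp hcrit) Set.univ n ≠ 0 := by
    intro n H
    obtain ⟨m, hm⟩ := hv.exists_forall_pos hq
    have hd := period_pos hq
    set d := period (leafOffspring p hp)
    have hmd : n + m ≤ d * (n + m) := Nat.le_mul_of_pos_left _ hd
    have h1 := ENNReal.tsum_eq_zero.1 H (d * (n + m) + 1)
    rw [mul_eq_zero] at h1
    refine h1.elim (hm _ (by omega) (dvd_mul_right _ _)) fun hw => ?_
    rw [window, if_pos ⟨by omega, trivial⟩] at hw
    exact one_ne_zero hw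
  have hpos2 : ∀ n : ℕ, P {ω | (n : ℕ∞) ≤ (τ ω).numLeaves} ≠ 0 := fun n => by
    rw [measure_congr (hev2 n), measure_leafEvent hτ hp hcrit]
    exact hmass n
  have hlt := hv.longTailed_Iio hq hqc
  refine ⟨⟨hq, hqc, fun Ω₀ _ P₀ _ τ₀ hτ₀ => identDistrib_numLeaves_size hτ hp hcrit hτ₀⟩,
    ⟨?_, ?_⟩, hpos2, ?_⟩
  · filter_upwards [hlt.eventually_ne_zero] with n hn
    rwa [hev1, measure_leafEvent hτ hp hcrit]
  · intro S _ Q _ T hT hQ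
    simp only [hev1] at hQ
    exact tendstoInDistribution_of_longTailed hτ hp hcrit hτstar hlt
      (fun n => measurableSet_leafEvent hτ.measurable _ n) (fun n => ae_eq_refl _) hT hQ
  · intro S _ Q _ T hT hQ
    exact tendstoInDistribution_of_longTailed hτ hp hcrit hτstar (longTailed_univ hmass) hm2 hev2
      hT fun n _ => hQ n
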